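/- Let $V$ be a finite-dimensional $\mathbb{Q}$-vector space with a non-degenerate, indefinite symmetric bilinear form $Q$, let $w$ be a positive even integer and let $\mathbf{h}=(h^{p,w-p})_{0\le p\le w}$ be Hodge numbers with $h^{w/2,w/2}\neq 0$. Let $G=O(V_\mathbb{R},Q)$, and let $\mathbb{D}$ be the period domain of Hodge structures of weight $w$ and type $\mathbf{h}$ on $V_\mathbb{R}$, with Hodge filtration $F^\bullet$ and Weil operator $C$ (multiplication by $i^{p-q}$ on $V^{p,q}$), such that $Q(F^p,F^{w-p+1})=0$ and $Q(Cu,\overline{u})>0$ for all non-zero $u\in V_\mathbb{C}$. It is a complex manifold on which $G$ acts. Let $\mathcal{F}$ be the holomorphic vector bundle on $\mathbb{D}$ with fibre $F^{w/2+1}$, with the hermitian metric $(u,u')=2Q(Cu,\overline{u'})$. For $v\in V_\mathbb{R}$ let $s_v:\mathcal{F}\to\mathcal{O}_\mathbb{D}$ be $s_v(u)=Q(u,v)$. For $r\geq 1$ and $v_1,\dots,v_r\in V_\mathbb{R}$ let $K(v_1,\dots,v_r)=\wedge(\mathcal{F}^{\oplus r})$ be the Koszul complex of $s=(s_{v_1},\dots,s_{v_r}):\mathcal{F}^{\oplus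 r}\to\mathcal{O}_\mathbb{D}$, with the induced hermitian metric and its Chern connection $\nabla$, graded by even and odd exterior powers. Let $s^*$ be the adjoint of its differential $s$, let $\nabla_{v_1,\dots,v_r}=\nabla+i\sqrt{2\pi}\,(s+s^*)$ (a superconnection), and put $$\varphi(v_1,\dots,v_r)=e^{-\pi\sum_i Q(v_i,v_i)}\,\mathrm{tr}_s\bigl(e^{\nabla_{v_1,\dots,v_r}^2}\bigr),$$ where $\mathrm{tr}_s$ is the supertrace. This is a well-defined smooth complex differential form on $\mathbb{D}$: it can be computed in any local holomorphic frame of $\mathcal{F}$. Give $\mathcal{F}^\vee$ the dual hermitian metric and its Chern connection $\nabla$, and write $c^{top}(\mathcal{F}^\vee,\nabla)=\det(\nabla^2)$ and $Td(\mathcal{F}^\vee,\nabla)=\det\bigl(\nabla^2/(1-e^{-\nabla^2})\bigr)$. Then: (a) $\varphi(v_1,\dots,v_r)$ is closed. (b) For every $g\in G$, $g^*\varphi(gv_1,\dots,gv_r)=\varphi(v_1,\dots,v_r)$. (c) The component of $\varphi(v_1,\dots,v_r)$ of degree $k$ vanishes for every $k<2r$. (d) $Td(\mathcal{F}^\vee,\nabla)$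 is invertible, and for $r=1$ and $v_1=0$, $\varphi(0)=c^{top}(\mathcal{F}^\vee,\nabla)\wedge Td(\mathcal{F}^\vee,\nabla)^{-1}$. (e) For every $k=(k_{ij})\in SO(r)$, $\varphi(v'_1,\dots,v'_r)=\varphi(v_1,\dots,v_r)$, where $v'_j=\sum_i k_{ij}v_i$, that is, $(v'_1,\dots,v'_r)=(v_1,\dots,v_r)\cdot k$. -/

import Mathlib

open scoped TensorProduct

noncomputable section

namespace PeriodForms

/-! ### Hodge structures and period domains -/

section Hodge

variable {W : Type*} [AddCommGroup W] [Module ℝ W]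

/-- The complexification of a real vector space. -/
abbrev VC (W : Type*) [AddCommGroup W] [Module ℝ W] : Type _ := ℂ ⊗[ℝ] W

/-- Complex conjugation on the complexification. -/
def conjC : VC W →ₗ[ℝ] VC W := LinearMap.rTensor W Complex.conjAe.toLinearMap

/-- The complex bilinear extension of a real bilinear form. -/
abbrev formC (B : LinearMap.BilinForm ℝ W) : LinearMap.BilinForm ℂ (VC W) := B.baseChange ℂ

/-- A real Hodge structure of weight `w` with Hodge numbers `h^{p,q}` vanishing unless
`0 ≤ p, q`: a decomposition of the complexification as the direct sum of subspaces
`V^{p,w-p} = comp p`, with `V^{w-p,p}` the conjugate of `V^{p,w-p}`. -/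
structure HodgeStructure (W : Type*) [AddCommGroup W] [Module ℝ W] (w : ℕ) where
  comp : Fin (w + 1) → Submodule ℂ (VC W)
  internal : DirectSum.IsInternal comp
  conj_mem : ∀ p, ∀ u ∈ comp p, conjC u ∈ comp p.rev

namespace HodgeStructure

variable {w : ℕ} (A : HodgeStructure W w)

/-- The Hodge filtration `F^p = ⨁_{q ≥ p} V^{q,w-q}`. -/
def F (p : ℕ) : Submodule ℂ (VC W) := ⨆ q : Fin (w + 1), ⨆ _ : p ≤ (q : ℕ), A.comp q

/-- The isomorphism of the direct sum of the `V^{p,q}` with the complexification. -/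
def sumEquiv : (DirectSum (Fin (w + 1)) fun p => A.comp p) ≃ₗ[ℂ] VC W :=
  LinearEquiv.ofBijective (DirectSum.coeLinearMap A.comp)
    (show Function.Bijective (DirectSum.coeLinearMap A.comp) from A.internal)

/-- The Weil operator `C`, acting on `V^{p,q}`, `q = w - p`, by `i^{p-q} = i^{2p-w}`. -/
def weil : VC W →ₗ[ℂ] VC W :=
  (DirectSum.toModule ℂ (Fin (w + 1)) (VC W)
      (fun p => (Complex.I ^ (2 * ((p : ℕ) : ℤ) - (w : ℤ))) • (A.comp p).subtype)) ∘ₗ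
    A.sumEquiv.symm.toLinearMap

theorem weil_of_mem {p : Fin (w + 1)} {u : VC W} (hu : u ∈ A.comp p) :
    A.weil u = (Complex.I ^ (2 * ((p : ℕ) : ℤ) - (w : ℤ))) • u := by
  have h : A.sumEquiv.symm u
      = DirectSum.lof ℂ (Fin (w + 1)) (fun p => A.comp p) p ⟨u, hu⟩ := by
    rw [LinearEquiv.symm_apply_eq, sumEquiv, LinearEquiv.ofBijective_apply,
      DirectSum.coeLinearMap_lof]
  simp only [weil, LinearMap.comp_apply, LinearEquiv.coe_coe, h, DirectSum.toModule_lof,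
    LinearMap.smul_apply, Submodule.subtype_apply]

end HodgeStructure

/-- The period domain: Hodge structures on `W` of weight `w` and type `h` (where `h p` is the
Hodge number `h^{p,w-p}`) that satisfy the two Riemann bilinear relations with respect to `B`. -/
structure PeriodDomain (B : LinearMap.BilinForm ℝ W) (w : ℕ) (h : ℕ → ℕ) extends
    HodgeStructure W w where
  finrank_comp : ∀ p : Fin (w + 1), Module.finrank ℂ (comp p) = h p
  bilinear₁ : ∀ p q : ℕ, p + q = w + 1 →
    ∀ u ∈ toHodgeStructure.F p, ∀ u' ∈ toHodgeStructure.F q, formC B u u' = 0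
  bilinear₂ : ∀ u : VC W, u ≠ 0 →
    0 < (formC B (toHodgeStructure.weil u) (conjC u)).re ∧
      (formC B (toHodgeStructure.weil u) (conjC u)).im = 0

/-- The orthogonal group of `(W, B)`. -/
def OrthGroup (B : LinearMap.BilinForm ℝ W) : Type _ :=
  {g : W ≃ₗ[ℝ] W // ∀ x y, B (g x) (g y) = B x y}

/-- The complex linear extension of a real automorphism. -/
def autC (g : W ≃ₗ[ℝ] W) : VC W ≃ₗ[ℂ] VC W := g.baseChange ℝ ℂ W W

theorem conjC_autC (g : W ≃ₗ[ℝ] W) (u : VC W) : conjC (autC g u) = autC g (conjC u) := by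
  induction u using TensorProduct.induction_on with
  | zero => simp
  | tmul a x => simp [conjC, autC]
  | add x y hx hy => simp only [map_add, hx, hy]

theorem formC_autC (B : LinearMap.BilinForm ℝ W) (g : OrthGroup B) (u u' : VC W) :
    formC B (autC g.1 u) (autC g.1 u') = formC B u u' := by
  induction u using TensorProduct.induction_on with
  | zero => simp
  | add x y hx hy => simp only [map_add, LinearMap.add_apply, hx, hy]
  | tmul a x =>
    induction u' using TensorProduct.induction_on with
    | zero => simp
    | add x y hx hy => simp only [map_add, hx, hy]
    | tmul b y => simp [autC, formC, g.2]

/-- Transport of a Hodge structure by an automorphism `g`: the pieces are `g V^{p,q}`. -/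
def HodgeStructure.act {w : ℕ} (g : W ≃ₗ[ℝ] W) (A : HodgeStructure W w) :
    HodgeStructure W w where
  comp p := (A.comp p).map (autC g).toLinearMap
  internal := by
    apply DirectSum.isInternal_submodule_of_iSupIndep_of_iSup_eq_top
    · exact (iSupIndep_map_orderIso_iff (Submodule.orderIsoMapComap (autC g))).2
        A.internal.submodule_iSupIndep
    · rw [← Submodule.map_iSup, A.internal.submodule_iSup_eq_top]
      simp
  conj_mem := by
    rintro p _ ⟨u, hu, rfl⟩
    exact ⟨conjC u, A.conj_mem p u hu, (conjC_autC g u).symm⟩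

theorem HodgeStructure.act_F {w : ℕ} (g : W ≃ₗ[ℝ] W) (A : HodgeStructure W w) (p : ℕ) :
    (A.act g).F p = (A.F p).map (autC g).toLinearMap := by
  simp only [HodgeStructure.F, Submodule.map_iSup, HodgeStructure.act]

theorem HodgeStructure.act_weil {w : ℕ} (g : W ≃ₗ[ℝ] W) (A : HodgeStructure W w) (u : VC W) :
    (A.act g).weil (autC g u) = autC g (A.weil u) := by
  have hu : u ∈ ⨆ p, A.comp p := by
    rw [A.internal.submodule_iSup_eq_top]; trivial
  induction hu using Submodule.iSup_induction' with
  | mem p x hx =>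
    have hx' : autC g x ∈ (A.act g).comp p := ⟨x, hx, rfl⟩
    rw [A.weil_of_mem hx, (A.act g).weil_of_mem hx', map_smul]
  | zero => simp
  | add x y _ _ hx hy => simp only [map_add, hx, hy]

/-- The action of the orthogonal group on the period domain. -/
def act {B : LinearMap.BilinForm ℝ W} {w : ℕ} {h : ℕ → ℕ} (g : OrthGroup B)
    (z : PeriodDomain B w h) : PeriodDomain B w h where
  toHodgeStructure := z.toHodgeStructure.act g.1
  finrank_comp p := by
    rw [← z.finrank_comp p]
    exact LinearEquiv.finrank_map_eq (autC g.1) (z.comp p)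
  bilinear₁ := by
    intro p q hpq u hu u' hu'
    rw [HodgeStructure.act_F] at hu hu'
    obtain ⟨a, ha, rfl⟩ := hu
    obtain ⟨b, hb, rfl⟩ := hu'
    exact (formC_autC B g a b).trans (z.bilinear₁ p q hpq a ha b hb)
  bilinear₂ := by
    intro u hu
    obtain ⟨a, rfl⟩ := (autC g.1).surjective u
    rw [HodgeStructure.act_weil, conjC_autC, formC_autC]
    exact z.bilinear₂ a (by rintro rfl; simp at hu)

end Hodge

/-! ### Complex differential forms on open subsets of `ℂ^N` -/

section Forms

/-- Coordinate space `ℂ^N`. -/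
abbrev Cn (N : ℕ) : Type := Fin N → ℂ

/-- The complexified cotangent space `T^* ⊗ ℂ` of `ℂ^N` at any point. -/
abbrev Cotangent (N : ℕ) : Type := Cn N →ₗ[ℝ] ℂ

/-- The exterior algebra of `T^* ⊗ ℂ`; its product is the wedge product. A complex differential
form of mixed degree on an open subset of `ℂ^N` is a function with values in it. -/
abbrev Ext (N : ℕ) : Type := ExteriorAlgebra ℂ (Cotangent N)

instance (N : ℕ) : Module.Finite ℂ (Ext N) :=
  Module.Finite.of_basis (Module.finBasis ℂ (Cotangent N)).ExteriorAlgebra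

variable {N : ℕ}

/-- The sum of a series in the finite-dimensional space `Ext N`, computed in coordinates. -/
def extSum (u : ℕ → Ext N) : Ext N :=
  ∑ k, (∑' n, (Module.finBasis ℂ (Ext N)).coord k (u n)) • Module.finBasis ℂ (Ext N) k

/-- The (real) derivative of a form in the direction of the vector `u`, with constant coefficient
forms being parallel; computed in coordinates of `Ext N`. -/
def dirDeriv (ω : Cn N → Ext N) (x u : Cn N) : Ext N :=
  ∑ k, (lineDeriv ℝ (fun y => (Module.finBasis ℂ (Ext N)).coord k (ω y)) x u) •
    Module.finBasis ℂ (Ext N) k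

/-- The one-form `dx_k`, where `z_k = x_k + i y_k`. -/
def dx (k : Fin N) : Cotangent N :=
  Complex.ofRealAm.toLinearMap ∘ₗ Complex.reLm ∘ₗ LinearMap.proj (R := ℝ) k

/-- The one-form `dy_k`, where `z_k = x_k + i y_k`. -/
def dy (k : Fin N) : Cotangent N :=
  Complex.ofRealAm.toLinearMap ∘ₗ Complex.imLm ∘ₗ LinearMap.proj (R := ℝ) k

/-- The exterior derivative `dω = ∑_k (dx_k ∧ ∂ω/∂x_k + dy_k ∧ ∂ω/∂y_k)`. -/
def extd (ω : Cn N → Ext N) (x : Cn N) : Ext N :=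
  ∑ k : Fin N,
    (ExteriorAlgebra.ι ℂ (dx k) * dirDeriv ω x (Pi.single k 1) +
      ExteriorAlgebra.ι ℂ (dy k) * dirDeriv ω x (Pi.single k Complex.I))

/-- The `(1,0)`-part `∂f` of the differential of a function. -/
def del (f : Cn N → ℂ) (x : Cn N) : Cotangent N where
  toFun u := (1 / 2 : ℂ) * (fderiv ℝ f x u - Complex.I * fderiv ℝ f x (Complex.I • u))
  map_add' u u' := by simp only [smul_add, map_add]; ring
  map_smul' c u := by
    rw [smul_comm, map_smul, map_smul]
    simp only [Complex.real_smul, RingHom.id_apply]; ring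

/-- The component of degree `k`. -/
def extDegree (k : ℕ) (α : Ext N) : Ext N :=
  (DirectSum.decompose (fun i : ℕ => ⋀[ℂ]^i (Cotangent N)) α k : Ext N)

/-- Pullback of alternating forms along a real linear map. -/
def extPullback {M : ℕ} (T : Cn M →L[ℝ] Cn N) : Ext N →ₐ[ℂ] Ext M :=
  ExteriorAlgebra.map
    { toFun := fun ξ => ξ ∘ₗ (T : Cn M →ₗ[ℝ] Cn N)
      map_add' := fun _ _ => rfl
      map_smul' := fun _ _ => rfl }

/-- Smoothness at a point of a mixed-degree form: all its coefficients are smooth. -/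
def SmoothFormAt (ω : Cn N → Ext N) (x : Cn N) : Prop :=
  ∀ l : Module.Dual ℂ (Ext N), ContDiffAt ℝ (⊤ : ℕ∞) (fun y => l (ω y)) x

end Forms

/-! ### Superconnections in a frame

A super vector bundle over an open subset of `ℂ^N` with a homogeneous frame `(ε_i)_{i : κ}`, where
`ε_i` has parity `deg i` mod `2`. An element `∑ ω_{ij} ⊗ E_{ij}` of the superalgebra
`∧T^* ⊗̂ End(E)` is the matrix `(ω_{ij})`, where `E_{ij} ε_j = ε_i`. -/

section Super

variable {N : ℕ} {κ : Type*} [Fintype κ] [DecidableEq κ]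

/-- The product of `∧T^* ⊗̂ End(E)`, following the sign rule
`(ω ⊗ u) (η ⊗ v) = (-1)^{deg η deg u} (ω ∧ η) ⊗ u v`; here `involute` acts on forms of
degree `k` by `(-1)^k`, and `E_{ij}` has parity `deg i + deg j`. -/
def superMul (deg : κ → ℕ) (S T : Matrix κ κ (Ext N)) : Matrix κ κ (Ext N) :=
  fun i k => ∑ j, S i j * ((fun α : Ext N => CliffordAlgebra.involute α)^[deg i + deg j] (T j k))

/-- Powers in `∧T^* ⊗̂ End(E)`. -/
def superPow (deg : κ → ℕ) (T : Matrix κ κ (Ext N)) : ℕ → Matrix κ κ (Ext N)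
  | 0 => 1
  | n + 1 => superMul deg T (superPow deg T n)

/-- The value `∑ c_n T^n` of a power series in `∧T^* ⊗̂ End(E)`. -/
def superSeries (deg : κ → ℕ) (c : ℕ → ℂ) (T : Matrix κ κ (Ext N)) : Matrix κ κ (Ext N) :=
  fun i j => extSum (fun n => c n • superPow deg T n i j)

/-- The exponential in `∧T^* ⊗̂ End(E)`. -/
def superExp (deg : κ → ℕ) (T : Matrix κ κ (Ext N)) : Matrix κ κ (Ext N) :=
  superSeries deg (fun n => ((n.factorial : ℂ))⁻¹) T

/-- The supertrace, `tr_s(ω ⊗ u) = ω tr_s(u)`. -/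
def superTrace (deg : κ → ℕ) (T : Matrix κ κ (Ext N)) : Ext N :=
  ∑ i, (-1 : ℂ) ^ deg i • T i i

/-- The curvature `∇² = d𝔸 + 𝔸𝔸` of the superconnection `∇ = d + 𝔸`, where `𝔸` is odd. -/
def superCurvature (deg : κ → ℕ) (A : Cn N → Matrix κ κ (Ext N)) (x : Cn N) :
    Matrix κ κ (Ext N) :=
  (Matrix.of fun i j => extd (fun y => A y i j) x) + superMul deg (A x) (A x)

/-- The connection matrix `θ`, `∇ε_j = ∑_i θ_{ij} ε_i`, of the Chern connection of a hermitian
holomorphic bundle in a holomorphic frame with Gram matrix `H_{ij} = (ε_i, ε_j)`; it is the matrix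
of `(1,0)`-forms with `∂H_{jk} = ∑_i θ_{ij} H_{ik}`. -/
def chernConnection (H : Cn N → Matrix κ κ ℂ) (x : Cn N) : Matrix κ κ (Cotangent N) :=
  fun i j => ∑ k, ((H x)⁻¹ k i) • del (fun y => H y j k) x

/-- The matrix of the adjoint of the endomorphism with matrix `D`, with respect to the hermitian
form with Gram matrix `H`: `(D ε_j, ε_k) = (ε_j, D^* ε_k)`. -/
def adjointMatrix (H D : Matrix κ κ ℂ) : Matrix κ κ ℂ := (H⁻¹ * D.transpose * H).map star

/-- The superconnection `∇ + i √(2π) (D + D^*)`, with `∇` the Chern connection, attached to a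
complex of hermitian holomorphic bundles with Gram matrix `H` and differential `D`. -/
def superconnection (H D : Cn N → Matrix κ κ ℂ) (x : Cn N) : Matrix κ κ (Ext N) :=
  fun i j => ExteriorAlgebra.ι ℂ (chernConnection H x i j) +
    algebraMap ℂ (Ext N)
      (Complex.I * (Real.sqrt (2 * Real.pi) : ℂ) * (D x i j + adjointMatrix (H x) (D x) i j))

/-- The Chern form `tr_s(e^{∇²})` of this superconnection. -/
def chernForm (deg : κ → ℕ) (H D : Cn N → Matrix κ κ ℂ) (x : Cn N) : Ext N :=
  superTrace deg (superExp deg (superCurvature deg (superconnection H D) x))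

/-- The curvature matrix of the Chern connection of a hermitian holomorphic bundle. -/
def bundleCurvature (H : Cn N → Matrix κ κ ℂ) (x : Cn N) : Matrix κ κ (Ext N) :=
  superCurvature (fun _ => 0)
    (fun y => Matrix.of fun i j => ExteriorAlgebra.ι ℂ (chernConnection H y i j)) x

/-- The determinant (Leibniz formula) of a matrix of forms of even degree. -/
def formDet {n : ℕ} (M : Matrix (Fin n) (Fin n) (Ext N)) : Ext N :=
  ∑ σ : Equiv.Perm (Fin n), (Equiv.Perm.sign σ : ℤ) • (List.ofFn fun i => M (σ i) i).prod

/-- The form `c^{top} = det(∇²)`. -/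
def topChernForm {n : ℕ} (H : Cn N → Matrix (Fin n) (Fin n) ℂ) (x : Cn N) : Ext N :=
  formDet (bundleCurvature H x)

/-- The Todd form `det(∇² / (1 - e^{-∇²}))`; recall `t / (1 - e^{-t}) = ∑ B'_n t^n / n!`
for the Bernoulli numbers `B'_n` with `B'_1 = 1/2`. -/
def toddForm {n : ℕ} (H : Cn N → Matrix (Fin n) (Fin n) ℂ) (x : Cn N) : Ext N :=
  formDet (superSeries (fun _ => 0)
    (fun k => ((bernoulli' k : ℚ) : ℂ) / (k.factorial : ℂ)) (bundleCurvature H x))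

/-- The Gram matrix of the dual frame of `E^∨`, for the metric that makes the isomorphism of the
conjugate bundle of `E` with `E^∨`, `e ↦ (·, e)`, an isometry. -/
def dualGram (H : Matrix κ κ ℂ) : Matrix κ κ ℂ := (H⁻¹).map star

end Super

/-! ### Koszul complexes in a frame

For a bundle `E` with frame `e_1, …, e_n`, the bundle `∧E` has the frame
`e_I = e_{i_1} ∧ ⋯ ∧ e_{i_k}`, `I = {i_1 < ⋯ < i_k}`. -/

section Koszul

variable {n : ℕ}

/-- The matrix of the Koszul differential of `s = (s(e_1), …, s(e_n))`:
`d e_I = ∑_a (-1)^{a+1} s(e_{i_a}) e_{I ∖ i_a}`. -/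
def koszulMatrix (s : Fin n → ℂ) : Matrix (Finset (Fin n)) (Finset (Fin n)) ℂ :=
  fun J I => ∑ i ∈ I, if J = I.erase i then (-1) ^ (I.filter (· < i)).card * s i else 0

/-- The Gram matrix of the metric on `∧E` induced by a metric on `E` with Gram matrix `H`:
`(e_I, e_J) = det ((e_{i_a}, e_{j_b}))_{a,b}` if `|I| = |J|`, and `0` otherwise. -/
def koszulGram (H : Matrix (Fin n) (Fin n) ℂ) : Matrix (Finset (Fin n)) (Finset (Fin n)) ℂ :=
  fun I J =>
    if hJ : J.card = I.card then
      (Matrix.of fun a b : Fin I.card => H (I.orderEmbOfFin rfl a) (J.orderEmbOfFin hJ b)).det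
    else 0

/-- The Chern form `tr_s(e^{∇_s²})`, `∇_s = ∇ + i √(2π) (s + s^*)`, of the Koszul complex of
`s : E → 𝒪`, where `E` is a hermitian holomorphic bundle. -/
def koszulChernForm {N : ℕ} (H : Cn N → Matrix (Fin n) (Fin n) ℂ) (s : Cn N → Fin n → ℂ)
    (x : Cn N) : Ext N :=
  chernForm (fun I : Finset (Fin n) => I.card) (fun y => koszulGram (H y))
    (fun y => koszulMatrix (s y)) x

/-- The Gram matrix of the frame `e_{(i,a)}` (`e_a` in the `i`-th summand) of `E^{⊕ r}`, the index
set `Fin r × Fin n` being identified with `Fin (r * n)`. -/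
def sumGram (r : ℕ) (H : Matrix (Fin n) (Fin n) ℂ) : Matrix (Fin (r * n)) (Fin (r * n)) ℂ :=
  fun k l =>
    if (finProdFinEquiv.symm k).1 = (finProdFinEquiv.symm l).1 then
      H (finProdFinEquiv.symm k).2 (finProdFinEquiv.symm l).2
    else 0

/-- The functional `(s_1, …, s_r) : E^{⊕ r} → 𝒪` in the frame `e_{(i,a)}`. -/
def sumSection {r : ℕ} (s : Fin r → Fin n → ℂ) : Fin (r * n) → ℂ :=
  fun k => s (finProdFinEquiv.symm k).1 (finProdFinEquiv.symm k).2

end Koszul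

/-! ### Differential forms on the period domain

The complex structure of the period domain, an open subset of a closed submanifold of a flag
manifold, is given through its holomorphic maps: a map `f` from an open subset of `ℂ^N` is
holomorphic when the subspaces `F^p` of `f y` have, locally, bases depending holomorphically on
`y`. A differential form on the period domain is a family of differential forms on the sources of
all such maps (in particular on all coordinate charts), compatible with pullback. -/

section Domain

variable {W : Type*} [AddCommGroup W] [Module ℝ W] {B : LinearMap.BilinForm ℝ W} {w : ℕ}
  {h : ℕ → ℕ} {N : ℕ}

/-- The dimension of `F^p`. -/
def hodgeRank (w : ℕ) (h : ℕ → ℕ) (p : ℕ) : ℕ := ∑ q ∈ Finset.Icc p w, h q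

/-- `e` is, near `x`, a holomorphic frame of the pullback by `f` of the Hodge bundle `ℱ^p`. -/
def IsHolFrameAt (f : Cn N → PeriodDomain B w h) (p : ℕ)
    (e : Cn N → Fin (hodgeRank w h p) → VC W) (x : Cn N) : Prop :=
  ∀ᶠ y in nhds x,
    (∀ a, ∀ l : Module.Dual ℂ (VC W), AnalyticAt ℂ (fun y' => l (e y' a)) y) ∧
      LinearIndependent ℂ (e y) ∧ Submodule.span ℂ (Set.range (e y)) = (f y).F p

/-- Holomorphy near `x` of a map from `ℂ^N` to the period domain. -/
def HolAt (f : Cn N → PeriodDomain B w h) (x : Cn N) : Prop :=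
  ∀ p : ℕ, ∃ e : Cn N → Fin (hodgeRank w h p) → VC W, IsHolFrameAt f p e x

/-- A rule attaching to maps `f : ℂ^N → 𝔻`, holomorphic near `x`, the value at `x` of a form
(thought of as `f^* ω`). Values at other points are irrelevant. -/
abbrev FormRule (B : LinearMap.BilinForm ℝ W) (w : ℕ) (h : ℕ → ℕ) : Type _ :=
  ∀ N : ℕ, (Cn N → PeriodDomain B w h) → Cn N → Ext N

/-- The rule is a smooth differential form on the period domain: it gives smooth forms, compatible
with pullback along holomorphic changes of parameters. -/
def IsDifferentialForm (ω : FormRule B w h) : Prop :=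
  (∀ (N : ℕ) (f : Cn N → PeriodDomain B w h) (x : Cn N), HolAt f x → SmoothFormAt (ω N f) x) ∧
    ∀ (N M : ℕ) (f : Cn N → PeriodDomain B w h) (f' : Cn M → PeriodDomain B w h)
      (t : Cn M → Cn N) (y : Cn M), AnalyticAt ℂ t y → HolAt f (t y) → f' =ᶠ[nhds y] f ∘ t →
        ω M f' y = extPullback (fderiv ℝ t y) (ω N f (t y))

/-- Equality of forms on the period domain. -/
def FormEq (ω η : FormRule B w h) : Prop :=
  ∀ (N : ℕ) (f : Cn N → PeriodDomain B w h) (x : Cn N), HolAt f x → ω N f x = η N f x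

/-- The exterior derivative. -/
def formD (ω : FormRule B w h) : FormRule B w h := fun N f x => extd (ω N f) x

/-- The component of degree `k`. -/
def formDegree (k : ℕ) (ω : FormRule B w h) : FormRule B w h :=
  fun N f x => extDegree k (ω N f x)

/-- The pullback of a form by a self-map of the period domain. -/
def formPullback (Φ : PeriodDomain B w h → PeriodDomain B w h) (ω : FormRule B w h) :
    FormRule B w h := fun N f x => ω N (Φ ∘ f) x

/-- The Gram matrix of a frame of `ℱ = ℱ^{w/2+1}` for the metric `2 Q(C u, ū')`. -/
def hodgeGram (f : Cn N → PeriodDomain B w h)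
    (e : Cn N → Fin (hodgeRank w h (w / 2 + 1)) → VC W) (y : Cn N) :
    Matrix (Fin (hodgeRank w h (w / 2 + 1))) (Fin (hodgeRank w h (w / 2 + 1))) ℂ :=
  fun a b => 2 * formC B ((f y).weil (e y a)) (conjC (e y b))

/-- The form `φ(v_1, …, v_r)` computed in a local holomorphic frame `e` of `ℱ`; the section `s_v`
of `ℱ^∨` is `s_v(u) = Q(u, v)`. -/
def phiInFrame {r : ℕ} (v : Fin r → W) (f : Cn N → PeriodDomain B w h)
    (e : Cn N → Fin (hodgeRank w h (w / 2 + 1)) → VC W) (x : Cn N) : Ext N :=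
  (Real.exp (-Real.pi * ∑ i, B (v i) (v i)) : ℂ) •
    koszulChernForm (fun y => sumGram r (hodgeGram f e y))
      (fun y => sumSection fun i a => formC B (e y a) (1 ⊗ₜ[ℝ] v i)) x

open Classical in
/-- The form defined by a local expression `Ψ f e x` in holomorphic frames `e` of `ℱ`. -/
def ofFrames (Ψ : ∀ N : ℕ, (Cn N → PeriodDomain B w h) →
    (Cn N → Fin (hodgeRank w h (w / 2 + 1)) → VC W) → Cn N → Ext N) : FormRule B w h :=
  fun N f x => if hf : HolAt f x then Ψ N f (Classical.choose (hf (w / 2 + 1))) x else 0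

/-- The form `φ(v_1, …, v_r)` on the period domain. -/
def phi (w : ℕ) (h : ℕ → ℕ) {r : ℕ} (B : LinearMap.BilinForm ℝ W) (v : Fin r → W) :
    FormRule B w h := ofFrames fun _ f e x => phiInFrame v f e x

/-- The form `c^{top}(ℱ^∨, ∇)`. -/
def topChernDual (B : LinearMap.BilinForm ℝ W) (w : ℕ) (h : ℕ → ℕ) : FormRule B w h :=
  ofFrames fun _ f e x => topChernForm (fun y => dualGram (hodgeGram f e y)) x

/-- The form `Td(ℱ^∨, ∇)`. -/
def toddDual (B : LinearMap.BilinForm ℝ W) (w : ℕ) (h : ℕ → ℕ) : FormRule B w h :=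
  ofFrames fun _ f e x => toddForm (fun y => dualGram (hodgeGram f e y)) x

end Domain

end PeriodForms

end

noncomputable section

namespace PeriodForms

set_option linter.unusedSectionVars false

/-! The superalgebra `∧T^* ⊗̂ End(E)` becomes an ordinary matrix algebra over `∧T^*` when row `i` is
twisted by the `deg i`-th power of the grade involution (`superHat`). Writing ε for the parity
operator, the curvature of a superconnection with twisted matrix A is then `ε dA + A A`
(`hatCurvature`), and all the superalgebra is matrix algebra.

For a Koszul complex, let s be the section, t the vector dual to it and λ = i√(2π). The Chern
connection of `∧E` is the derivation extending that of `E` (`chernConnection_minorMat`), and the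
adjoint of contraction with s is exterior multiplication by t (`adjointMatrix_koszul`). By the
canonical anticommutation relations the curvature is `c + X` with c the scalar `λ² ∑ s_a t_a`, and X
a sum of terms in which a two-form multiplies two fermionic operators or a one-form multiplies one
(`KoszulAt.hatCurvature_eq`). So X is nilpotent and the Chern form is the finite sum `e^c ∑
tr_s(X^k)/k!` (`superTrace_superExp`).

Closedness: the Bianchi identity makes `ε dX` a commutator with the connection minus a term in dc.
Traces kill the commutator, and the remaining term cancels the derivative of `e^c`
(`extd_expTrace`).

Low degrees: in every power of X a form of degree k comes with at most k Clifford generators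
(`cliffSpan`), and the supertrace on `∧ℂⁿ` kills words in fewer than 2n of them
(`trace_parityMat_mul_word`). Here n is r times the rank of ℱ. That rank is positive: otherwise the
Weil operator is the identity and the form is positive definite (`pos_of_hodgeRank_eq_zero`),
against the existence of a negative vector.

Independence of the frame: a holomorphic change of frame g conjugates the curvature by `∧g`
(`KoszulAt.koszulChernForm_gauge`). The same lemma, with the constant matrix `k ⊗ 1`, gives
invariance under rotations. Equivariance holds since the transported frame has the same Gram matrix
and the same section. Compatibility with pullback reduces to that of d on functions and one-forms.

Value at zero: X is now the derivation of `∧E` extending the curvature R, so its exponential is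
`∧(e^R)`, whose supertrace is `det(1 - e^R)` (`sum_nilEval_exp_numMat`). The dual bundle has
curvature `P = -Rᵀ` (`bundleCurvature_dual`), and `det(1 - e^{-P}) · det(P/(1 - e^{-P})) = det P`.
Two-forms are central, so determinants can be taken over a commutative ring.

Smoothness of the metric needs an argument, as frames of the F^p are holomorphic but the Weil
operator is not: it is a combination of the projections onto F^p along the conjugate of F^{w+1-p},
which vary smoothly (`HolAt.smoothVec_proj`). -/

theorem ι_mul_eq {R L : Type*} [CommRing R] [AddCommGroup L] [Module R L] (ξ : L)
    (α : ExteriorAlgebra R L) :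
    ExteriorAlgebra.ι R ξ * α = CliffordAlgebra.involute α * ExteriorAlgebra.ι R ξ := by
  induction α using ExteriorAlgebra.induction with
  | algebraMap r => rw [AlgHom.commutes, Algebra.commutes]
  | ι η =>
    rw [CliffordAlgebra.involute_ι, neg_mul, eq_neg_iff_add_eq_zero]
    exact ExteriorAlgebra.ι_add_mul_swap ξ η
  | mul a b ha hb => rw [map_mul, ← mul_assoc, ha, mul_assoc, hb, mul_assoc]
  | add a b ha hb => rw [map_add, mul_add, add_mul, ha, hb]

/-! ### A submultiplicative norm on the exterior algebra -/

section ExtNorm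

variable (N : ℕ)

/-- The left regular representation of `Ext N`, by continuous operators in coordinates. -/
def extRep : Ext N →ₐ[ℂ]
    ((Fin (Module.finrank ℂ (Ext N)) → ℂ) →L[ℂ] (Fin (Module.finrank ℂ (Ext N)) → ℂ)) :=
  (Module.End.toContinuousLinearMap (𝕜 := ℂ) (Fin (Module.finrank ℂ (Ext N)) → ℂ)).toAlgHom.comp
    (((Module.finBasis ℂ (Ext N)).equivFun.conjAlgEquiv ℂ).toAlgHom.comp (Algebra.lmul ℂ (Ext N)))

theorem extRep_injective : Function.Injective (extRep N) := by
  unfold extRep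
  simp only [AlgHom.coe_comp]
  exact (AlgEquiv.injective _).comp ((AlgEquiv.injective _).comp Algebra.lmul_injective)

/-- A submultiplicative norm on the finite-dimensional algebra `Ext N`. -/
abbrev extNormedRing : NormedRing (Ext N) :=
  NormedRing.induced (Ext N) _ (extRep N).toRingHom (extRep_injective N)

attribute [local instance] extNormedRing

/-- The normed algebra structure of `Ext N`. -/
abbrev extNormedAlgebra : NormedAlgebra ℂ (Ext N) :=
  NormedAlgebra.induced ℂ (Ext N) _ (extRep N)

end ExtNorm

attribute [local instance] extNormedRing extNormedAlgebra

/-! ### Exterior calculus on ℂ^N -/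

section Calculus

open scoped ContDiff

variable {N : ℕ}

/-- The grade involution of the algebra of forms. -/
abbrev invol : Ext N →ₐ[ℂ] Ext N := CliffordAlgebra.involute

theorem invol_ι (ξ : Cotangent N) : invol (ExteriorAlgebra.ι ℂ ξ) = -ExteriorAlgebra.ι ℂ ξ :=
  CliffordAlgebra.involute_ι ξ

theorem commute_of_even {α : Ext N} (hα : invol α = α) (β : Ext N) : α * β = β * α := by
  induction β using ExteriorAlgebra.induction with
  | algebraMap r => rw [Algebra.commutes]
  | ι η => rw [ι_mul_eq, hα]
  | mul a b ha hb => rw [← mul_assoc, ha, mul_assoc, hb, mul_assoc]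
  | add a b ha hb => rw [mul_add, add_mul, ha, hb]

/-- The real coordinate vectors `∂/∂x_k`, `∂/∂y_k` of `ℂ^N`. -/
def coordVec : Fin N ⊕ Fin N → Cn N :=
  Sum.elim (fun k => Pi.single k 1) (fun k => Pi.single k Complex.I)

/-- The real coordinate forms `dx_k`, `dy_k` of `ℂ^N`. -/
def coordForm : Fin N ⊕ Fin N → Cotangent N := Sum.elim dx dy

/-- The `dx_k, dy_k` are the basis dual to the real coordinate vectors; this is what turns the
coordinate definition of d into statements about Fréchet derivatives. -/
theorem sum_coordForm (ξ : Cotangent N) : ∑ i, ξ (coordVec i) • coordForm i = ξ := by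
  refine LinearMap.ext fun u => ?_
  have hu : u = ∑ k : Fin N, ((u k).re • (Pi.single k 1 : Cn N) +
      (u k).im • (Pi.single k Complex.I : Cn N)) := by
    ext l
    simp [Finset.sum_apply, Pi.single_apply, Finset.sum_add_distrib]
  conv_rhs => rw [hu]
  simp only [Fintype.sum_sum_type, coordVec, coordForm, Sum.elim_inl, Sum.elim_inr, map_sum,
    map_add, map_smul, Finset.sum_add_distrib, LinearMap.add_apply, LinearMap.sum_apply,
    LinearMap.smul_apply]
  simp [dx, dy, mul_comm]

/-- The antisymmetrisation of an `Ext N`-valued linear form. -/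
def wedgeL (L : Cn N →L[ℝ] Ext N) : Ext N :=
  ∑ i, ExteriorAlgebra.ι ℂ (coordForm i) * L (coordVec i)

theorem wedgeL_of_apply {L : Cn N →L[ℝ] Ext N} {ξ : Cotangent N} {η : Ext N}
    (h : ∀ u, L u = ξ u • η) : wedgeL L = ExteriorAlgebra.ι ℂ ξ * η := by
  conv_rhs => rw [← sum_coordForm ξ]
  simp only [wedgeL, h, map_sum, Finset.sum_mul, map_smul, mul_smul_comm, smul_mul_assoc]

theorem dirDeriv_eq {α : Cn N → Ext N} {x : Cn N} (hα : DifferentiableAt ℝ α x) (u : Cn N) :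
    dirDeriv α x u = fderiv ℝ α x u := by
  unfold dirDeriv
  conv_rhs => rw [← (Module.finBasis ℂ (Ext N)).sum_repr (fderiv ℝ α x u)]
  refine Finset.sum_congr rfl fun k _ => ?_
  congr 1
  let l : Ext N →L[ℝ] ℂ :=
    (LinearMap.toContinuousLinearMap ((Module.finBasis ℂ (Ext N)).coord k)).restrictScalars ℝ
  have h1 : HasFDerivAt (fun y => l (α y)) (l.comp (fderiv ℝ α x)) x :=
    l.hasFDerivAt.comp x hα.hasFDerivAt
  exact (h1.hasLineDerivAt u).lineDeriv

/-- Bridge from the coordinatewise definition of d, which makes sense without a norm on `Ext N`, to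
the Fréchet derivative for the auxiliary norm. All rules for d are deduced from it. -/
theorem extd_eq {α : Cn N → Ext N} {x : Cn N} (hα : DifferentiableAt ℝ α x) :
    extd α x = wedgeL (fderiv ℝ α x) := by
  simp only [extd, wedgeL, Fintype.sum_sum_type, dirDeriv_eq hα, Finset.sum_add_distrib,
    coordVec, coordForm, Sum.elim_inl, Sum.elim_inr]

theorem extd_congr {α η : Cn N → Ext N} {x : Cn N} (h : α =ᶠ[nhds x] η) :
    extd α x = extd η x := by
  have : ∀ u, dirDeriv α x u = dirDeriv η x u := by
    intro u
    unfold dirDeriv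
    refine Finset.sum_congr rfl fun k _ => ?_
    congr 1
    refine Filter.EventuallyEq.lineDeriv_eq ?_
    filter_upwards [h] with y hy
    rw [hy]
  simp only [extd, this]

theorem extd_add {α η : Cn N → Ext N} {x : Cn N} (hα : DifferentiableAt ℝ α x)
    (hη : DifferentiableAt ℝ η x) :
    extd (fun y => α y + η y) x = extd α x + extd η x := by
  rw [extd_eq hα, extd_eq hη, extd_eq (hα.fun_add hη), fderiv_fun_add hα hη]
  simp [wedgeL, mul_add, Finset.sum_add_distrib]

theorem extd_sum {ι : Type*} (s : Finset ι) {α : ι → Cn N → Ext N} {x : Cn N}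
    (hα : ∀ i ∈ s, DifferentiableAt ℝ (α i) x) :
    extd (fun y => ∑ i ∈ s, α i y) x = ∑ i ∈ s, extd (α i) x := by
  rw [extd_eq (DifferentiableAt.fun_sum hα), fderiv_fun_sum hα,
    Finset.sum_congr rfl fun i hi => extd_eq (hα i hi)]
  simp only [wedgeL, sum_apply, Finset.mul_sum]
  exact Finset.sum_comm

theorem extd_const (η : Ext N) (x : Cn N) : extd (fun _ => η) x = 0 := by
  rw [extd_eq (differentiableAt_const _)]
  simp [wedgeL]

/-- The involution in the second term comes from moving the coordinate one-forms past the first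
factor with `ι_mul_eq`. -/
theorem extd_mul {α η : Cn N → Ext N} {x : Cn N} (hα : DifferentiableAt ℝ α x)
    (hη : DifferentiableAt ℝ η x) :
    extd (fun y => α y * η y) x = extd α x * η x + invol (α x) * extd η x := by
  rw [extd_eq hα, extd_eq hη, extd_eq (hα.fun_mul hη), fderiv_fun_mul' hα hη]
  simp only [wedgeL, add_apply, mul_add, Finset.sum_add_distrib,
    Finset.sum_mul, Finset.mul_sum]
  rw [add_comm]
  congr 1
  · refine Finset.sum_congr rfl fun i _ => ?_
    simp [mul_assoc]
  · refine Finset.sum_congr rfl fun i _ => ?_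
    rw [← mul_assoc, ← ι_mul_eq]
    simp [mul_assoc]

theorem extd_const_smul (c : ℂ) {α : Cn N → Ext N} {x : Cn N} (hα : DifferentiableAt ℝ α x) :
    extd (fun y => c • α y) x = c • extd α x := by
  have := extd_mul (differentiableAt_const (𝕜 := ℝ) (x := x) (algebraMap ℂ (Ext N) c)) hα
  simpa [extd_const, Algebra.smul_def] using this

theorem extd_smul_const {f : Cn N → ℂ} {x : Cn N} (hf : DifferentiableAt ℝ f x) (η : Ext N) :
    extd (fun y => f y • η) x =
      ExteriorAlgebra.ι ℂ (fderiv ℝ f x : Cn N →ₗ[ℝ] ℂ) * η := by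
  have h1 : HasFDerivAt (fun y => f y • η) ((fderiv ℝ f x).smulRight η) x :=
    hf.hasFDerivAt.smul_const η
  rw [extd_eq h1.differentiableAt, h1.fderiv]
  exact wedgeL_of_apply fun u => rfl

theorem extd_algebraMap {f : Cn N → ℂ} {x : Cn N} (hf : DifferentiableAt ℝ f x) :
    extd (fun y => algebraMap ℂ (Ext N) (f y)) x =
      ExteriorAlgebra.ι ℂ (fderiv ℝ f x : Cn N →ₗ[ℝ] ℂ) := by
  simpa [Algebra.algebraMap_eq_smul_one] using extd_smul_const hf (1 : Ext N)

theorem extd_invol {α : Cn N → Ext N} {x : Cn N} (hα : DifferentiableAt ℝ α x) :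
    extd (fun y => invol (α y)) x = -invol (extd α x) := by
  let l : Ext N →L[ℝ] Ext N :=
    (LinearMap.toContinuousLinearMap (invol (N := N)).toLinearMap).restrictScalars ℝ
  have h1 : HasFDerivAt (fun y => l (α y)) (l.comp (fderiv ℝ α x)) x :=
    l.hasFDerivAt.comp x hα.hasFDerivAt
  have h2 : extd (fun y => l (α y)) x = -invol (extd α x) := by
    rw [extd_eq h1.differentiableAt, h1.fderiv, extd_eq hα]
    simp only [wedgeL, map_sum, map_mul, invol_ι, neg_mul, Finset.sum_neg_distrib, neg_neg]
    rfl
  exact h2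

theorem extd_eventuallyEq {α : Cn N → Ext N} {x : Cn N} {n : WithTop ℕ∞} (hn : 1 ≤ n)
    (hn' : n ≠ ∞) (hα : ContDiffAt ℝ n α x) :
    extd α =ᶠ[nhds x] fun y => wedgeL (fderiv ℝ α y) := by
  filter_upwards [hα.eventually hn'] with y hy
  exact extd_eq (hy.differentiableAt (by positivity))

/-- Second derivatives are symmetric while one-forms anticommute, so the double sum equals its own
negative. -/
theorem extd_extd {α : Cn N → Ext N} {x : Cn N} (hα : ContDiffAt ℝ 2 α x) :
    extd (extd α) x = 0 := by
  rw [extd_congr (extd_eventuallyEq (by norm_num) (by decide) hα)]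
  have h1 : DifferentiableAt ℝ (fderiv ℝ α) x :=
    (hα.fderiv_right (m := 1) (by norm_num)).differentiableAt (by norm_num)
  have h2 : ∀ i : Fin N ⊕ Fin N, HasFDerivAt
      (fun y => ExteriorAlgebra.ι ℂ (coordForm i) * fderiv ℝ α y (coordVec i))
      ((ContinuousLinearMap.mul ℝ (Ext N) (ExteriorAlgebra.ι ℂ (coordForm i))).comp
        ((ContinuousLinearMap.apply ℝ (Ext N) (coordVec i)).comp
          (fderiv ℝ (fderiv ℝ α) x))) x := fun i =>
    (ContinuousLinearMap.mul ℝ (Ext N) (ExteriorAlgebra.ι ℂ (coordForm i))).hasFDerivAt.comp x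
      ((ContinuousLinearMap.apply ℝ (Ext N) (coordVec i)).hasFDerivAt.comp x h1.hasFDerivAt)
  have h3 : ∀ u v, fderiv ℝ (fderiv ℝ α) x u v = fderiv ℝ (fderiv ℝ α) x v u :=
    fun u v => (hα.isSymmSndFDerivAt (by simp)) u v
  unfold wedgeL
  rw [extd_sum _ fun i _ => (h2 i).differentiableAt,
    Finset.sum_congr rfl fun i _ => by
      rw [extd_eq (h2 i).differentiableAt, (h2 i).fderiv]]
  simp only [wedgeL, ContinuousLinearMap.comp_apply, ContinuousLinearMap.mul_apply',
    ContinuousLinearMap.apply_apply]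
  set S := ∑ i : Fin N ⊕ Fin N, ∑ j : Fin N ⊕ Fin N, ExteriorAlgebra.ι ℂ (coordForm j) *
    (ExteriorAlgebra.ι ℂ (coordForm i) *
      fderiv ℝ (fderiv ℝ α) x (coordVec j) (coordVec i)) with hS
  have h4 : S = -S := by
    conv_rhs => rw [hS, Finset.sum_comm]
    rw [hS, ← Finset.sum_neg_distrib]
    refine Finset.sum_congr rfl fun i _ => ?_
    rw [← Finset.sum_neg_distrib]
    refine Finset.sum_congr rfl fun j _ => ?_
    rw [h3, ← mul_assoc, ← mul_assoc, ← neg_mul]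
    congr 1
    rw [eq_neg_iff_add_eq_zero]
    exact ExteriorAlgebra.ι_add_mul_swap _ _
  have h5 : (2 : ℂ) • S = 0 := by
    rw [two_smul]; nth_rewrite 1 [h4]; simp
  exact (smul_eq_zero.1 h5).resolve_left two_ne_zero

theorem contDiffAt_extd {α : Cn N → Ext N} {x : Cn N} (hα : ContDiffAt ℝ ∞ α x) :
    ContDiffAt ℝ ∞ (extd α) x := by
  have h1 : ContDiffAt ℝ ∞ (fderiv ℝ α) x := hα.fderiv_right (by simp)
  have h2 : extd α =ᶠ[nhds x] fun y => wedgeL (fderiv ℝ α y) :=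
    extd_eventuallyEq (n := 1) le_rfl (by decide) (hα.of_le (by exact_mod_cast le_top))
  refine ContDiffAt.congr_of_eventuallyEq ?_ h2
  unfold wedgeL
  refine ContDiffAt.sum fun i _ => contDiffAt_const.mul ?_
  exact h1.clm_apply contDiffAt_const

theorem smoothFormAt_of_contDiffAt {α : Cn N → Ext N} {x : Cn N} (hα : ContDiffAt ℝ ∞ α x) :
    SmoothFormAt α x := fun l =>
  ((LinearMap.toContinuousLinearMap l).restrictScalars ℝ).contDiff.contDiffAt.comp x hα

end Calculus

/-! ### The operator ∂ on functions -/

section Del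

open scoped ContDiff

variable {N M : ℕ}

theorem del_apply (f : Cn N → ℂ) (x u : Cn N) :
    del f x u = (1 / 2 : ℂ) * (fderiv ℝ f x u - Complex.I * fderiv ℝ f x (Complex.I • u)) := rfl

theorem del_congr {f g : Cn N → ℂ} {x : Cn N} (h : f =ᶠ[nhds x] g) : del f x = del g x := by
  refine LinearMap.ext fun u => ?_
  rw [del_apply, del_apply, h.fderiv_eq]

theorem del_const (c : ℂ) (x : Cn N) : del (fun _ => c) x = 0 := by
  refine LinearMap.ext fun u => ?_
  simp [del_apply]

theorem del_sum {ι : Type*} (s : Finset ι) {f : ι → Cn N → ℂ} {x : Cn N}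
    (hf : ∀ i ∈ s, DifferentiableAt ℝ (f i) x) :
    del (fun y => ∑ i ∈ s, f i y) x = ∑ i ∈ s, del (f i) x := by
  refine LinearMap.ext fun u => ?_
  rw [LinearMap.sum_apply, del_apply, fderiv_fun_sum hf]
  simp only [sum_apply, del_apply]
  rw [← Finset.mul_sum, Finset.mul_sum, ← Finset.sum_sub_distrib]

theorem del_mul {f g : Cn N → ℂ} {x : Cn N} (hf : DifferentiableAt ℝ f x)
    (hg : DifferentiableAt ℝ g x) :
    del (fun y => f y * g y) x = f x • del g x + g x • del f x := by
  refine LinearMap.ext fun u => ?_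
  simp only [LinearMap.add_apply, LinearMap.smul_apply, del_apply, fderiv_fun_mul hf hg,
    add_apply, smul_apply, smul_eq_mul]
  ring

theorem fderiv_real_smul_I {E : Type*} [NormedAddCommGroup E] [NormedSpace ℂ E]
    {f : Cn N → E} {x : Cn N} (hf : DifferentiableAt ℂ f x) (u : Cn N) :
    fderiv ℝ f x (Complex.I • u) = Complex.I • fderiv ℝ f x u := by
  have h : HasFDerivAt f ((fderiv ℂ f x).restrictScalars ℝ) x :=
    hf.hasFDerivAt.restrictScalars ℝ
  rw [h.fderiv]
  simp

/-- A complex linear derivative is all of type (1,0). This is why the inhomogeneous term of a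
holomorphic change of frame is a full differential. -/
theorem del_of_holomorphic {f : Cn N → ℂ} {x : Cn N} (hf : DifferentiableAt ℂ f x) :
    del f x = (fderiv ℝ f x : Cn N →ₗ[ℝ] ℂ) := by
  refine LinearMap.ext fun u => ?_
  rw [del_apply, fderiv_real_smul_I hf, smul_eq_mul, ← mul_assoc, Complex.I_mul_I]
  simp
  ring

theorem del_star_of_holomorphic {f : Cn N → ℂ} {x : Cn N} (hf : DifferentiableAt ℂ f x) :
    del (fun y => star (f y)) x = 0 := by
  have h : HasFDerivAt (fun y => star (f y))
      ((Complex.conjCLE : ℂ →L[ℝ] ℂ).comp (fderiv ℝ f x)) x :=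
    (Complex.conjCLE : ℂ →L[ℝ] ℂ).hasFDerivAt.comp x (hf.restrictScalars ℝ).hasFDerivAt
  refine LinearMap.ext fun u => ?_
  rw [del_apply, h.fderiv]
  simp only [ContinuousLinearMap.comp_apply, fderiv_real_smul_I hf, smul_eq_mul]
  simp [← mul_assoc]

theorem del_comp_holomorphic {f : Cn N → ℂ} {t : Cn M → Cn N} {y : Cn M}
    (hf : DifferentiableAt ℝ f (t y)) (ht : DifferentiableAt ℂ t y) :
    del (fun y' => f (t y')) y = del f (t y) ∘ₗ (fderiv ℝ t y : Cn M →ₗ[ℝ] Cn N) := by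
  have h : HasFDerivAt (fun y' => f (t y')) ((fderiv ℝ f (t y)).comp (fderiv ℝ t y)) y :=
    hf.hasFDerivAt.comp y (ht.restrictScalars ℝ).hasFDerivAt
  refine LinearMap.ext fun u => ?_
  rw [LinearMap.comp_apply, del_apply, del_apply, h.fderiv]
  simp [fderiv_real_smul_I ht]

theorem ι_eq_sum_coordForm (ξ : Cotangent N) :
    ExteriorAlgebra.ι ℂ ξ = ∑ i, ξ (coordVec i) • ExteriorAlgebra.ι ℂ (coordForm i) := by
  conv_lhs => rw [← sum_coordForm ξ]
  simp only [map_sum, map_smul]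

theorem contDiffAt_ι_del {f : Cn N → ℂ} {x : Cn N} (hf : ContDiffAt ℝ ∞ f x) :
    ContDiffAt ℝ ∞ (fun y => ExteriorAlgebra.ι ℂ (del f y)) x := by
  have h1 : ContDiffAt ℝ ∞ (fderiv ℝ f) x := hf.fderiv_right (by simp)
  simp only [fun y => ι_eq_sum_coordForm (del f y), del_apply]
  refine ContDiffAt.sum fun i _ => ContDiffAt.fun_smul ?_ contDiffAt_const
  exact contDiffAt_const.mul ((h1.clm_apply contDiffAt_const).sub
    (contDiffAt_const.mul (h1.clm_apply contDiffAt_const)))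

end Del

/-! ### Pullback of functions and one-forms -/

section Pullback

open scoped ContDiff

variable {N M : ℕ}

theorem extPullback_ι (T : Cn M →L[ℝ] Cn N) (ξ : Cotangent N) :
    extPullback T (ExteriorAlgebra.ι ℂ ξ) =
      ExteriorAlgebra.ι ℂ (ξ ∘ₗ (T : Cn M →ₗ[ℝ] Cn N)) :=
  ExteriorAlgebra.map_apply_ι _ _

theorem extd_pullback_algebraMap {f : Cn N → ℂ} {t : Cn M → Cn N} {y : Cn M}
    (hf : DifferentiableAt ℝ f (t y)) (ht : DifferentiableAt ℝ t y) :
    extd (fun y' => algebraMap ℂ (Ext M) (f (t y'))) y =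
      extPullback (fderiv ℝ t y) (extd (fun u => algebraMap ℂ (Ext N) (f u)) (t y)) := by
  have h : HasFDerivAt (fun y' => f (t y')) ((fderiv ℝ f (t y)).comp (fderiv ℝ t y)) y :=
    hf.hasFDerivAt.comp y ht.hasFDerivAt
  rw [extd_algebraMap h.differentiableAt, h.fderiv, extd_algebraMap hf, extPullback_ι]
  rfl

theorem contDiffAt_coordForm_comp (i : Fin N ⊕ Fin N) (t : Cn M → Cn N) (y : Cn M)
    (ht : ContDiffAt ℝ 2 t y) : ContDiffAt ℝ 2 (fun y' => coordForm i (t y')) y :=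
  (LinearMap.toContinuousLinearMap (coordForm i)).contDiff.contDiffAt.comp y ht

/-- The exterior derivative of a one-form commutes with pullback. -/
theorem extd_pullback_ι {θ : Cn N → Cotangent N} {t : Cn M → Cn N} {y : Cn M}
    (hθ : DifferentiableAt ℝ (fun u => ExteriorAlgebra.ι ℂ (θ u)) (t y))
    (ht : ContDiffAt ℝ 2 t y) :
    extd (fun y' => ExteriorAlgebra.ι ℂ (θ (t y') ∘ₗ (fderiv ℝ t y' : Cn M →ₗ[ℝ] Cn N))) y =
      extPullback (fderiv ℝ t y) (extd (fun u => ExteriorAlgebra.ι ℂ (θ u)) (t y)) := by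
  have hc : ∀ i : Fin N ⊕ Fin N, DifferentiableAt ℝ (fun u => θ u (coordVec i)) (t y) := by
    intro i
    -- The coefficients of a one-form depend linearly on its image in the exterior algebra, through
    -- the left inverse `ExteriorAlgebra.ιInv`, so they inherit differentiability.
    let l : Ext N →L[ℝ] ℂ := (LinearMap.toContinuousLinearMap
      ((LinearMap.applyₗ (R := ℝ) (coordVec i)).restrictScalars ℝ ∘ₗ
        (ExteriorAlgebra.ιInv (R := ℂ) (M := Cotangent N)).restrictScalars ℝ))
    have h : (fun u => θ u (coordVec i)) = fun u => l (ExteriorAlgebra.ι ℂ (θ u)) := by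
      funext u
      simp [l, ExteriorAlgebra.ι_leftInverse (θ u)]
    rw [h]
    exact l.differentiableAt.comp (t y) hθ
  have hty : DifferentiableAt ℝ t y := ht.differentiableAt (by norm_num)
  have hg : ∀ i : Fin N ⊕ Fin N, ContDiffAt ℝ 2
      (fun y' => algebraMap ℂ (Ext M) (coordForm i (t y'))) y := fun i =>
    ((Algebra.linearMap ℂ (Ext M)).toContinuousLinearMap.restrictScalars ℝ).contDiff.contDiffAt.comp
      y (contDiffAt_coordForm_comp i t y ht)
  -- The pullback is `∑ (θ_i ∘ t) d(x_i ∘ t)`. In this form its differential involves only the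
  -- `dθ_i`, because `d d (x_i ∘ t) = 0`.
  have hev : (fun y' => ExteriorAlgebra.ι ℂ (θ (t y') ∘ₗ (fderiv ℝ t y' : Cn M →ₗ[ℝ] Cn N)))
      =ᶠ[nhds y] fun y' => ∑ i, algebraMap ℂ (Ext M) (θ (t y') (coordVec i)) *
        extd (fun z => algebraMap ℂ (Ext M) (coordForm i (t z))) y' := by
    filter_upwards [ht.eventually (by decide)] with y' hy'
    have h1 : DifferentiableAt ℝ t y' := hy'.differentiableAt (by norm_num)
    conv_lhs => rw [← sum_coordForm (θ (t y'))]
    rw [← extPullback_ι]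
    simp only [map_sum, map_smul]
    refine Finset.sum_congr rfl fun i _ => ?_
    rw [extd_algebraMap ((contDiffAt_coordForm_comp i t y' hy').differentiableAt (by norm_num)),
      ← Algebra.smul_def, extPullback_ι]
    congr 2
    refine LinearMap.ext fun u => ?_
    have h2 : HasFDerivAt (fun z => coordForm i (t z))
        ((LinearMap.toContinuousLinearMap (coordForm i)).comp (fderiv ℝ t y')) y' :=
      (LinearMap.toContinuousLinearMap (coordForm i)).hasFDerivAt.comp y' h1.hasFDerivAt
    rw [h2.fderiv]
    rfl
  have hd1 : ∀ i : Fin N ⊕ Fin N, DifferentiableAt ℝ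
      (fun y' => algebraMap ℂ (Ext M) (θ (t y') (coordVec i))) y := fun i =>
    ((Algebra.linearMap ℂ (Ext M)).toContinuousLinearMap.restrictScalars ℝ).differentiableAt.comp
      y ((hc i).comp y hty)
  have hd2 : ∀ i : Fin N ⊕ Fin N, DifferentiableAt ℝ
      (extd (fun z => algebraMap ℂ (Ext M) (coordForm i (t z)))) y := by
    intro i
    have h1 : DifferentiableAt ℝ
        (fderiv ℝ (fun z => algebraMap ℂ (Ext M) (coordForm i (t z)))) y :=
      ((hg i).fderiv_right (m := 1) (by norm_num)).differentiableAt (by norm_num)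
    refine DifferentiableAt.congr_of_eventuallyEq ?_
      (extd_eventuallyEq (by norm_num) (by decide) (hg i))
    unfold wedgeL
    refine DifferentiableAt.fun_sum fun j _ => (differentiableAt_const _).fun_mul ?_
    exact h1.clm_apply (differentiableAt_const _)
  rw [extd_congr hev, extd_sum _ fun i _ => (hd1 i).fun_mul (hd2 i)]
  simp only [ι_eq_sum_coordForm (θ _)]
  rw [extd_sum _ fun i _ => (hc i).smul_const _, map_sum]
  refine Finset.sum_congr rfl fun i _ => ?_
  rw [extd_mul (hd1 i) (hd2 i), extd_extd (hg i), mul_zero, add_zero,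
    extd_pullback_algebraMap (hc i) hty, extd_smul_const (hc i), extd_algebraMap (hc i), map_mul]
  congr 1
  have h2 : extd (fun z => algebraMap ℂ (Ext M) (coordForm i (t z))) y = _ :=
    extd_pullback_algebraMap (f := coordForm i)
      (LinearMap.toContinuousLinearMap (coordForm i)).differentiableAt hty
  rw [h2, extd_algebraMap (f := coordForm i)
    (LinearMap.toContinuousLinearMap (coordForm i)).differentiableAt]
  congr 2
  exact congrArg _ ((LinearMap.toContinuousLinearMap (coordForm i)).hasFDerivAt.fderiv)

end Pullback

/-! ### Degrees of forms -/

section Degree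

variable {N : ℕ}

theorem exteriorPower_eq_zero {k : ℕ} (hk : Module.finrank ℂ (Cotangent N) < k)
    {α : Ext N} (hα : α ∈ ⋀[ℂ]^k (Cotangent N)) : α = 0 := by
  have h : Module.finrank ℂ (⋀[ℂ]^k (Cotangent N)) = 0 := by
    rw [exteriorPower.finrank_eq, Nat.choose_eq_zero_of_lt hk]
  have := Module.finrank_zero_iff.1 h
  exact congrArg Subtype.val (Subsingleton.elim (⟨α, hα⟩ : ⋀[ℂ]^k (Cotangent N)) 0)

theorem extDegree_of_mem {j k : ℕ} {α : Ext N} (hα : α ∈ ⋀[ℂ]^j (Cotangent N)) (hjk : j ≠ k) :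
    extDegree k α = 0 := by
  rw [extDegree, DirectSum.decompose_of_mem_ne (fun i : ℕ => ⋀[ℂ]^i (Cotangent N)) hα hjk]

theorem extDegree_sum {ι : Type*} (s : Finset ι) (k : ℕ) (α : ι → Ext N) :
    extDegree k (∑ i ∈ s, α i) = ∑ i ∈ s, extDegree k (α i) := by
  unfold extDegree
  rw [DirectSum.decompose_sum]
  simp

theorem extDegree_smul (k : ℕ) (c : ℂ) (α : Ext N) :
    extDegree k (c • α) = c • extDegree k α := by
  unfold extDegree
  rw [DirectSum.decompose_smul]
  rfl

theorem ι_mem_exteriorPower (ξ : Cotangent N) :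
    ExteriorAlgebra.ι ℂ ξ ∈ ⋀[ℂ]^1 (Cotangent N) := by
  change _ ∈ LinearMap.range (ExteriorAlgebra.ι ℂ (M := Cotangent N)) ^ 1
  rw [pow_one]
  exact LinearMap.mem_range_self _ _

theorem one_mem_exteriorPower : (1 : Ext N) ∈ ⋀[ℂ]^0 (Cotangent N) := by
  change _ ∈ LinearMap.range (ExteriorAlgebra.ι ℂ (M := Cotangent N)) ^ 0
  rw [pow_zero]
  exact Submodule.one_le.1 le_rfl

theorem mul_mem_exteriorPower {j k : ℕ} {α β : Ext N} (hα : α ∈ ⋀[ℂ]^j (Cotangent N))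
    (hβ : β ∈ ⋀[ℂ]^k (Cotangent N)) : α * β ∈ ⋀[ℂ]^(j + k) (Cotangent N) := by
  change _ ∈ LinearMap.range (ExteriorAlgebra.ι ℂ (M := Cotangent N)) ^ (j + k)
  rw [pow_add]
  exact Submodule.mul_mem_mul hα hβ

theorem invol_of_mem {k : ℕ} {α : Ext N} (hα : α ∈ ⋀[ℂ]^k (Cotangent N)) :
    invol α = (-1 : ℂ) ^ k • α := by
  induction k generalizing α with
  | zero =>
    change _ ∈ LinearMap.range (ExteriorAlgebra.ι ℂ (M := Cotangent N)) ^ 0 at hα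
    rw [pow_zero, Submodule.mem_one] at hα
    obtain ⟨c, rfl⟩ := hα
    simp
  | succ k ih =>
    change _ ∈ LinearMap.range (ExteriorAlgebra.ι ℂ (M := Cotangent N)) ^ (k + 1) at hα
    rw [pow_succ] at hα
    induction hα using Submodule.mul_induction_on' with
    | mem_mul_mem a ha b hb =>
      obtain ⟨ξ, rfl⟩ := hb
      rw [map_mul, ih ha, invol_ι, pow_succ]
      simp
    | add a _ b _ ha hb => rw [map_add, ha, hb, smul_add]

theorem extd_ι_mem {θ : Cn N → Cotangent N} {x : Cn N}
    (hθ : DifferentiableAt ℝ (fun u => ExteriorAlgebra.ι ℂ (θ u)) x) :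
    extd (fun u => ExteriorAlgebra.ι ℂ (θ u)) x ∈ ⋀[ℂ]^2 (Cotangent N) := by
  rw [extd_eq hθ]
  refine Submodule.sum_mem _ fun i _ => ?_
  refine mul_mem_exteriorPower (j := 1) (k := 1) (ι_mem_exteriorPower _) ?_
  change _ ∈ LinearMap.range (ExteriorAlgebra.ι ℂ (M := Cotangent N)) ^ 1
  rw [pow_one]
  -- The difference quotients of a one-form stay among the one-forms, a closed subspace by finite
  -- dimension, so the derivative stays there too.
  let S : Submodule ℝ (Ext N) :=
    (LinearMap.range (ExteriorAlgebra.ι ℂ (M := Cotangent N))).restrictScalars ℝ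
  have hS : IsClosed (S : Set (Ext N)) := S.closed_of_finiteDimensional
  have h1 : HasLineDerivAt ℝ (fun u => ExteriorAlgebra.ι ℂ (θ u))
      (fderiv ℝ (fun u => ExteriorAlgebra.ι ℂ (θ u)) x (coordVec i)) x (coordVec i) :=
    hθ.hasFDerivAt.hasLineDerivAt _
  have h2 := h1.tendsto_slope_zero
  refine hS.mem_of_tendsto h2 (Filter.Eventually.of_forall fun s => ?_)
  exact S.smul_mem _ (S.sub_mem (LinearMap.mem_range_self _ _) (LinearMap.mem_range_self _ _))

end Degree

/-! ### Creation and annihilation matrices on the exterior algebra -/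

section Fermions

variable (R : Type*) [CommRing R] {n : ℕ}

/-- The basis `e_I` of the exterior algebra of `R^n`. -/
def wedgeBasis (n : ℕ) : Module.Basis (Finset (Fin n)) R (ExteriorAlgebra R (Fin n → R)) :=
  (Pi.basisFun R (Fin n)).ExteriorAlgebra

/-- The generator `e_a` of the exterior algebra of `R^n`. -/
def gen (a : Fin n) : ExteriorAlgebra R (Fin n → R) := ExteriorAlgebra.ι R (Pi.single a 1)

theorem wedgeBasis_eq_ιMulti (I : Finset (Fin n)) :
    wedgeBasis R n I = ExteriorAlgebra.ιMulti R I.card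
      (fun i => Pi.single (I.orderEmbOfFin rfl i) 1) := by
  rw [wedgeBasis, ExteriorAlgebra.basis_apply]
  unfold ExteriorAlgebra.ιMulti_family
  congr 1
  funext i
  simp [Set.powersetCard.ofFinEmbEquiv_symm_apply]

theorem wedgeBasis_eq_prod (I : Finset (Fin n)) :
    wedgeBasis R n I = ((I.sort (· ≤ ·)).map (gen R)).prod := by
  rw [wedgeBasis_eq_ιMulti, ExteriorAlgebra.ιMulti_apply]
  congr 1
  apply List.ext_getElem
  · simp
  · intro i h1 h2
    simp [gen, Finset.orderEmbOfFin_apply]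

theorem wedgeBasis_empty : wedgeBasis R n ∅ = 1 := by
  rw [wedgeBasis_eq_prod]; simp

theorem wedgeBasis_insert {a : Fin n} {I : Finset (Fin n)} (h : ∀ b ∈ I, a < b) :
    wedgeBasis R n (insert a I) = gen R a * wedgeBasis R n I := by
  rw [wedgeBasis_eq_prod, wedgeBasis_eq_prod,
    Finset.sort_insert (· ≤ ·) (fun b hb => (h b hb).le) fun ha => lt_irrefl _ (h a ha)]
  simp

theorem gen_mul_gen_swap (a b : Fin n) : gen R a * gen R b = -(gen R b * gen R a) := by
  rw [eq_neg_iff_add_eq_zero]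
  exact ExteriorAlgebra.ι_add_mul_swap _ _

/-- Each generator with index below a that is crossed on the way to the sorted position costs a
sign. The induction peels off the smallest index. -/
theorem gen_mul_wedgeBasis {a : Fin n} {I : Finset (Fin n)} (ha : a ∉ I) :
    gen R a * wedgeBasis R n I = (-1) ^ (I.filter (· < a)).card * wedgeBasis R n (insert a I) := by
  induction I using Finset.induction_on_min with
  | empty => rw [wedgeBasis_insert R (by simp)]; simp
  | insert m J hm ih =>
    rw [Finset.mem_insert, not_or] at ha
    rcases lt_or_gt_of_ne ha.1 with h | h
    · rw [wedgeBasis_insert R (a := a), Finset.filter_eq_empty_iff.2]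
      · simp
      · intro b hb
        rcases Finset.mem_insert.1 hb with rfl | hb
        · exact h.le.not_gt
        · exact (h.trans (hm b hb)).le.not_gt
      · intro b hb
        rcases Finset.mem_insert.1 hb with rfl | hb
        · exact h
        · exact h.trans (hm b hb)
    · have h1 : ∀ b ∈ insert a J, m < b := by
        intro b hb
        rcases Finset.mem_insert.1 hb with rfl | hb
        · exact h
        · exact hm b hb
      rw [wedgeBasis_insert R hm, Finset.insert_comm, wedgeBasis_insert R h1, ← mul_assoc,
        gen_mul_gen_swap, neg_mul, mul_assoc, ih ha.2, Finset.filter_insert, if_pos h,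
        Finset.card_insert_of_notMem (fun hc => lt_irrefl _ (hm m (Finset.mem_filter.1 hc).1)),
        pow_succ, ← mul_assoc, ← mul_assoc,
        ((Commute.neg_one_right (gen R m)).pow_right _).eq]
      simp

theorem gen_mul_wedgeBasis_of_mem {a : Fin n} {I : Finset (Fin n)} (ha : a ∈ I) :
    gen R a * wedgeBasis R n I = 0 := by
  have h1 := gen_mul_wedgeBasis R (Finset.notMem_erase a I)
  rw [Finset.insert_erase ha] at h1
  have h2 : gen R a * gen R a = 0 := ExteriorAlgebra.ι_sq_zero _
  have h3 : (-1 : ExteriorAlgebra R (Fin n → R)) ^ ((I.erase a).filter (· < a)).card *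
      (gen R a * wedgeBasis R n I) = 0 := by
    rw [← mul_assoc, ((Commute.neg_one_left (gen R a)).pow_left _).eq, mul_assoc, ← h1,
      ← mul_assoc, h2, zero_mul]
  exact (((IsUnit.neg isUnit_one).pow _).mul_right_eq_zero).1 h3

/-- Contraction with the `a`-th coordinate functional. -/
def contr (a : Fin n) : Module.End R (ExteriorAlgebra R (Fin n → R)) :=
  CliffordAlgebra.contractLeft (Q := 0) (LinearMap.proj a)

theorem contr_one (a : Fin n) : contr R a 1 = 0 := CliffordAlgebra.contractLeft_one (Q := 0) _

theorem contr_ι_mul (a : Fin n) (t : Fin n → R) (x : ExteriorAlgebra R (Fin n → R)) :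
    contr R a (ExteriorAlgebra.ι R t * x) = t a • x - ExteriorAlgebra.ι R t * contr R a x :=
  CliffordAlgebra.contractLeft_ι_mul (Q := 0) _ _ _

theorem contr_gen_mul (a b : Fin n) (x : ExteriorAlgebra R (Fin n → R)) :
    contr R a (gen R b * x) = (if a = b then x else 0) - gen R b * contr R a x := by
  rw [gen, contr_ι_mul]
  by_cases h : a = b <;> simp [h]

theorem contr_contr (a b : Fin n) (x : ExteriorAlgebra R (Fin n → R)) :
    contr R a (contr R b x) = -contr R b (contr R a x) := CliffordAlgebra.contractLeft_comm (Q := 0) _ _ _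

theorem contr_mul (a : Fin n) (x y : ExteriorAlgebra R (Fin n → R)) :
    contr R a (x * y) = contr R a x * y + CliffordAlgebra.involute x * contr R a y := by
  induction x using ExteriorAlgebra.induction generalizing y with
  | algebraMap r =>
    rw [← Algebra.smul_def, map_smul, AlgHom.commutes, Algebra.algebraMap_eq_smul_one, map_smul,
      contr_one]
    simp
  | ι t =>
    have h := contr_ι_mul R a t 1
    rw [mul_one, contr_one, mul_zero, sub_zero] at h
    rw [contr_ι_mul, h, CliffordAlgebra.involute_ι, smul_mul_assoc, one_mul, neg_mul,
      sub_eq_add_neg]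
  | mul u v hu hv => rw [mul_assoc, hu, hv, hu, map_mul]; noncomm_ring
  | add u v hu hv => rw [add_mul, map_add, hu, hv, map_add, map_add]; noncomm_ring

theorem contr_wedgeBasis_of_notMem {a : Fin n} {I : Finset (Fin n)} (ha : a ∉ I) :
    contr R a (wedgeBasis R n I) = 0 := by
  induction I using Finset.induction_on_min with
  | empty => rw [wedgeBasis_empty, contr_one]
  | insert m J hm ih =>
    rw [Finset.mem_insert, not_or] at ha
    rw [wedgeBasis_insert R hm, contr_gen_mul, if_neg ha.1, ih ha.2]
    simp

/-- Up to a sign `e_I` is `e_a ∧ e_{I∖a}`; contraction is an antiderivation that kills the second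
factor. -/
theorem contr_wedgeBasis {a : Fin n} {I : Finset (Fin n)} (ha : a ∈ I) :
    contr R a (wedgeBasis R n I) =
      (-1) ^ (I.filter (· < a)).card * wedgeBasis R n (I.erase a) := by
  have h1 := gen_mul_wedgeBasis R (Finset.notMem_erase a I)
  have h2 : (I.erase a).filter (· < a) = I.filter (· < a) := by
    rw [Finset.filter_erase]
    exact Finset.erase_eq_of_notMem (by simp)
  rw [Finset.insert_erase ha, h2] at h1
  have h3 : wedgeBasis R n I = (-1 : R) ^ (I.filter (· < a)).card •
      (gen R a * wedgeBasis R n (I.erase a)) := by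
    rw [h1, Algebra.smul_def, ← mul_assoc]
    simp [← pow_add, ← two_mul]
  rw [h3, map_smul, contr_gen_mul, if_pos rfl,
    contr_wedgeBasis_of_notMem R (Finset.notMem_erase a I), mul_zero, sub_zero,
    Algebra.smul_def]
  simp

/-- The matrix of contraction with the `a`-th coordinate functional in the basis `e_I`. -/
def annMat (a : Fin n) : Matrix (Finset (Fin n)) (Finset (Fin n)) R :=
  fun J I => if a ∈ I ∧ J = I.erase a then (-1) ^ (I.filter (· < a)).card else 0

/-- The matrix of left multiplication by `e_a` in the basis `e_I`. -/
def creMat (a : Fin n) : Matrix (Finset (Fin n)) (Finset (Fin n)) R := (annMat R a).transpose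

theorem annMat_map {S : Type*} [CommRing S] (f : R →+* S) (a : Fin n) :
    (annMat R a).map f = annMat S a := by
  ext J I
  simp only [annMat, Matrix.map_apply]
  split_ifs <;> simp

theorem creMat_map {S : Type*} [CommRing S] (f : R →+* S) (a : Fin n) :
    (creMat R a).map f = creMat S a := by
  rw [creMat, Matrix.transpose_map, annMat_map, creMat]

theorem neg_one_pow_mul_eq_smul (k : ℕ) (x : ExteriorAlgebra R (Fin n → R)) :
    (-1) ^ k * x = (-1 : R) ^ k • x := by
  rw [Algebra.smul_def]; simp

theorem toMatrix_contr (a : Fin n) :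
    LinearMap.toMatrix (wedgeBasis R n) (wedgeBasis R n) (contr R a) = annMat R a := by
  ext J I
  rw [LinearMap.toMatrix_apply, annMat]
  by_cases ha : a ∈ I
  · rw [contr_wedgeBasis R ha, neg_one_pow_mul_eq_smul, map_smul, Module.Basis.repr_self]
    simp [ha, Finsupp.single_apply, eq_comm]
  · rw [contr_wedgeBasis_of_notMem R ha]
    simp [ha]

/-- Justifies defining `creMat` as a transpose: exterior multiplication and contraction are adjoint
for the basis `e_I`, with the same signs. -/
theorem toMatrix_gen_mul (a : Fin n) :
    LinearMap.toMatrix (wedgeBasis R n) (wedgeBasis R n) (LinearMap.mulLeft R (gen R a)) =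
      creMat R a := by
  ext J I
  rw [LinearMap.toMatrix_apply, creMat, Matrix.transpose_apply, annMat, LinearMap.mulLeft_apply]
  by_cases ha : a ∈ I
  · rw [gen_mul_wedgeBasis_of_mem R ha, if_neg]
    · simp
    · rintro ⟨-, rfl⟩
      simp at ha
  · rw [gen_mul_wedgeBasis R ha, neg_one_pow_mul_eq_smul, map_smul, Module.Basis.repr_self]
    by_cases hJ : J = insert a I
    · subst hJ
      rw [if_pos (by simp [ha])]
      simp [Finset.filter_insert]
    · rw [if_neg, Finsupp.smul_apply, Finsupp.single_eq_of_ne hJ, smul_zero]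
      rintro ⟨h1, rfl⟩
      exact hJ (Finset.insert_erase h1).symm

theorem annMat_anticomm (a b : Fin n) :
    annMat R a * annMat R b = -(annMat R b * annMat R a) := by
  rw [← toMatrix_contr, ← toMatrix_contr, ← LinearMap.toMatrix_comp, ← LinearMap.toMatrix_comp,
    ← map_neg]
  congr 1
  exact LinearMap.ext fun x => contr_contr R a b x

theorem creMat_anticomm (a b : Fin n) :
    creMat R a * creMat R b = -(creMat R b * creMat R a) := by
  rw [creMat, creMat, ← Matrix.transpose_mul, ← Matrix.transpose_mul, annMat_anticomm,
    Matrix.transpose_neg]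

/-- The mixed canonical anticommutation relation, read off from the antiderivation property of
contraction. -/
theorem annMat_mul_creMat (a b : Fin n) :
    annMat R a * creMat R b = (if a = b then 1 else 0) - creMat R b * annMat R a := by
  rw [← toMatrix_contr, ← toMatrix_gen_mul, ← LinearMap.toMatrix_comp, ← LinearMap.toMatrix_comp]
  have h : (if a = b then (1 : Matrix (Finset (Fin n)) (Finset (Fin n)) R) else 0) =
      LinearMap.toMatrix (wedgeBasis R n) (wedgeBasis R n) (if a = b then LinearMap.id else 0) := by
    split_ifs <;> simp
  rw [h, ← map_sub]
  congr 1
  refine LinearMap.ext fun x => ?_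
  simp only [LinearMap.comp_apply, LinearMap.mulLeft_apply, contr_gen_mul, LinearMap.sub_apply]
  split_ifs <;> simp

end Fermions

/-! ### Matrices of minors as the functor ∧ -/

section Minors

variable {R : Type*} [CommRing R] {n : ℕ}

/-- The matrix of minors of `g`, that is, the matrix of `∧g` in the basis `e_I`. -/
def minorMat (g : Matrix (Fin n) (Fin n) R) : Matrix (Finset (Fin n)) (Finset (Fin n)) R :=
  fun I J =>
    if hJ : J.card = I.card then
      (Matrix.of fun a b : Fin I.card => g (I.orderEmbOfFin rfl a) (J.orderEmbOfFin hJ b)).det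
    else 0

/-- Both sides are linear functionals on the k-th exterior power, so they are compared on its basis.
The dual functionals on the right evaluate on pure wedges as determinants, which is how minors
arise. -/
theorem wedgeBasis_repr_exteriorPower {k : ℕ} (x : ⋀[R]^k (Fin n → R)) (I : Finset (Fin n)) :
    (wedgeBasis R n).repr x I = if h : I.card = k then
      exteriorPower.ιMultiDual R k (Pi.basisFun R (Fin n)) (Set.powersetCard.ofCard h) x else 0 := by
  let l : (⋀[R]^k (Fin n → R)) →ₗ[R] R := if h : I.card = k then
    exteriorPower.ιMultiDual R k (Pi.basisFun R (Fin n)) (Set.powersetCard.ofCard h) else 0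
  have h1 : (wedgeBasis R n).coord I ∘ₗ (⋀[R]^k (Fin n → R)).subtype = l := by
    apply ((Pi.basisFun R (Fin n)).exteriorPower k).ext
    intro s
    have h2 : (wedgeBasis R n) s.val = ((Pi.basisFun R (Fin n)).exteriorPower k s :
        ExteriorAlgebra R (Fin n → R)) := ExteriorAlgebra.basis_eq_coe_basis _ s
    rw [LinearMap.comp_apply, Submodule.subtype_apply, ← h2, Module.Basis.coord_apply,
      Module.Basis.repr_self]
    simp only [l]
    split_ifs with h
    · rw [← exteriorPower.basis_coord, Module.Basis.coord_apply, Module.Basis.repr_self,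
        Finsupp.single_apply, Finsupp.single_apply]
      congr 1
      rw [Subtype.ext_iff]
      rfl
    · rw [Finsupp.single_apply, if_neg]
      · rfl
      · rintro rfl
        exact h s.2
  have h3 := LinearMap.congr_fun h1 x
  rw [LinearMap.comp_apply, Submodule.subtype_apply, Module.Basis.coord_apply] at h3
  rw [h3]
  simp only [l]
  split_ifs <;> rfl

/-- Through this identification the Cauchy–Binet formula `minorMat_mul` is just functoriality of the
exterior algebra. -/
theorem toMatrix_exteriorAlgebra_map (g : Matrix (Fin n) (Fin n) R) :
    LinearMap.toMatrix (wedgeBasis R n) (wedgeBasis R n)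
      (ExteriorAlgebra.map (Matrix.toLin' g)).toLinearMap = minorMat g := by
  ext I J
  rw [LinearMap.toMatrix_apply, AlgHom.toLinearMap_apply, wedgeBasis_eq_ιMulti,
    ExteriorAlgebra.map_apply_ιMulti]
  have h1 := wedgeBasis_repr_exteriorPower (exteriorPower.ιMulti R J.card
    ((Matrix.toLin' g) ∘ fun i => Pi.single (J.orderEmbOfFin rfl i) 1)) I
  rw [exteriorPower.ιMulti_apply_coe] at h1
  rw [h1, minorMat]
  by_cases h : I.card = J.card
  · rw [dif_pos h, dif_pos h.symm, exteriorPower.ιMultiDual_apply_ιMulti, ← Matrix.det_transpose]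
    -- The two minors are indexed by `Fin I.card` and `Fin J.card`; with the sizes as variables the
    -- equality follows by substitution.
    have h2 : ∀ (k l : ℕ) (hk : I.card = k) (hl : J.card = k) (hl' : J.card = l) (hk' : I.card = l),
      (Matrix.of fun a b : Fin k => g (I.orderEmbOfFin hk a) (J.orderEmbOfFin hl b)).det =
      (Matrix.of fun a b : Fin l => g (I.orderEmbOfFin hk' a) (J.orderEmbOfFin hl' b)).det := by
      intro k l hk hl hl' hk'
      subst hk
      subst hk'
      rfl
    rw [h2 _ J.card rfl h.symm rfl h]
    congr 1
    ext a b
    simp [Set.powersetCard.ofFinEmbEquiv_symm_apply, Matrix.toLin'_apply]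
  · rw [dif_neg h, dif_neg (Ne.symm h)]

theorem minorMat_mul (g g' : Matrix (Fin n) (Fin n) R) :
    minorMat (g * g') = minorMat g * minorMat g' := by
  rw [← toMatrix_exteriorAlgebra_map, ← toMatrix_exteriorAlgebra_map g,
    ← toMatrix_exteriorAlgebra_map g', ← LinearMap.toMatrix_comp, Matrix.toLin'_mul,
    ← ExteriorAlgebra.map_comp_map]
  rfl

theorem minorMat_one : minorMat (1 : Matrix (Fin n) (Fin n) R) = 1 := by
  rw [← toMatrix_exteriorAlgebra_map, Matrix.toLin'_one, ExteriorAlgebra.map_id]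
  exact LinearMap.toMatrix_id _

theorem minorMat_transpose (g : Matrix (Fin n) (Fin n) R) :
    minorMat g.transpose = (minorMat g).transpose := by
  ext I J
  rw [Matrix.transpose_apply, minorMat, minorMat]
  by_cases h : I.card = J.card
  · rw [dif_pos h, dif_pos h.symm, ← Matrix.det_transpose]
    have h2 : ∀ (k l : ℕ) (hk : I.card = k) (hl : J.card = k) (hl' : J.card = l) (hk' : I.card = l),
      (Matrix.of fun a b : Fin k => g (J.orderEmbOfFin hl a) (I.orderEmbOfFin hk b)).det =
      (Matrix.of fun a b : Fin l => g (J.orderEmbOfFin hl' a) (I.orderEmbOfFin hk' b)).det := by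
      intro k l hk hl hl' hk'
      subst hk
      subst hk'
      rfl
    rw [← h2 _ _ rfl h.symm rfl h]
    rfl
  · rw [dif_neg h, dif_neg (Ne.symm h)]

theorem minorMat_map {S : Type*} [CommRing S] (f : R →+* S) (g : Matrix (Fin n) (Fin n) R) :
    minorMat (g.map f) = (minorMat g).map f := by
  ext I J
  rw [Matrix.map_apply, minorMat, minorMat]
  split_ifs
  · rw [RingHom.map_det]
    rfl
  · simp

theorem toMatrix_ι_mul (t : Fin n → R) :
    LinearMap.toMatrix (wedgeBasis R n) (wedgeBasis R n)
      (LinearMap.mulLeft R (ExteriorAlgebra.ι R t)) = ∑ a, t a • creMat R a := by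
  have h : ExteriorAlgebra.ι R t = ∑ a, t a • gen R a := by
    conv_lhs => rw [pi_eq_sum_univ' t]
    rw [map_sum]
    refine Finset.sum_congr rfl fun a _ => ?_
    rw [map_smul, gen]
  have h2 : LinearMap.mulLeft R (ExteriorAlgebra.ι R t) =
      ∑ a, t a • LinearMap.mulLeft R (gen R a) := by
    refine LinearMap.ext fun x => ?_
    simp [h, Finset.sum_mul, LinearMap.sum_apply]
  rw [h2, map_sum]
  refine Finset.sum_congr rfl fun a _ => ?_
  rw [map_smul, toMatrix_gen_mul]

/-- An algebra map satisfies `∧g(t ∧ x) = gt ∧ ∧g(x)`. This single intertwining relation yields the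
Chern connection of `∧E`, the adjoint of the Koszul differential, and its behaviour under change of
frame. -/
theorem minorMat_mul_creMat (g : Matrix (Fin n) (Fin n) R) (t : Fin n → R) :
    minorMat g * ∑ a, t a • creMat R a = (∑ a, (g.mulVec t) a • creMat R a) * minorMat g := by
  rw [← toMatrix_ι_mul, ← toMatrix_ι_mul, ← toMatrix_exteriorAlgebra_map,
    ← LinearMap.toMatrix_comp, ← LinearMap.toMatrix_comp]
  congr 1
  refine LinearMap.ext fun x => ?_
  simp [ExteriorAlgebra.map_apply_ι]

/-- Multilinear expansion of the determinant in rows: choosing rows of `-g` on s and of the identity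
elsewhere leaves a signed principal minor. -/
theorem sum_minorMat_diag (g : Matrix (Fin n) (Fin n) R) :
    ∑ I, (-1) ^ I.card * minorMat g I I = (1 - g).det := by
  have h1 : (1 - g).det = ∑ s : Finset (Fin n),
      (Matrix.of (s.piecewise (-g).row (1 : Matrix (Fin n) (Fin n) R).row)).det := by
    rw [sub_eq_add_neg, add_comm]
    exact (Matrix.detRowAlternating (R := R) (n := Fin n)).map_add_univ _ _
  rw [h1]
  refine Finset.sum_congr rfl fun s _ => ?_
  rw [Matrix.det_piecewise_one_eq_submatrix_det, Matrix.submatrix_neg, Pi.neg_apply, Pi.neg_apply,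
    Matrix.det_neg, Fintype.card_coe, minorMat, dif_pos rfl]
  congr 1
  rw [← Matrix.det_submatrix_equiv_self (s.orderIsoOfFin rfl).toEquiv]
  rfl

end Minors

/-! ### The action of gl_n on the exterior algebra by bilinears in the fermions -/

section Number

variable (R : Type*) [CommRing R] {n : ℕ}

/-- The matrix of the derivation of `∧R^n` that extends the matrix unit `E_{ab}`. -/
def numMat (a b : Fin n) : Matrix (Finset (Fin n)) (Finset (Fin n)) R := creMat R a * annMat R b

theorem numMat_map {S : Type*} [CommRing S] (f : R →+* S) (a b : Fin n) :
    (numMat R a b).map f = numMat S a b := by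
  rw [numMat, Matrix.map_mul, creMat_map, annMat_map, numMat]

theorem numMat_transpose (a b : Fin n) : (numMat R a b).transpose = numMat R b a := by
  rw [numMat, Matrix.transpose_mul, creMat, Matrix.transpose_transpose, numMat, creMat]

theorem numMat_mul_creMat (a b c : Fin n) :
    numMat R a b * creMat R c = (if b = c then creMat R a else 0) + creMat R c * numMat R a b := by
  rw [numMat, mul_assoc, annMat_mul_creMat, mul_sub, ← mul_assoc, creMat_anticomm R a c]
  split_ifs <;> noncomm_ring

theorem numMat_mul_annMat (a b c : Fin n) :
    numMat R a b * annMat R c = annMat R c * numMat R a b - (if c = a then annMat R b else 0) := by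
  rw [numMat, mul_assoc, ← mul_assoc (annMat R c), annMat_mul_creMat, annMat_anticomm R b c]
  split_ifs <;> noncomm_ring

/-- The commutation relations of matrix units: the bilinears represent gl_n. -/
theorem numMat_mul_numMat (a b c d : Fin n) :
    numMat R a b * numMat R c d = numMat R c d * numMat R a b +
      (if b = c then numMat R a d else 0) - (if d = a then numMat R c b else 0) := by
  conv_lhs => rw [numMat.eq_def R c d, ← mul_assoc, numMat_mul_creMat, add_mul, mul_assoc,
    numMat_mul_annMat, mul_sub, ← mul_assoc, ← numMat]
  split_ifs <;> simp [numMat, add_comm, add_sub_assoc]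

theorem numMat_apply_empty (a b : Fin n) (J : Finset (Fin n)) : numMat R a b J ∅ = 0 := by
  rw [numMat, Matrix.mul_apply]
  exact Finset.sum_eq_zero fun K _ => by simp [annMat]

/-- A matrix that commutes with the exterior products up to a linear map `Z` and kills the vacuum
is the derivation that extends `Z`. -/
theorem eq_sum_numMat {Y : Matrix (Finset (Fin n)) (Finset (Fin n)) R}
    {Z : Matrix (Fin n) (Fin n) R}
    (hY : ∀ a, Y * creMat R a = ∑ b, Z b a • creMat R b + creMat R a * Y)
    (h0 : ∀ J, Y J ∅ = 0) : Y = ∑ a, ∑ b, Z a b • numMat R a b := by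
  rw [← sub_eq_zero]
  set D := Y - ∑ a, ∑ b, Z a b • numMat R a b with hD
  have h1 : ∀ a, D * creMat R a = creMat R a * D := by
    intro a
    have h2 : (∑ c, ∑ b, Z c b • numMat R c b) * creMat R a =
        ∑ b, Z b a • creMat R b + creMat R a * ∑ c, ∑ b, Z c b • numMat R c b := by
      simp only [Finset.sum_mul, Finset.mul_sum, smul_mul_assoc, numMat_mul_creMat, smul_add,
        Finset.sum_add_distrib, mul_smul_comm, smul_ite, smul_zero]
      simp
    rw [hD, sub_mul, mul_sub, hY, h2]
    abel
  have h3 : ∀ J, D J ∅ = 0 := by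
    intro J
    simp [hD, h0, Matrix.sum_apply, numMat_apply_empty]
  -- The difference commutes with all creation operators and kills the vacuum; since every `e_I` is
  -- created from the vacuum, it vanishes.
  let D' := Matrix.toLin (wedgeBasis R n) (wedgeBasis R n) D
  have h4 : ∀ a x, D' (gen R a * x) = gen R a * D' x := by
    intro a x
    have h5 : D' ∘ₗ LinearMap.mulLeft R (gen R a) = LinearMap.mulLeft R (gen R a) ∘ₗ D' := by
      apply (LinearMap.toMatrix (wedgeBasis R n) (wedgeBasis R n)).injective
      rw [LinearMap.toMatrix_comp _ (wedgeBasis R n), LinearMap.toMatrix_comp _ (wedgeBasis R n),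
        toMatrix_gen_mul, LinearMap.toMatrix_toLin, h1]
    exact LinearMap.congr_fun h5 x
  have h6 : D' = 0 := by
    apply (wedgeBasis R n).ext
    intro I
    rw [LinearMap.zero_apply]
    induction I using Finset.induction_on_min with
    | empty =>
      rw [Matrix.toLin_self]
      simp [h3]
    | insert m J hm ih => rw [wedgeBasis_insert R hm, h4, ih, mul_zero]
  exact (Matrix.toLin (wedgeBasis R n) (wedgeBasis R n)).map_eq_zero_iff.1 h6

end Number

/-! ### Exponentials of derivations of the exterior algebra -/

section Exponential

variable {R : Type*} [CommRing R] {n : ℕ}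

/-- The derivation of `∧R^n` that extends the endomorphism with matrix `Z`. -/
def derivEnd (Z : Matrix (Fin n) (Fin n) R) : Module.End R (ExteriorAlgebra R (Fin n → R)) :=
  ∑ a, ∑ b, Z a b • (LinearMap.mulLeft R (gen R a) ∘ₗ contr R b)

/-- Contraction and exterior multiplication each produce a grade involution on passing x, and the
two cancel. -/
theorem derivEnd_mul (Z : Matrix (Fin n) (Fin n) R) (x y : ExteriorAlgebra R (Fin n → R)) :
    derivEnd Z (x * y) = x * derivEnd Z y + derivEnd Z x * y := by
  simp only [derivEnd, LinearMap.sum_apply, LinearMap.smul_apply, LinearMap.comp_apply,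
    LinearMap.mulLeft_apply, Finset.mul_sum, Finset.sum_mul, ← Finset.sum_add_distrib]
  refine Finset.sum_congr rfl fun a _ => Finset.sum_congr rfl fun b _ => ?_
  rw [contr_mul, mul_add, ← mul_assoc (gen R a) (CliffordAlgebra.involute x), gen,
    ι_mul_eq (Pi.single a 1) (CliffordAlgebra.involute x),
    CliffordAlgebra.involute_involute, mul_smul_comm, smul_mul_assoc, ← smul_add, ← mul_assoc,
    ← mul_assoc, add_comm]

theorem derivEnd_one (Z : Matrix (Fin n) (Fin n) R) : derivEnd Z 1 = 0 := by
  simp [derivEnd, LinearMap.sum_apply, contr_one]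

theorem derivEnd_ι (Z : Matrix (Fin n) (Fin n) R) (t : Fin n → R) :
    derivEnd Z (ExteriorAlgebra.ι R t) = ExteriorAlgebra.ι R (Z.mulVec t) := by
  have h1 : ∀ b, contr R b (ExteriorAlgebra.ι R t) = t b • 1 := by
    intro b
    have h := contr_ι_mul R b t 1
    rwa [mul_one, contr_one, mul_zero, sub_zero] at h
  have h2 : Z.mulVec t = ∑ a, (Z.mulVec t) a • (Pi.single a 1 : Fin n → R) := by
    conv_lhs => rw [pi_eq_sum_univ' (Z.mulVec t)]
  rw [h2]
  simp only [derivEnd, LinearMap.sum_apply, LinearMap.smul_apply, LinearMap.comp_apply, h1,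
    map_sum, map_smul, LinearMap.mulLeft_apply, mul_one, gen, smul_smul, Matrix.mulVec, dotProduct,
    Finset.sum_smul]

theorem toMatrix_derivEnd (Z : Matrix (Fin n) (Fin n) R) :
    LinearMap.toMatrix (wedgeBasis R n) (wedgeBasis R n) (derivEnd Z) =
      ∑ a, ∑ b, Z a b • numMat R a b := by
  simp only [derivEnd, map_sum, map_smul]
  refine Finset.sum_congr rfl fun a _ => Finset.sum_congr rfl fun b _ => ?_
  rw [LinearMap.toMatrix_comp _ (wedgeBasis R n), toMatrix_gen_mul, toMatrix_contr, numMat]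

/-- The exponential of a nilpotent derivation is an algebra homomorphism, hence determined on
generators, where it is the exponential of Z. -/
theorem exp_derivEnd [Algebra ℚ R] {Z : Matrix (Fin n) (Fin n) R} (hZ : IsNilpotent Z)
    (hD : IsNilpotent (derivEnd Z)) :
    IsNilpotent.exp (derivEnd Z) =
      (ExteriorAlgebra.map (Matrix.toLin' (IsNilpotent.exp Z))).toLinearMap := by
  have hone : IsNilpotent.exp (derivEnd Z) 1 = 1 := by
    have h := IsNilpotent.exp_smul_eq_sum (a := derivEnd Z)
      (m := (1 : ExteriorAlgebra R (Fin n → R))) (k := 1) (by simp [derivEnd_one]) hD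
    simpa using h
  let φ : ExteriorAlgebra R (Fin n → R) →ₐ[R] ExteriorAlgebra R (Fin n → R) :=
    AlgHom.ofLinearMap (IsNilpotent.exp (derivEnd Z)) hone
      (Module.End.exp_mul_of_derivation R _ (derivEnd Z) (derivEnd_mul Z) hD)
  have hφ : φ = ExteriorAlgebra.map (Matrix.toLin' (IsNilpotent.exp Z)) := by
    apply ExteriorAlgebra.hom_ext
    have hZ' : IsNilpotent (Matrix.toLinAlgEquiv' Z) := hZ.map _
    have h1 := Module.End.commute_exp_left_of_commute (fM := Matrix.toLinAlgEquiv' Z)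
      (fN := derivEnd Z) (g := ExteriorAlgebra.ι R) hZ' hD
      (LinearMap.ext fun t => by simp [derivEnd_ι])
    rw [← IsNilpotent.map_exp hZ] at h1
    refine LinearMap.ext fun t => ?_
    have h2 := LinearMap.congr_fun h1 t
    simpa [φ, ExteriorAlgebra.map_apply_ι] using h2
  rw [← hφ]
  rfl

theorem exp_sum_numMat [Algebra ℚ R] {Z : Matrix (Fin n) (Fin n) R} (hZ : IsNilpotent Z)
    (hD : IsNilpotent (∑ a, ∑ b, Z a b • numMat R a b)) :
    IsNilpotent.exp (∑ a, ∑ b, Z a b • numMat R a b) = minorMat (IsNilpotent.exp Z) := by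
  have h1 : IsNilpotent (derivEnd Z) := by
    rw [← toMatrix_derivEnd] at hD
    exact (IsNilpotent.map_iff
      (LinearMap.toMatrixAlgEquiv (wedgeBasis R n)).injective).1 hD
  rw [← toMatrix_exteriorAlgebra_map, ← exp_derivEnd hZ h1, ← toMatrix_derivEnd]
  exact (IsNilpotent.map_exp h1 (LinearMap.toMatrixAlgEquiv (wedgeBasis R n))).symm

end Exponential

/-! ### Clifford generators and vanishing of supertraces -/

section Clifford

variable {n : ℕ}

/-- The parity operator of `∧ℂ^n`. -/
def parityMat (n : ℕ) : Matrix (Finset (Fin n)) (Finset (Fin n)) ℂ :=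
  Matrix.diagonal fun I => (-1) ^ I.card

/-- The Clifford generators `e_a ∧ + ι_a` and `e_a ∧ - ι_a`. -/
def cliffGen (p : Fin n × Bool) : Matrix (Finset (Fin n)) (Finset (Fin n)) ℂ :=
  creMat ℂ p.1 + (if p.2 then (-1 : ℂ) else 1) • annMat ℂ p.1

theorem parityMat_mul_self : parityMat n * parityMat n = 1 := by
  rw [parityMat, Matrix.diagonal_mul_diagonal, ← Matrix.diagonal_one]
  congr 1
  funext I
  rw [← pow_add, ← two_mul, pow_mul]
  simp

theorem parityMat_transpose : (parityMat n).transpose = parityMat n :=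
  Matrix.diagonal_transpose _

theorem parityMat_mul_annMat (a : Fin n) :
    parityMat n * annMat ℂ a = -(annMat ℂ a * parityMat n) := by
  ext J I
  rw [parityMat, Matrix.diagonal_mul, Matrix.neg_apply, Matrix.mul_diagonal, annMat]
  split_ifs with h
  · obtain ⟨ha, rfl⟩ := h
    have : I.card = (I.erase a).card + 1 := (Finset.card_erase_add_one ha).symm
    rw [this, pow_succ]
    ring
  · simp

theorem parityMat_mul_creMat (a : Fin n) :
    parityMat n * creMat ℂ a = -(creMat ℂ a * parityMat n) := by
  have h := congrArg Matrix.transpose (parityMat_mul_annMat a)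
  rw [Matrix.transpose_mul, Matrix.transpose_neg, Matrix.transpose_mul, parityMat_transpose] at h
  rw [creMat, h, neg_neg]

theorem parityMat_mul_cliffGen (p : Fin n × Bool) :
    parityMat n * cliffGen p = -(cliffGen p * parityMat n) := by
  rw [cliffGen, mul_add, add_mul, mul_smul_comm, smul_mul_assoc, parityMat_mul_annMat,
    parityMat_mul_creMat, smul_neg, neg_add]

theorem matrix_eq_zero_of_eq_neg {κ : Type*} {X : Matrix κ κ ℂ} (h : X = -X) : X = 0 := by
  ext i j
  exact self_eq_neg.1 (congrFun₂ h i j)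

theorem cliffGen_mul_self (p : Fin n × Bool) :
    cliffGen p * cliffGen p = if p.2 then (-1 : ℂ) • 1 else (1 : ℂ) • 1 := by
  have h1 : creMat ℂ p.1 * creMat ℂ p.1 = 0 := matrix_eq_zero_of_eq_neg (creMat_anticomm ℂ p.1 p.1)
  have h2 : annMat ℂ p.1 * annMat ℂ p.1 = 0 := matrix_eq_zero_of_eq_neg (annMat_anticomm ℂ p.1 p.1)
  have h3 := annMat_mul_creMat ℂ p.1 p.1
  rw [if_pos rfl] at h3
  simp only [cliffGen, mul_add, add_mul, mul_smul_comm, smul_mul_assoc, h1, h2, h3]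
  split_ifs <;> simp <;> abel

theorem cliffGen_anticomm {p q : Fin n × Bool} (hpq : p ≠ q) :
    cliffGen p * cliffGen q = -(cliffGen q * cliffGen p) := by
  obtain ⟨a, s⟩ := p
  obtain ⟨b, t⟩ := q
  simp only [cliffGen, mul_add, add_mul, mul_smul_comm, smul_mul_assoc]
  rw [creMat_anticomm ℂ a b, annMat_anticomm ℂ a b, annMat_mul_creMat ℂ a b,
    annMat_mul_creMat ℂ b a]
  by_cases hab : a = b
  · subst hab
    have hst : s ≠ t := fun h => hpq (by rw [h])
    cases s <;> cases t <;> simp at hst ⊢ <;> abel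
  · rw [if_neg hab, if_neg (Ne.symm hab)]
    cases s <;> cases t <;> simp <;> abel

theorem creMat_eq_cliffGen (a : Fin n) :
    creMat ℂ a = (1 / 2 : ℂ) • cliffGen (a, false) + (1 / 2 : ℂ) • cliffGen (a, true) := by
  ext I J
  simp [cliffGen]
  ring

theorem annMat_eq_cliffGen (a : Fin n) :
    annMat ℂ a = (1 / 2 : ℂ) • cliffGen (a, false) + (-1 / 2 : ℂ) • cliffGen (a, true) := by
  ext I J
  simp [cliffGen]
  ring

theorem mul_prod_of_anticomm {A : Type*} [Ring A] {x : A} (l : List A)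
    (h : ∀ y ∈ l, x * y = -(y * x)) : x * l.prod = (-1) ^ l.length * (l.prod * x) := by
  induction l with
  | nil => simp
  | cons y l ih =>
    rw [List.prod_cons, ← mul_assoc, h y (by simp), neg_mul, mul_assoc,
      ih fun z hz => h z (by simp [hz]), List.length_cons, pow_succ, ← mul_assoc,
      ((Commute.neg_one_right y).pow_right l.length).eq]
    noncomm_ring

/-- An odd word anticommutes with parity, so cyclicity makes the trace its own negative. A short
even word omits some generator: that one commutes with the word, anticommutes with parity and
squares to ±1, so moving it around the trace again flips the sign. -/
theorem trace_parityMat_mul_word (l : List (Fin n × Bool)) (hl : l.length < 2 * n) :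
    (parityMat n * (l.map cliffGen).prod).trace = 0 := by
  set w := (l.map cliffGen).prod with hw
  have hε : parityMat n * w = (-1) ^ l.length * (w * parityMat n) := by
    have := mul_prod_of_anticomm (x := parityMat n) (l.map cliffGen) (by
      intro y hy
      obtain ⟨p, -, rfl⟩ := List.mem_map.1 hy
      exact parityMat_mul_cliffGen p)
    rwa [List.length_map] at this
  have key : ∀ t : ℂ, t = -t → t = 0 := fun t ht => self_eq_neg.1 ht
  rcases Nat.even_or_odd l.length with he | ho
  · obtain ⟨p, hp⟩ : ∃ p : Fin n × Bool, p ∉ l := by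
      by_contra! hall
      have h1 : (Finset.univ : Finset (Fin n × Bool)).card ≤ l.toFinset.card :=
        Finset.card_le_card fun p _ => List.mem_toFinset.2 (hall p)
      have h2 := l.toFinset_card_le
      simp at h1
      omega
    have hγ : cliffGen p * w = w * cliffGen p := by
      have := mul_prod_of_anticomm (x := cliffGen p) (l.map cliffGen) (by
        intro y hy
        obtain ⟨q, hq, rfl⟩ := List.mem_map.1 hy
        exact cliffGen_anticomm fun h => hp (h ▸ hq))
      rwa [List.length_map, he.neg_one_pow, one_mul] at this
    have h1 : (parityMat n * w * (cliffGen p * cliffGen p)).trace =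
        -(parityMat n * w * (cliffGen p * cliffGen p)).trace := by
      conv_lhs => rw [← mul_assoc, Matrix.trace_mul_comm, ← mul_assoc, ← mul_assoc,
        ← neg_eq_iff_eq_neg.2 (parityMat_mul_cliffGen p), neg_mul, neg_mul, Matrix.trace_neg,
        mul_assoc (parityMat n), hγ]
      simp only [mul_assoc]
    have h2 := key _ h1
    rw [cliffGen_mul_self] at h2
    split_ifs at h2 <;> simpa using h2
  · rw [ho.neg_one_pow] at hε
    apply key
    conv_lhs => rw [hε, neg_one_mul, Matrix.trace_neg, Matrix.trace_mul_comm]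

end Clifford

/-! ### Convergence of exponential series of forms -/

section Series

variable {N : ℕ}

theorem extSum_eq_of_hasSum {u : ℕ → Ext N} {α : Ext N} (h : HasSum u α) : extSum u = α := by
  unfold extSum
  conv_rhs => rw [← (Module.finBasis ℂ (Ext N)).sum_repr α]
  refine Finset.sum_congr rfl fun k _ => ?_
  congr 1
  let l : Ext N →L[ℂ] ℂ := LinearMap.toContinuousLinearMap ((Module.finBasis ℂ (Ext N)).coord k)
  exact (l.hasSum h).tsum_eq

/-- This is the coefficient of `X^k` in `exp(c + X)`. The truncated exponent `n - k` does no harm,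
since the binomial coefficient vanishes for n < k. -/
theorem hasSum_choose_mul_pow (c : ℂ) (k : ℕ) :
    HasSum (fun n : ℕ => ((n.factorial : ℂ))⁻¹ * (c ^ (n - k) * (n.choose k : ℂ)))
      (Complex.exp c * ((k.factorial : ℂ))⁻¹) := by
  have h1 : HasSum (fun l : ℕ => c ^ l / (l.factorial : ℂ) * ((k.factorial : ℂ))⁻¹)
      (Complex.exp c * ((k.factorial : ℂ))⁻¹) := by
    rw [Complex.exp_eq_exp_ℂ]
    exact (NormedSpace.expSeries_div_hasSum_exp c).mul_right _
  refine ((add_left_injective k).hasSum_iff (f := fun n : ℕ =>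
    ((n.factorial : ℂ))⁻¹ * (c ^ (n - k) * (n.choose k : ℂ))) ?_).1 ?_
  · intro n hn
    have : n < k := by
      by_contra! hk
      exact hn ⟨n - k, Nat.sub_add_cancel hk⟩
    rw [Nat.choose_eq_zero_of_lt this]
    simp
  · convert! h1 using 2 with l
    have h2 : ((l + k).factorial : ℂ) = ((l + k).choose k : ℂ) * (l.factorial * k.factorial) := by
      have := Nat.add_choose_mul_factorial_mul_factorial l k
      rw [← this, ← Nat.choose_symm_add]
      push_cast
      ring
    have h3 : ((l + k).choose k : ℂ) ≠ 0 := by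
      exact_mod_cast (Nat.choose_pos (Nat.le_add_left k l)).ne'
    have h4 : (l.factorial : ℂ) ≠ 0 := by exact_mod_cast l.factorial_ne_zero
    have h5 : (k.factorial : ℂ) ≠ 0 := by exact_mod_cast k.factorial_ne_zero
    simp only [Function.comp_apply, Nat.add_sub_cancel, h2]
    field_simp

end Series

/-! ### From the super product to ordinary matrix multiplication -/

section Hat

variable {N : ℕ} {κ : Type*} [Fintype κ] [DecidableEq κ]

/-- The isomorphism of `∧T^* ⊗̂ End(E)` with the ordinary matrix algebra over `∧T^*`. -/
def superHat (deg : κ → ℕ) (T : Matrix κ κ (Ext N)) : Matrix κ κ (Ext N) :=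
  fun i j => ((invol : Ext N →ₐ[ℂ] Ext N) ^ deg i) (T i j)

theorem involPow_involPow (k : ℕ) (α : Ext N) :
    ((invol : Ext N →ₐ[ℂ] Ext N) ^ k) (((invol : Ext N →ₐ[ℂ] Ext N) ^ k) α) = α := by
  have h : (invol : Ext N →ₐ[ℂ] Ext N) * invol = 1 := CliffordAlgebra.involute_comp_involute
  rw [← AlgHom.mul_apply, ← (Commute.refl (invol : Ext N →ₐ[ℂ] Ext N)).mul_pow, h, one_pow]
  rfl

theorem superHat_superHat (deg : κ → ℕ) (T : Matrix κ κ (Ext N)) :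
    superHat deg (superHat deg T) = T := by
  ext i j
  exact involPow_involPow _ _

/-- On the entry `T j k` the involution acts `deg i` times from the twist and `deg i + deg j` times
from the sign rule. It squares to one, so `deg j` times remain, exactly the twist of row j. -/
theorem superHat_superMul (deg : κ → ℕ) (S T : Matrix κ κ (Ext N)) :
    superHat deg (superMul deg S T) = superHat deg S * superHat deg T := by
  ext i k
  simp only [superHat, superMul, Matrix.mul_apply, map_sum, map_mul]
  refine Finset.sum_congr rfl fun j _ => ?_
  congr 1
  have h : (fun α : Ext N => CliffordAlgebra.involute α)^[deg i + deg j] (T j k) =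
      ((invol : Ext N →ₐ[ℂ] Ext N) ^ (deg i + deg j)) (T j k) := by
    rw [AlgHom.coe_pow]
  rw [h, pow_add, AlgHom.mul_apply, involPow_involPow]

theorem superHat_superPow (deg : κ → ℕ) (T : Matrix κ κ (Ext N)) (k : ℕ) :
    superHat deg (superPow deg T k) = superHat deg T ^ k := by
  induction k with
  | zero =>
    ext i j
    simp only [superHat, superPow, pow_zero, Matrix.one_apply]
    split_ifs <;> simp
  | succ k ih => rw [superPow, superHat_superMul, ih, pow_succ']

/-- The scalar is central, so the binomial theorem applies to each power; nilpotency of X leaves m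
coefficients, each summed by `hasSum_choose_mul_pow`. -/
theorem superExp_eq (deg : κ → ℕ) {T X : Matrix κ κ (Ext N)} {c : ℂ} {m : ℕ}
    (hT : superHat deg T = c • 1 + X) (hX : X ^ m = 0) :
    superExp deg T = superHat deg
      (Complex.exp c • ∑ k ∈ Finset.range m, ((k.factorial : ℂ))⁻¹ • X ^ k) := by
  have hpow : ∀ n, superHat deg T ^ n =
      ∑ k ∈ Finset.range m, (c ^ (n - k) * (n.choose k : ℂ)) • X ^ k := by
    intro n
    have hc : Commute X (c • (1 : Matrix κ κ (Ext N))) := (Commute.one_right X).smul_right c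
    rw [hT, add_comm, hc.add_pow]
    have h1 : ∀ k ∈ Finset.range (n + 1), X ^ k * (c • (1 : Matrix κ κ (Ext N))) ^ (n - k) *
        ((n.choose k : ℕ) : Matrix κ κ (Ext N)) = (c ^ (n - k) * (n.choose k : ℂ)) • X ^ k := by
      intro k _
      rw [smul_pow, one_pow, mul_smul_comm, mul_one, smul_mul_assoc, ← nsmul_eq_mul',
        ← Nat.cast_smul_eq_nsmul ℂ, smul_smul]
    rw [Finset.sum_congr rfl h1]
    rcases le_total m (n + 1) with h | h
    · refine (Finset.sum_subset (Finset.range_mono h) fun k _ hk => ?_).symm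
      rw [pow_eq_zero_of_le (by simpa using hk) hX, smul_zero]
    · refine Finset.sum_subset (Finset.range_mono h) fun k _ hk => ?_
      rw [Nat.choose_eq_zero_of_lt (by simpa using hk)]
      simp
  ext i j
  rw [superExp, superSeries]
  refine extSum_eq_of_hasSum ?_
  have h1 : HasSum (fun n : ℕ => ((n.factorial : ℂ))⁻¹ • ((superHat deg T ^ n) i j))
      ((Complex.exp c • ∑ k ∈ Finset.range m, ((k.factorial : ℂ))⁻¹ • X ^ k) i j) := by
    simp only [hpow, Matrix.sum_apply, Matrix.smul_apply, Finset.smul_sum, smul_smul]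
    exact hasSum_sum fun k _ => (hasSum_choose_mul_pow c k).smul_const ((X ^ k) i j)
  let l : Ext N →L[ℂ] Ext N := LinearMap.toContinuousLinearMap
    ((invol : Ext N →ₐ[ℂ] Ext N) ^ deg i).toLinearMap
  have h2 := l.hasSum h1
  convert! h2 using 2 with n
  change _ = ((invol : Ext N →ₐ[ℂ] Ext N) ^ deg i) _
  rw [map_smul, ← superHat_superPow, superHat, involPow_involPow]

/-- Even elements of `∧T^* ⊗̂ End(E)`. -/
def SuperEven (deg : κ → ℕ) (X : Matrix κ κ (Ext N)) : Prop :=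
  ∀ i j, invol (X i j) = (-1 : ℂ) ^ (deg i + deg j) • X i j

/-- Odd elements of `∧T^* ⊗̂ End(E)`. -/
def SuperOdd (deg : κ → ℕ) (X : Matrix κ κ (Ext N)) : Prop :=
  ∀ i j, invol (X i j) = -((-1 : ℂ) ^ (deg i + deg j) • X i j)

/-- The parity operator. -/
def signMat (N : ℕ) (deg : κ → ℕ) : Matrix κ κ (Ext N) :=
  Matrix.diagonal fun i => algebraMap ℂ (Ext N) ((-1) ^ deg i)

theorem signMat_mul_apply (deg : κ → ℕ) (X : Matrix κ κ (Ext N)) (i j : κ) :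
    (signMat N deg * X) i j = (-1 : ℂ) ^ deg i • X i j := by
  rw [signMat, Matrix.diagonal_mul, Algebra.smul_def]

theorem mul_signMat_apply (deg : κ → ℕ) (X : Matrix κ κ (Ext N)) (i j : κ) :
    (X * signMat N deg) i j = (-1 : ℂ) ^ deg j • X i j := by
  rw [signMat, Matrix.mul_diagonal, Algebra.smul_def, Algebra.commutes]

theorem neg_one_pow_mul_add (a b : ℕ) : (-1 : ℂ) ^ a * (-1) ^ (a + b) = (-1) ^ b := by
  rw [pow_add, ← mul_assoc, ← pow_add, ← two_mul, pow_mul]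
  simp

theorem SuperEven.signMat_mul {deg : κ → ℕ} {X : Matrix κ κ (Ext N)} (hX : SuperEven deg X) :
    signMat N deg * X.map invol = X * signMat N deg := by
  ext i j
  rw [signMat_mul_apply, mul_signMat_apply, Matrix.map_apply, hX, smul_smul, neg_one_pow_mul_add]

theorem SuperOdd.signMat_mul {deg : κ → ℕ} {X : Matrix κ κ (Ext N)} (hX : SuperOdd deg X) :
    signMat N deg * X.map invol = -(X * signMat N deg) := by
  ext i j
  rw [Matrix.neg_apply, signMat_mul_apply, mul_signMat_apply, Matrix.map_apply, hX, smul_neg,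
    smul_smul, neg_one_pow_mul_add]

theorem neg_one_pow_mul_trans (a b c : ℕ) :
    (-1 : ℂ) ^ (a + b) * (-1) ^ (b + c) = (-1) ^ (a + c) := by
  rw [← pow_add, show a + b + (b + c) = (a + c) + 2 * b by ring, pow_add, pow_mul]
  simp

theorem SuperEven.mul {deg : κ → ℕ} {X Y : Matrix κ κ (Ext N)} (hX : SuperEven deg X)
    (hY : SuperEven deg Y) : SuperEven deg (X * Y) := by
  intro i k
  rw [Matrix.mul_apply, map_sum, Finset.smul_sum]
  refine Finset.sum_congr rfl fun j _ => ?_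
  rw [map_mul, hX, hY, smul_mul_smul_comm, neg_one_pow_mul_trans]

theorem SuperEven.add {deg : κ → ℕ} {X Y : Matrix κ κ (Ext N)} (hX : SuperEven deg X)
    (hY : SuperEven deg Y) : SuperEven deg (X + Y) := by
  intro i k
  rw [Matrix.add_apply, map_add, hX, hY, smul_add]

theorem SuperOdd.add {deg : κ → ℕ} {X Y : Matrix κ κ (Ext N)} (hX : SuperOdd deg X)
    (hY : SuperOdd deg Y) : SuperOdd deg (X + Y) := by
  intro i k
  rw [Matrix.add_apply, map_add, hX, hY, smul_add, neg_add]

theorem SuperOdd.smul {deg : κ → ℕ} {X : Matrix κ κ (Ext N)} (hX : SuperOdd deg X) (c : ℂ) :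
    SuperOdd deg (c • X) := by
  intro i k
  rw [Matrix.smul_apply, map_smul, hX, smul_neg, smul_comm]

theorem SuperOdd.sum {deg : κ → ℕ} {ι : Type*} (s : Finset ι) {X : ι → Matrix κ κ (Ext N)}
    (hX : ∀ i ∈ s, SuperOdd deg (X i)) : SuperOdd deg (∑ i ∈ s, X i) := by
  classical
  induction s using Finset.induction_on with
  | empty => intro i j; simp
  | insert a s ha ih =>
    rw [Finset.sum_insert ha]
    exact (hX a (by simp)).add (ih fun i hi => hX i (by simp [hi]))

theorem superEven_smul_one (deg : κ → ℕ) (c : ℂ) :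
    SuperEven deg (c • (1 : Matrix κ κ (Ext N))) := by
  intro i j
  rw [Matrix.smul_apply, map_smul, smul_comm]
  by_cases h : i = j
  · subst h
    simp [← two_mul]
  · simp [h]

theorem SuperEven.pow {deg : κ → ℕ} {X : Matrix κ κ (Ext N)} (hX : SuperEven deg X) (k : ℕ) :
    SuperEven deg (X ^ k) := by
  induction k with
  | zero =>
    have := superEven_smul_one (N := N) deg 1
    rwa [one_smul] at this
  | succ k ih => rw [pow_succ]; exact ih.mul hX

/-- Diagonal entries of even elements are even forms, so the twist does not affect the supertrace.
-/
theorem SuperEven.involPow_diag {deg : κ → ℕ} {X : Matrix κ κ (Ext N)} (hX : SuperEven deg X)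
    (k : ℕ) (i : κ) : ((invol : Ext N →ₐ[ℂ] Ext N) ^ k) (X i i) = X i i := by
  induction k with
  | zero => rfl
  | succ k ih =>
    rw [pow_succ, AlgHom.mul_apply, hX i i]
    simp [← two_mul, ih]

/-- Opposite entries of X and Y have opposite form parities, so in each product one factor is an
even, hence central, form. -/
theorem SuperEven.trace_comm {deg : κ → ℕ} {X Y : Matrix κ κ (Ext N)} (hX : SuperEven deg X)
    (hY : SuperOdd deg Y) : (X * Y).trace = (Y * X).trace := by
  simp only [Matrix.trace, Matrix.diag, Matrix.mul_apply]
  rw [Finset.sum_comm]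
  refine Finset.sum_congr rfl fun i _ => Finset.sum_congr rfl fun j _ => ?_
  rcases Nat.even_or_odd (deg j + deg i) with h | h
  · refine commute_of_even ?_ _
    rw [hX, h.neg_one_pow, one_smul]
  · refine (commute_of_even ?_ _).symm
    rw [hY, add_comm, h.neg_one_pow, neg_smul, one_smul, neg_neg]

theorem trace_signMat_mul (deg : κ → ℕ) (X : Matrix κ κ (Ext N)) :
    (signMat N deg * X).trace = superTrace deg X := by
  simp only [Matrix.trace, Matrix.diag, signMat_mul_apply, superTrace]

theorem superTrace_superExp (deg : κ → ℕ) {T X : Matrix κ κ (Ext N)} {c : ℂ} {m : ℕ}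
    (hT : superHat deg T = c • 1 + X) (hX : X ^ m = 0) (hX' : SuperEven deg X) :
    superTrace deg (superExp deg T) =
      Complex.exp c • ∑ k ∈ Finset.range m, ((k.factorial : ℂ))⁻¹ • superTrace deg (X ^ k) := by
  rw [superExp_eq deg hT hX]
  simp only [superTrace, superHat, Matrix.smul_apply, Matrix.sum_apply, map_smul, map_sum,
    fun k i => (hX'.pow k).involPow_diag (deg i) i]
  rw [Finset.smul_sum, Finset.sum_congr rfl fun i _ => by
    rw [smul_comm, Finset.smul_sum]]
  rw [← Finset.smul_sum, ← Finset.smul_sum, Finset.sum_comm]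
  congr 1
  refine Finset.sum_congr rfl fun k _ => ?_
  rw [Finset.smul_sum]
  exact Finset.sum_congr rfl fun i _ => smul_comm _ _ _

end Hat

/-! ### Curvature of superconnections: Bianchi identity, gauge change, closedness -/

section Curvature

open scoped ContDiff

variable {N : ℕ} {κ : Type*} [Fintype κ] [DecidableEq κ]

/-- Smoothness of a matrix of forms. -/
def SmoothMat (A : Cn N → Matrix κ κ (Ext N)) (x : Cn N) : Prop :=
  ∀ i j, ContDiffAt ℝ ∞ (fun y => A y i j) x

/-- The entrywise exterior derivative of a matrix of forms. -/
def matD (A : Cn N → Matrix κ κ (Ext N)) (x : Cn N) : Matrix κ κ (Ext N) :=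
  fun i j => extd (fun y => A y i j) x

theorem SmoothMat.differentiableAt {A : Cn N → Matrix κ κ (Ext N)} {x : Cn N}
    (hA : SmoothMat A x) (i j : κ) : DifferentiableAt ℝ (fun y => A y i j) x :=
  (hA i j).differentiableAt (by simp)

theorem SmoothMat.add {A B : Cn N → Matrix κ κ (Ext N)} {x : Cn N} (hA : SmoothMat A x)
    (hB : SmoothMat B x) : SmoothMat (fun y => A y + B y) x := fun i j => (hA i j).add (hB i j)

theorem SmoothMat.mul {A B : Cn N → Matrix κ κ (Ext N)} {x : Cn N} (hA : SmoothMat A x)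
    (hB : SmoothMat B x) : SmoothMat (fun y => A y * B y) x := fun i j => by
  simp only [Matrix.mul_apply]
  exact ContDiffAt.sum fun k _ => (hA i k).mul (hB k j)

theorem smoothMat_const (C : Matrix κ κ (Ext N)) (x : Cn N) : SmoothMat (fun _ => C) x :=
  fun _ _ => contDiffAt_const

theorem SmoothMat.pow {A : Cn N → Matrix κ κ (Ext N)} {x : Cn N} (hA : SmoothMat A x) (k : ℕ) :
    SmoothMat (fun y => A y ^ k) x := by
  induction k with
  | zero => simpa using smoothMat_const 1 x
  | succ k ih => simpa only [pow_succ] using ih.mul hA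

theorem SmoothMat.matD {A : Cn N → Matrix κ κ (Ext N)} {x : Cn N} (hA : SmoothMat A x) :
    SmoothMat (matD A) x := fun i j => contDiffAt_extd (hA i j)

theorem SmoothMat.congr {A B : Cn N → Matrix κ κ (Ext N)} {x : Cn N} (hA : SmoothMat A x)
    (h : B =ᶠ[nhds x] A) : SmoothMat B x := fun i j =>
  (hA i j).congr_of_eventuallyEq (h.mono fun _ hy => congrFun₂ hy i j)

theorem matD_congr {A B : Cn N → Matrix κ κ (Ext N)} {x : Cn N} (h : A =ᶠ[nhds x] B) :
    matD A x = matD B x := by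
  ext i j
  exact extd_congr (h.mono fun _ hy => congrFun₂ hy i j)

theorem matD_add {A B : Cn N → Matrix κ κ (Ext N)} {x : Cn N} (hA : SmoothMat A x)
    (hB : SmoothMat B x) : matD (fun y => A y + B y) x = matD A x + matD B x := by
  ext i j
  exact extd_add (hA.differentiableAt i j) (hB.differentiableAt i j)

theorem matD_const (C : Matrix κ κ (Ext N)) (x : Cn N) : matD (fun _ => C) x = 0 := by
  ext i j
  exact extd_const _ _

theorem matD_mul {A B : Cn N → Matrix κ κ (Ext N)} {x : Cn N} (hA : SmoothMat A x)
    (hB : SmoothMat B x) :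
    matD (fun y => A y * B y) x = matD A x * B x + (A x).map invol * matD B x := by
  ext i j
  simp only [matD, Matrix.mul_apply, Matrix.add_apply, Matrix.map_apply]
  rw [extd_sum _ fun k _ => (hA.differentiableAt i k).fun_mul (hB.differentiableAt k j),
    ← Finset.sum_add_distrib]
  exact Finset.sum_congr rfl fun k _ =>
    extd_mul (hA.differentiableAt i k) (hB.differentiableAt k j)

theorem matD_matD {A : Cn N → Matrix κ κ (Ext N)} {x : Cn N} (hA : SmoothMat A x) :
    matD (matD A) x = 0 := by
  ext i j
  exact extd_extd ((hA i j).of_le (show ((2 : ℕ∞) : WithTop ℕ∞) ≤ _ from mod_cast le_top))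

theorem signMat_mul_self (deg : κ → ℕ) : signMat N deg * signMat N deg = 1 := by
  ext i j
  rw [signMat_mul_apply, signMat, Matrix.diagonal_apply, Matrix.one_apply]
  split_ifs
  · rw [Algebra.smul_def, ← map_mul, ← pow_add, ← two_mul, pow_mul]
    simp
  · simp

/-- The curvature in terms of the ordinary matrix algebra. -/
def hatCurvature (deg : κ → ℕ) (A : Cn N → Matrix κ κ (Ext N)) (x : Cn N) : Matrix κ κ (Ext N) :=
  signMat N deg * matD A x + A x * A x

theorem extd_involPow {α : Cn N → Ext N} {x : Cn N} (hα : ContDiffAt ℝ ∞ α x) (k : ℕ) :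
    extd (fun y => ((invol : Ext N →ₐ[ℂ] Ext N) ^ k) (α y)) x =
      (-1 : ℂ) ^ k • ((invol : Ext N →ₐ[ℂ] Ext N) ^ k) (extd α x) := by
  induction k generalizing α with
  | zero => simp
  | succ k ih =>
    have h1 : ContDiffAt ℝ ∞ (fun y => invol (α y)) x :=
      ((LinearMap.toContinuousLinearMap (invol (N := N)).toLinearMap).restrictScalars
        ℝ).contDiff.contDiffAt.comp x hα
    have h2 := ih h1
    rw [extd_invol (hα.differentiableAt (by simp))] at h2
    simp only [pow_succ, AlgHom.mul_apply]
    rw [h2]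
    simp

theorem smoothMat_superHat {deg : κ → ℕ} {A : Cn N → Matrix κ κ (Ext N)} {x : Cn N}
    (hA : SmoothMat A x) : SmoothMat (fun y => superHat deg (A y)) x := fun i j =>
  ((LinearMap.toContinuousLinearMap ((invol : Ext N →ₐ[ℂ] Ext N) ^ deg i).toLinearMap).restrictScalars
    ℝ).contDiff.contDiffAt.comp x (hA i j)

/-- The parity operator in `hatCurvature` appears because d anticommutes with the involution, so the
twist of row i contributes `(-1)^{deg i}`. -/
theorem superHat_superCurvature {deg : κ → ℕ} {A : Cn N → Matrix κ κ (Ext N)} {x : Cn N}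
    (hA : SmoothMat A x) :
    superHat deg (superCurvature deg A x) = hatCurvature deg (fun y => superHat deg (A y)) x := by
  rw [hatCurvature, ← superHat_superMul]
  ext i j
  rw [Matrix.add_apply, signMat_mul_apply]
  simp only [superHat, superCurvature, Matrix.add_apply, Matrix.of_apply, map_add, matD]
  rw [extd_involPow (hA i j), smul_smul, ← pow_add, ← two_mul, pow_mul]
  simp

/-- The Bianchi identity. -/
theorem signMat_mul_matD_hatCurvature {deg : κ → ℕ} {A : Cn N → Matrix κ κ (Ext N)} {x : Cn N}
    (hA : SmoothMat A x) (hodd : SuperOdd deg (A x)) :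
    signMat N deg * matD (hatCurvature deg A) x =
      hatCurvature deg A x * A x - A x * hatCurvature deg A x := by
  have h1 : matD (hatCurvature deg A) x = matD A x * A x + (A x).map invol * matD A x := by
    change matD (fun y => signMat N deg * matD A y + A y * A y) x = _
    rw [matD_add ((smoothMat_const _ x).mul hA.matD) (hA.mul hA),
      matD_mul (smoothMat_const _ x) hA.matD, matD_mul hA hA, matD_const, matD_matD hA]
    simp
  rw [h1, mul_add, ← mul_assoc, ← mul_assoc, hodd.signMat_mul, hatCurvature]
  noncomm_ring

/-- The matrix of functions `C` as a matrix of forms. -/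
abbrev scalarMat (N : ℕ) (C : Matrix κ κ ℂ) : Matrix κ κ (Ext N) := C.map (algebraMap ℂ (Ext N))

theorem scalarMat_apply (C : Matrix κ κ ℂ) (i j : κ) :
    scalarMat N C i j = algebraMap ℂ (Ext N) (C i j) := rfl

theorem scalarMat_mul (C D : Matrix κ κ ℂ) :
    scalarMat N (C * D) = scalarMat N C * scalarMat N D := Matrix.map_mul

theorem scalarMat_map_invol (C : Matrix κ κ ℂ) : (scalarMat N C).map invol = scalarMat N C := by
  ext i j
  exact AlgHom.commutes _ _

/-- The curvature after a change of frame. -/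
theorem hatCurvature_gauge {deg : κ → ℕ} {A A' : Cn N → Matrix κ κ (Ext N)}
    {G K : Cn N → Matrix κ κ ℂ} {x : Cn N} (hA : SmoothMat A x) (hodd : SuperOdd deg (A x))
    (hG : SmoothMat (fun y => scalarMat N (G y)) x) (hK : SmoothMat (fun y => scalarMat N (K y)) x)
    (hKG : ∀ᶠ y in nhds x, K y * G y = 1) (hGK : G x * K x = 1)
    (hεK : signMat N deg * scalarMat N (K x) = scalarMat N (K x) * signMat N deg)
    (hA' : ∀ᶠ y in nhds x, A' y = scalarMat N (K y) * A y * scalarMat N (G y) +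
      scalarMat N (K y) * (signMat N deg * matD (fun z => scalarMat N (G z)) y)) :
    hatCurvature deg A' x = scalarMat N (K x) * hatCurvature deg A x * scalarMat N (G x) := by
  set E := signMat N deg with hE
  have hEE : E * E = 1 := signMat_mul_self deg
  set g := scalarMat N (G x) with hg
  set k := scalarMat N (K x) with hk
  set dG := matD (fun z => scalarMat N (G z)) x with hdG
  set dK := matD (fun z => scalarMat N (K z)) x with hdK
  have hgk : g * k = 1 := by
    rw [hg, hk, ← scalarMat_mul, hGK]
    exact Matrix.map_one _ (map_zero _) (map_one _)
  -- Differentiate `K G = 1`, which holds on a neighbourhood.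
  have hdKg : dK * g = -(k * dG) := by
    have h1 : matD (fun y => scalarMat N (K y) * scalarMat N (G y)) x = 0 := by
      rw [← matD_const (1 : Matrix κ κ (Ext N)) x]
      apply matD_congr
      filter_upwards [hKG] with y hy
      rw [← scalarMat_mul, hy]
      exact Matrix.map_one _ (map_zero _) (map_one _)
    rw [matD_mul hK hG, scalarMat_map_invol] at h1
    exact eq_neg_of_add_eq_zero_left h1
  have hdK' : dK = -(k * dG * k) := by
    rw [← mul_one dK, ← hgk, ← mul_assoc, hdKg, neg_mul]
  have hD : matD A' x = dK * A x * g + k * matD A x * g + k * (A x).map invol * dG +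
      dK * (E * dG) := by
    rw [matD_congr hA', matD_add ((hK.mul hA).mul hG)
      (hK.mul ((smoothMat_const _ x).mul hG.matD)), matD_mul (hK.mul hA) hG, matD_mul hK hA,
      matD_mul hK ((smoothMat_const _ x).mul hG.matD),
      matD_mul (smoothMat_const _ x) hG.matD, matD_const, matD_matD hG,
      scalarMat_map_invol]
    have h1 : (scalarMat N (K x) * A x).map invol = k * (A x).map invol := by
      rw [Matrix.map_mul (f := (invol : Ext N →ₐ[ℂ] Ext N)), scalarMat_map_invol]
    rw [h1]
    simp only [mul_zero, zero_mul, add_zero]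
    noncomm_ring
  have hA'x := hA'.self_of_nhds
  rw [hatCurvature, hatCurvature, hD, hA'x, ← hE, ← hg, ← hk, ← hdG, hdK']
  have hodd' := hodd.signMat_mul
  rw [← hE] at hodd'
  -- ε commutes with K and, by oddness, moves past A up to the involution. In this way every term of
  -- `ε dA'` is matched with a term of `A' A'` or of the conjugated curvature.
  have e1 : E * (-(k * dG * k) * A x * g) = -(k * (E * dG) * k * A x * g) := by
    simp only [neg_mul, mul_neg, ← mul_assoc, hεK]
  have e2 : E * (k * matD A x * g) = k * (E * matD A x) * g := by
    simp only [← mul_assoc, hεK]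
  have e3 : E * (k * (A x).map invol * dG) = -(k * A x * (E * dG)) := by
    rw [← mul_assoc, ← mul_assoc, hεK, mul_assoc k, hodd']
    noncomm_ring
  have e4 : E * (-(k * dG * k) * (E * dG)) = -(k * (E * dG) * k * (E * dG)) := by
    simp only [neg_mul, mul_neg, ← mul_assoc, hεK]
  rw [mul_add, mul_add, mul_add, e1, e2, e3, e4]
  have e5 : ∀ Y : Matrix κ κ (Ext N), k * A x * g * (k * Y) = k * A x * Y := by
    intro Y
    rw [mul_assoc (k * A x) g, ← mul_assoc g, hgk, one_mul]
  simp only [mul_add, add_mul]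
  rw [mul_assoc k (A x) g, ← mul_assoc (k * (A x * g)) k, ← mul_assoc k (A x) g,
    mul_assoc (k * A x * g) k (A x * g), e5, e5]
  noncomm_ring

theorem trace_scalarMat_mul (C : Matrix κ κ ℂ) (X : Matrix κ κ (Ext N)) :
    (scalarMat N C * X).trace = (X * scalarMat N C).trace := by
  simp only [Matrix.trace, Matrix.diag, Matrix.mul_apply]
  rw [Finset.sum_comm]
  exact Finset.sum_congr rfl fun i _ => Finset.sum_congr rfl fun j _ =>
    Algebra.commutes (C _ _) (X _ _)

theorem superTrace_conj {deg : κ → ℕ} {G K : Matrix κ κ ℂ} (hGK : G * K = 1)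
    (hεK : signMat N deg * scalarMat N K = scalarMat N K * signMat N deg)
    (X : Matrix κ κ (Ext N)) :
    superTrace deg (scalarMat N K * X * scalarMat N G) = superTrace deg X := by
  rw [← trace_signMat_mul, ← mul_assoc, ← mul_assoc, hεK, mul_assoc, mul_assoc,
    trace_scalarMat_mul, ← mul_assoc, mul_assoc _ (scalarMat N G), ← scalarMat_mul, hGK,
    scalarMat, Matrix.map_one _ (map_zero _) (map_one _), mul_one, trace_signMat_mul]

theorem conj_pow {G K : Matrix κ κ ℂ} (hGK : G * K = 1) (X : Matrix κ κ (Ext N)) (k : ℕ) :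
    (scalarMat N K * X * scalarMat N G) ^ (k + 1) = scalarMat N K * X ^ (k + 1) * scalarMat N G := by
  have h : scalarMat N G * scalarMat N K = 1 := by
    rw [← scalarMat_mul, hGK]
    exact Matrix.map_one _ (map_zero _) (map_one _)
  induction k with
  | zero => simp
  | succ k ih =>
    rw [pow_succ, ih, pow_succ _ (k + 1)]
    simp only [mul_assoc]
    rw [← mul_assoc (scalarMat N G) (scalarMat N K), h, one_mul]

/-- The right-hand side is an ordinary trace, to which `SuperEven.trace_comm` applies once `ε dX` is
known to be a commutator. -/
theorem extd_superTrace {deg : κ → ℕ} {X : Cn N → Matrix κ κ (Ext N)} {x : Cn N}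
    (hX : SmoothMat X x) :
    extd (fun y => superTrace deg (X y)) x = (signMat N deg * matD X x).trace := by
  have h : ∀ i, DifferentiableAt ℝ (fun y => (-1 : ℂ) ^ deg i • X y i i) x := fun i =>
    (hX.differentiableAt i i).fun_const_smul _
  simp only [superTrace]
  rw [extd_sum _ fun i _ => h i]
  simp only [Matrix.trace, Matrix.diag, signMat_mul_apply]
  exact Finset.sum_congr rfl fun i _ => extd_const_smul _ (hX.differentiableAt i i)

theorem contDiffAt_superTrace {deg : κ → ℕ} {X : Cn N → Matrix κ κ (Ext N)} {x : Cn N}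
    (hX : SmoothMat X x) : ContDiffAt ℝ ∞ (fun y => superTrace deg (X y)) x :=
  ContDiffAt.sum fun i _ => contDiffAt_const.fun_smul (hX i i)

/-- The form `e^c ∑_k tr_s(X^k) / k!`. -/
def expTrace (deg : κ → ℕ) (m : ℕ) (c : ℂ) (X : Matrix κ κ (Ext N)) : Ext N :=
  Complex.exp c • ∑ k ∈ Finset.range m, ((k.factorial : ℂ))⁻¹ • superTrace deg (X ^ k)

theorem contDiffAt_expTrace {deg : κ → ℕ} {X : Cn N → Matrix κ κ (Ext N)} {c : Cn N → ℂ}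
    {x : Cn N} (hX : SmoothMat X x) (hc : ContDiffAt ℝ ∞ c x) (m : ℕ) :
    ContDiffAt ℝ ∞ (fun y => expTrace deg m (c y) (X y)) x :=
  hc.cexp.fun_smul (ContDiffAt.sum fun k _ =>
    contDiffAt_const.fun_smul (contDiffAt_superTrace (hX.pow k)))

/-- Taking the commutator with A is a derivation, so the Bianchi relation for X propagates to its
powers. The truncated exponent at k = 0 is multiplied by zero. -/
theorem matD_pow_of_curvature {deg : κ → ℕ} {A X : Cn N → Matrix κ κ (Ext N)} {x : Cn N}
    {ξ : Cotangent N} (hX : SmoothMat X x) (heven : SuperEven deg (X x))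
    (hDX : signMat N deg * matD X x = X x * A x - A x * X x -
      signMat N deg * ExteriorAlgebra.ι ℂ ξ • (1 : Matrix κ κ (Ext N))) (k : ℕ) :
    signMat N deg * matD (fun y => X y ^ k) x = X x ^ k * A x - A x * X x ^ k -
      (k : ℂ) • (signMat N deg * ExteriorAlgebra.ι ℂ ξ • X x ^ (k - 1)) := by
  -- ε absorbs the sign that ξ acquires on crossing an entry of the even matrix X.
  have hcomm : ∀ Y, X x * (signMat N deg * ExteriorAlgebra.ι ℂ ξ • Y) =
      signMat N deg * ExteriorAlgebra.ι ℂ ξ • (X x * Y) := by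
    intro Y
    ext i j
    rw [signMat_mul_apply, Matrix.smul_apply, Matrix.mul_apply, Matrix.mul_apply, smul_eq_mul,
      Finset.mul_sum, Finset.smul_sum]
    refine Finset.sum_congr rfl fun l _ => ?_
    rw [signMat_mul_apply, Matrix.smul_apply, smul_eq_mul, mul_smul_comm, ← mul_assoc,
      ← mul_assoc, ι_mul_eq, heven, smul_mul_assoc, smul_mul_assoc, smul_smul, neg_one_pow_mul_add]
  induction k with
  | zero =>
    simp only [pow_zero, matD_const]
    simp
  | succ k ih =>
    have h1 : matD (fun y => X y ^ (k + 1)) x =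
        matD X x * X x ^ k + (X x).map invol * matD (fun y => X y ^ k) x := by
      rw [← matD_mul hX (hX.pow k)]
      simp only [pow_succ']
    rw [h1, mul_add, ← mul_assoc, ← mul_assoc, hDX, heven.signMat_mul, mul_assoc (X x), ih,
      mul_sub, mul_sub, sub_mul, sub_mul, mul_smul_comm (k : ℂ), hcomm, Nat.add_sub_cancel]
    have h2 : (k : ℂ) • (signMat N deg * ExteriorAlgebra.ι ℂ ξ • (X x * X x ^ (k - 1))) =
        (k : ℂ) • (signMat N deg * ExteriorAlgebra.ι ℂ ξ • X x ^ k) := by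
      rcases k with _ | k
      · simp
      · rw [Nat.add_sub_cancel, ← pow_succ']
    have h3 : signMat N deg * ExteriorAlgebra.ι ℂ ξ • (1 : Matrix κ κ (Ext N)) * X x ^ k =
        signMat N deg * ExteriorAlgebra.ι ℂ ξ • X x ^ k := by
      rw [mul_assoc, smul_mul_assoc, one_mul]
    rw [h2, h3, pow_succ' (X x) k]
    push_cast
    rw [add_smul, one_smul]
    noncomm_ring

/-- The Chern form of a superconnection is closed. -/
theorem extd_expTrace {deg : κ → ℕ} {A X : Cn N → Matrix κ κ (Ext N)} {c : Cn N → ℂ} {x : Cn N}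
    {m : ℕ} (hA : SmoothMat A x) (hodd : SuperOdd deg (A x)) (hX : SmoothMat X x)
    (heven : SuperEven deg (X x)) (hc : ContDiffAt ℝ ∞ c x)
    (hF : ∀ᶠ y in nhds x, hatCurvature deg A y = c y • 1 + X y) (hm : X x ^ m = 0) :
    extd (fun y => expTrace deg (m + 1) (c y) (X y)) x = 0 := by
  have hc' : DifferentiableAt ℝ c x := hc.differentiableAt (by simp)
  set ξ : Cotangent N := (fderiv ℝ c x : Cn N →ₗ[ℝ] ℂ) with hξ
  have hcs : SmoothMat (fun y => c y • (1 : Matrix κ κ (Ext N))) x := fun i j => by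
    simp only [Matrix.smul_apply]
    exact hc.fun_smul contDiffAt_const
  have hDc : matD (fun y => c y • (1 : Matrix κ κ (Ext N))) x =
      ExteriorAlgebra.ι ℂ ξ • (1 : Matrix κ κ (Ext N)) := by
    ext i j
    simp only [matD, Matrix.smul_apply]
    exact extd_smul_const hc' _
  -- The scalar part of the curvature drops out of the commutator in the Bianchi identity but
  -- contributes its differential on the left.
  have hDX : signMat N deg * matD X x = X x * A x - A x * X x -
      signMat N deg * ExteriorAlgebra.ι ℂ ξ • (1 : Matrix κ κ (Ext N)) := by
    have h1 := signMat_mul_matD_hatCurvature hA hodd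
    rw [matD_congr hF, matD_add hcs hX, hDc, hF.self_of_nhds, mul_add] at h1
    rw [eq_sub_of_add_eq' h1]
    simp only [add_mul, mul_add, smul_mul_assoc, one_mul, mul_smul_comm, mul_one]
    abel
  have hstr : ∀ k : ℕ, extd (fun y => superTrace deg (X y ^ k)) x =
      -((k : ℂ) • (ExteriorAlgebra.ι ℂ ξ * superTrace deg (X x ^ (k - 1)))) := by
    intro k
    rw [extd_superTrace (hX.pow k), matD_pow_of_curvature hX heven hDX k, Matrix.trace_sub,
      Matrix.trace_sub, (heven.pow k).trace_comm hodd, sub_self, zero_sub, Matrix.trace_smul]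
    congr 2
    simp only [Matrix.trace, Matrix.diag, signMat_mul_apply, superTrace, Finset.mul_sum]
    refine Finset.sum_congr rfl fun i _ => ?_
    rw [Matrix.smul_apply, smul_eq_mul, mul_smul_comm]
  have hd : ∀ k : ℕ, DifferentiableAt ℝ
      (fun y => ((k.factorial : ℂ))⁻¹ • superTrace deg (X y ^ k)) x := fun k =>
    (contDiffAt_const.fun_smul (contDiffAt_superTrace (hX.pow k))).differentiableAt
      (n := ∞) (by simp)
  have hexp : DifferentiableAt ℝ (fun y => algebraMap ℂ (Ext N) (Complex.exp (c y))) x :=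
    ((Algebra.linearMap ℂ (Ext N)).toContinuousLinearMap.restrictScalars ℝ).differentiableAt.comp
      x hc'.cexp
  have hdexp : fderiv ℝ (fun y => Complex.exp (c y)) x = Complex.exp (c x) • fderiv ℝ c x :=
    hc'.hasFDerivAt.cexp.fderiv
  have hsum : extd (fun y => ∑ k ∈ Finset.range (m + 1),
      ((k.factorial : ℂ))⁻¹ • superTrace deg (X y ^ k)) x =
      -(ExteriorAlgebra.ι ℂ ξ * ∑ k ∈ Finset.range (m + 1),
        ((k.factorial : ℂ))⁻¹ • superTrace deg (X x ^ k)) := by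
    -- Differentiation lowers the power of X by one: the term k = 0 on the left is constant and the
    -- term k = m on the right vanishes, which is why the sum has m + 1 terms.
    rw [extd_sum _ fun k _ => hd k, Finset.sum_range_succ', Finset.sum_range_succ, hm, mul_add,
      Finset.mul_sum]
    have h0 : extd (fun y => ((Nat.factorial 0 : ℂ))⁻¹ • superTrace deg (X y ^ 0)) x = 0 := by
      simp only [pow_zero]
      exact extd_const _ _
    have h1 : superTrace deg (0 : Matrix κ κ (Ext N)) = 0 := by simp [superTrace]
    rw [h0, h1, smul_zero, mul_zero, add_zero, add_zero, ← Finset.sum_neg_distrib]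
    refine Finset.sum_congr rfl fun k _ => ?_
    rw [extd_const_smul _ ((contDiffAt_superTrace (hX.pow (k + 1))).differentiableAt (by simp)),
      hstr, Nat.add_sub_cancel, mul_smul_comm, smul_neg, smul_smul]
    congr 2
    have h5 : (k.factorial : ℂ) ≠ 0 := by exact_mod_cast k.factorial_ne_zero
    have h6 : (k : ℂ) + 1 ≠ 0 := by exact_mod_cast k.succ_ne_zero
    rw [Nat.factorial_succ]
    push_cast
    field_simp
  simp only [expTrace, Algebra.smul_def (Complex.exp _)]
  rw [extd_mul hexp (DifferentiableAt.fun_sum fun k _ => hd k), hsum,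
    extd_algebraMap hc'.cexp, hdexp]
  have h7 : ExteriorAlgebra.ι ℂ
      ((Complex.exp (c x) • fderiv ℝ c x : Cn N →L[ℝ] ℂ) : Cn N →ₗ[ℝ] ℂ) =
      algebraMap ℂ (Ext N) (Complex.exp (c x)) * ExteriorAlgebra.ι ℂ ξ := by
    rw [← Algebra.smul_def, ← map_smul]
    rfl
  rw [h7, AlgHom.commutes, mul_neg, mul_assoc, add_neg_cancel]

theorem hatCurvature_pullback {M : ℕ} {deg : κ → ℕ} {A : Cn N → Matrix κ κ (Ext N)}
    {A' : Cn M → Matrix κ κ (Ext M)} {t : Cn M → Cn N} {y : Cn M}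
    (hA : A' y = (A (t y)).map (extPullback (fderiv ℝ t y)))
    (hD : matD A' y = (matD A (t y)).map (extPullback (fderiv ℝ t y))) :
    hatCurvature deg A' y = (hatCurvature deg A (t y)).map (extPullback (fderiv ℝ t y)) := by
  have h1 : signMat M deg = (signMat N deg).map (extPullback (fderiv ℝ t y)) := by
    ext i j
    rw [Matrix.map_apply, signMat, signMat, Matrix.diagonal_apply, Matrix.diagonal_apply]
    split_ifs
    · exact (AlgHom.commutes _ _).symm
    · exact (map_zero _).symm
  rw [hatCurvature, hatCurvature, hA, hD, h1]
  rw [Matrix.map_add (extPullback (fderiv ℝ t y)) (map_add _),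
    Matrix.map_mul (f := extPullback (fderiv ℝ t y)),
    Matrix.map_mul (f := extPullback (fderiv ℝ t y))]

theorem expTrace_map {M : ℕ} {deg : κ → ℕ} (T : Ext N →ₐ[ℂ] Ext M) (m : ℕ) (c : ℂ)
    (X : Matrix κ κ (Ext N)) : expTrace deg m c (X.map T) = T (expTrace deg m c X) := by
  have h : ∀ k, (X.map T) ^ k = (X ^ k).map T := fun k =>
    (map_pow (T.mapMatrix (m := κ)) X k).symm
  simp only [expTrace, map_smul, map_sum, superTrace, h, Matrix.map_apply]

end Curvature

/-! ### The Chern connection in a holomorphic frame -/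

section Chern

open scoped ContDiff

variable {N : ℕ} {κ : Type*} [Fintype κ] [DecidableEq κ]

/-- The value on the vector `u` of the `(1,0)`-part of the differential of a matrix. -/
def delMat (H : Cn N → Matrix κ κ ℂ) (x u : Cn N) : Matrix κ κ ℂ :=
  fun i j => del (fun y => H y i j) x u

/-- Smoothness of a matrix of functions. -/
def SmoothFun (H : Cn N → Matrix κ κ ℂ) (x : Cn N) : Prop :=
  ∀ i j, ContDiffAt ℝ ∞ (fun y => H y i j) x

/-- Holomorphy of a matrix of functions. -/
def HolFun (G : Cn N → Matrix κ κ ℂ) (x : Cn N) : Prop :=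
  ∀ i j, ContDiffAt ℂ ∞ (fun y => G y i j) x

theorem SmoothFun.differentiableAt {H : Cn N → Matrix κ κ ℂ} {x : Cn N} (hH : SmoothFun H x)
    (i j : κ) : DifferentiableAt ℝ (fun y => H y i j) x := (hH i j).differentiableAt (by simp)

theorem HolFun.smoothFun {G : Cn N → Matrix κ κ ℂ} {x : Cn N} (hG : HolFun G x) :
    SmoothFun G x := fun i j => (hG i j).restrict_scalars ℝ

theorem HolFun.differentiableAt {G : Cn N → Matrix κ κ ℂ} {x : Cn N} (hG : HolFun G x)
    (i j : κ) : DifferentiableAt ℂ (fun y => G y i j) x := (hG i j).differentiableAt (by simp)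

theorem SmoothFun.mul {G H : Cn N → Matrix κ κ ℂ} {x : Cn N} (hG : SmoothFun G x)
    (hH : SmoothFun H x) : SmoothFun (fun y => G y * H y) x := fun i j => by
  simp only [Matrix.mul_apply]
  exact ContDiffAt.sum fun k _ => (hG i k).mul (hH k j)

theorem SmoothFun.add {G H : Cn N → Matrix κ κ ℂ} {x : Cn N} (hG : SmoothFun G x)
    (hH : SmoothFun H x) : SmoothFun (fun y => G y + H y) x := fun i j => (hG i j).add (hH i j)

theorem contDiffAt_star {f : Cn N → ℂ} {x : Cn N} (hf : ContDiffAt ℝ ∞ f x) :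
    ContDiffAt ℝ ∞ (fun y => star (f y)) x :=
  (Complex.conjCLE : ℂ →L[ℝ] ℂ).contDiff.contDiffAt.comp x hf

theorem SmoothFun.map_star {H : Cn N → Matrix κ κ ℂ} {x : Cn N} (hH : SmoothFun H x) :
    SmoothFun (fun y => (H y).map star) x := fun i j => contDiffAt_star (hH i j)

theorem SmoothFun.transpose {H : Cn N → Matrix κ κ ℂ} {x : Cn N} (hH : SmoothFun H x) :
    SmoothFun (fun y => (H y).transpose) x := fun i j => hH j i

theorem contDiffAt_det {𝕜 : Type*} [NontriviallyNormedField 𝕜] [NormedAlgebra 𝕜 ℂ]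
    {E : Type*} [NormedAddCommGroup E] [NormedSpace 𝕜 E] {n : WithTop ℕ∞}
    {ι : Type*} [Fintype ι] [DecidableEq ι] {H : E → Matrix ι ι ℂ} {x : E}
    (hH : ∀ i j, ContDiffAt 𝕜 n (fun y => H y i j) x) :
    ContDiffAt 𝕜 n (fun y => (H y).det) x := by
  simp only [Matrix.det_apply, Units.smul_def, ← Int.cast_smul_eq_zsmul ℂ, smul_eq_mul]
  exact ContDiffAt.sum fun σ _ => contDiffAt_const.mul (contDiffAt_prod fun i _ => hH _ _)

theorem contDiffAt_inv {𝕜 : Type*} [NontriviallyNormedField 𝕜] [NormedAlgebra 𝕜 ℂ]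
    {E : Type*} [NormedAddCommGroup E] [NormedSpace 𝕜 E] {n : WithTop ℕ∞}
    {ι : Type*} [Fintype ι] [DecidableEq ι] {H : E → Matrix ι ι ℂ} {x : E}
    (hH : ∀ i j, ContDiffAt 𝕜 n (fun y => H y i j) x) (hx : IsUnit (H x)) (i j : ι) :
    ContDiffAt 𝕜 n (fun y => (H y)⁻¹ i j) x := by
  have h1 : (H x).det ≠ 0 := ((Matrix.isUnit_iff_isUnit_det _).1 hx).ne_zero
  simp only [Matrix.inv_def, Ring.inverse_eq_inv', Matrix.smul_apply, smul_eq_mul,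
    Matrix.adjugate_apply]
  refine ((contDiffAt_det hH).inv h1).mul (contDiffAt_det fun k l => ?_)
  by_cases h : k = j
  · subst h
    simp only [Matrix.updateRow_self]
    exact contDiffAt_const
  · simp only [Matrix.updateRow_ne h]
    exact hH k l

theorem SmoothFun.inv {H : Cn N → Matrix κ κ ℂ} {x : Cn N} (hH : SmoothFun H x)
    (hx : IsUnit (H x)) : SmoothFun (fun y => (H y)⁻¹) x := contDiffAt_inv hH hx

theorem eventually_isUnit {E : Type*} [TopologicalSpace E] {ι : Type*} [Fintype ι]
    [DecidableEq ι] {H : E → Matrix ι ι ℂ} {x : E}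
    (hH : ∀ i j, ContinuousAt (fun y => H y i j) x) (hx : IsUnit (H x)) :
    ∀ᶠ y in nhds x, IsUnit (H y) := by
  have h1 : ContinuousAt (fun y => (H y).det) x := by
    have h2 : ContinuousAt H x := continuousAt_pi.2 fun i => continuousAt_pi.2 fun j => hH i j
    exact (continuous_id.matrix_det.continuousAt (x := H x)).comp h2
  have h3 : (H x).det ≠ 0 := ((Matrix.isUnit_iff_isUnit_det _).1 hx).ne_zero
  filter_upwards [h1.eventually_ne h3] with y hy
  exact (Matrix.isUnit_iff_isUnit_det _).2 hy.isUnit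

theorem delMat_congr {G H : Cn N → Matrix κ κ ℂ} {x : Cn N} (h : G =ᶠ[nhds x] H) (u : Cn N) :
    delMat G x u = delMat H x u := by
  ext i j
  exact congrArg (· u) (del_congr (h.mono fun _ hy => congrFun₂ hy i j))

theorem delMat_mul {G H : Cn N → Matrix κ κ ℂ} {x : Cn N} (hG : SmoothFun G x)
    (hH : SmoothFun H x) (u : Cn N) :
    delMat (fun y => G y * H y) x u = delMat G x u * H x + G x * delMat H x u := by
  ext i j
  simp only [delMat, Matrix.mul_apply, Matrix.add_apply]
  rw [del_sum _ fun k _ => (hG.differentiableAt i k).fun_mul (hH.differentiableAt k j),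
    LinearMap.sum_apply, ← Finset.sum_add_distrib]
  refine Finset.sum_congr rfl fun k _ => ?_
  rw [del_mul (hG.differentiableAt i k) (hH.differentiableAt k j)]
  simp only [LinearMap.add_apply, LinearMap.smul_apply, smul_eq_mul]
  ring

theorem delMat_const (C : Matrix κ κ ℂ) (x u : Cn N) : delMat (fun _ => C) x u = 0 := by
  ext i j
  exact congrArg (· u) (del_const _ _)

theorem delMat_map_star {G : Cn N → Matrix κ κ ℂ} {x : Cn N} (hG : HolFun G x) (u : Cn N) :
    delMat (fun y => (G y).map star) x u = 0 := by
  ext i j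
  exact congrArg (· u) (del_star_of_holomorphic (hG.differentiableAt i j))

theorem chernConnection_apply (H : Cn N → Matrix κ κ ℂ) (x u : Cn N) (i j : κ) :
    chernConnection H x i j u = (delMat H x u * (H x)⁻¹) j i := by
  simp only [chernConnection, LinearMap.sum_apply, LinearMap.smul_apply, Matrix.mul_apply, delMat,
    smul_eq_mul]
  exact Finset.sum_congr rfl fun k _ => mul_comm _ _

theorem map_star_mul (G H : Matrix κ κ ℂ) : (G * H).map star = G.map star * H.map star :=
  Matrix.map_mul (f := starRingEnd ℂ)

theorem map_star_one : (1 : Matrix κ κ ℂ).map star = 1 :=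
  Matrix.map_one _ (star_zero _) (star_one _)

/-- The Chern connection after a holomorphic change of frame. -/
theorem chernConnection_gauge {H H' G K : Cn N → Matrix κ κ ℂ} {x : Cn N} (hH : SmoothFun H x)
    (hu : IsUnit (H x)) (hG : HolFun G x) (hGK : G x * K x = 1)
    (hH' : ∀ᶠ y in nhds x, H' y = (G y).transpose * H y * (G y).map star) (i j : κ) :
    chernConnection H' x i j = ∑ a, ∑ b, (K x i a * G x b j) • chernConnection H x a b +
      ∑ a, K x i a • del (fun y => G y a j) x := by
  have hKG : K x * G x = 1 := mul_eq_one_comm.1 hGK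
  have e1 : (G x).map star * (K x).map star = 1 := by
    rw [← map_star_mul, hGK, map_star_one]
  have e2 : (G x).transpose * (K x).transpose = 1 := by
    rw [← Matrix.transpose_mul, hKG, Matrix.transpose_one]
  have h1 : (H' x)⁻¹ = (K x).map star * (H x)⁻¹ * (K x).transpose := by
    rw [hH'.self_of_nhds, Matrix.mul_inv_rev, Matrix.mul_inv_rev, Matrix.inv_eq_right_inv e1,
      Matrix.inv_eq_right_inv e2, mul_assoc]
  refine LinearMap.ext fun u => ?_
  -- The conjugate of G is antiholomorphic, so ∂ produces no third term.
  have h2 : delMat H' x u = (delMat G x u).transpose * H x * (G x).map star +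
      (G x).transpose * delMat H x u * (G x).map star := by
    have hGt : delMat (fun y => (G y).transpose) x u = (delMat G x u).transpose := rfl
    rw [delMat_congr hH', delMat_mul (hG.smoothFun.transpose.mul hH) hG.smoothFun.map_star,
      delMat_mul hG.smoothFun.transpose hH, delMat_map_star hG, mul_zero, add_zero, add_mul, hGt]
  have h3 : delMat H' x u * (H' x)⁻¹ = (delMat G x u).transpose * (K x).transpose +
      (G x).transpose * (delMat H x u * (H x)⁻¹) * (K x).transpose := by
    have hHH : H x * (H x)⁻¹ = 1 :=
      Matrix.mul_nonsing_inv _ ((Matrix.isUnit_iff_isUnit_det _).1 hu)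
    rw [h2, h1, add_mul]
    congr 1
    · calc _ = (delMat G x u).transpose * (H x * ((G x).map star * (K x).map star) * (H x)⁻¹) *
            (K x).transpose := by simp only [mul_assoc]
        _ = _ := by rw [e1, mul_one, hHH, mul_one]
    · calc _ = (G x).transpose * delMat H x u * ((G x).map star * (K x).map star) * (H x)⁻¹ *
            (K x).transpose := by simp only [mul_assoc]
        _ = _ := by rw [e1, mul_one, mul_assoc (G x).transpose]
  rw [chernConnection_apply, h3]
  simp only [Matrix.add_apply, LinearMap.add_apply, LinearMap.sum_apply, LinearMap.smul_apply,
    chernConnection_apply, smul_eq_mul]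
  rw [add_comm]
  congr 1
  · rw [Matrix.mul_apply]
    refine Finset.sum_congr rfl fun a _ => ?_
    rw [Matrix.mul_apply, Finset.sum_mul]
    refine Finset.sum_congr rfl fun b _ => ?_
    rw [Matrix.transpose_apply, Matrix.transpose_apply]
    ring
  · rw [Matrix.mul_apply]
    exact Finset.sum_congr rfl fun a _ => mul_comm _ _

/-- For a hermitian metric the dual Gram matrix is the transposed inverse; differentiating `H H⁻¹ =
1` gives the sign and the transposition. -/
theorem chernConnection_dual {H : Cn N → Matrix κ κ ℂ} {x : Cn N} (hH : SmoothFun H x)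
    (hu : IsUnit (H x)) (hherm : ∀ᶠ y in nhds x, (H y).transpose = (H y).map star) (i j : κ) :
    chernConnection (fun y => dualGram (H y)) x i j = -chernConnection H x j i := by
  have hunit : ∀ᶠ y in nhds x, IsUnit (H y) :=
    eventually_isUnit (fun i j => (hH i j).continuousAt) hu
  have hinv : ∀ᶠ y in nhds x, H y * (H y)⁻¹ = 1 := hunit.mono fun y hy =>
    Matrix.mul_nonsing_inv _ ((Matrix.isUnit_iff_isUnit_det _).1 hy)
  have hdual : ∀ᶠ y in nhds x, dualGram (H y) = ((H y)⁻¹).transpose := by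
    filter_upwards [hherm, hinv] with y hy hy'
    have h1 : (H y).transpose * ((H y)⁻¹).map star = 1 := by
      rw [hy, ← map_star_mul, hy', map_star_one]
    rw [Matrix.transpose_nonsing_inv, Matrix.inv_eq_right_inv h1, dualGram]
  have h0 := hinv.self_of_nhds
  have h0' : (H x)⁻¹ * H x = 1 := mul_eq_one_comm.1 h0
  refine LinearMap.ext fun u => ?_
  have h2 : delMat H x u * (H x)⁻¹ + H x * delMat (fun y => (H y)⁻¹) x u = 0 := by
    rw [← delMat_mul hH (hH.inv hu), delMat_congr hinv, delMat_const]
  have h3 : (dualGram (H x))⁻¹ = (H x).transpose := by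
    rw [hdual.self_of_nhds]
    exact Matrix.inv_eq_right_inv (by rw [← Matrix.transpose_mul, h0, Matrix.transpose_one])
  have h4 : delMat (fun y => ((H y)⁻¹).transpose) x u =
      (delMat (fun y => (H y)⁻¹) x u).transpose := rfl
  rw [chernConnection_apply, LinearMap.neg_apply, chernConnection_apply, delMat_congr hdual, h3, h4,
    ← Matrix.transpose_mul, Matrix.transpose_apply, eq_neg_of_add_eq_zero_right h2,
    Matrix.neg_apply]

theorem adjointMatrix_gauge {H D G K : Matrix κ κ ℂ} (hGK : G * K = 1) :
    adjointMatrix (G.transpose * H * G.map star) (K * D * G) = K * adjointMatrix H D * G := by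
  have hKG : K * G = 1 := mul_eq_one_comm.1 hGK
  have e1 : G.map star * K.map star = 1 := by rw [← map_star_mul, hGK, map_star_one]
  have e2 : G.transpose * K.transpose = 1 := by
    rw [← Matrix.transpose_mul, hKG, Matrix.transpose_one]
  have e3 : K.transpose * G.transpose = 1 := mul_eq_one_comm.1 e2
  have h1 : (G.transpose * H * G.map star)⁻¹ = K.map star * H⁻¹ * K.transpose := by
    rw [Matrix.mul_inv_rev, Matrix.mul_inv_rev, Matrix.inv_eq_right_inv e1,
      Matrix.inv_eq_right_inv e2, mul_assoc]
  have h2 : (G.transpose * H * G.map star)⁻¹ * (K * D * G).transpose *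
      (G.transpose * H * G.map star) = K.map star * (H⁻¹ * D.transpose * H) * G.map star := by
    rw [h1, Matrix.transpose_mul, Matrix.transpose_mul]
    calc _ = K.map star * H⁻¹ * (K.transpose * G.transpose) * D.transpose *
          (K.transpose * G.transpose) * H * G.map star := by simp only [mul_assoc]
      _ = _ := by rw [e3]; simp only [mul_one, mul_assoc]
  have h3 : ∀ X : Matrix κ κ ℂ, (X.map star).map star = X := fun X => by
    ext i j
    exact star_star _
  rw [adjointMatrix, h2, map_star_mul, map_star_mul, h3, h3, adjointMatrix]

/-- The superconnection, in the ordinary matrix algebra over `∧T^*`. -/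
def hatConn (deg : κ → ℕ) (H D : Cn N → Matrix κ κ ℂ) (x : Cn N) : Matrix κ κ (Ext N) :=
  signMat N deg * (Matrix.of fun i j => ExteriorAlgebra.ι ℂ (chernConnection H x i j)) +
    (Complex.I * (Real.sqrt (2 * Real.pi) : ℂ)) •
      scalarMat N (D x + adjointMatrix (H x) (D x))

theorem involPow_ι (k : ℕ) (ξ : Cotangent N) :
    ((invol : Ext N →ₐ[ℂ] Ext N) ^ k) (ExteriorAlgebra.ι ℂ ξ) =
      (-1 : ℂ) ^ k • ExteriorAlgebra.ι ℂ ξ := by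
  induction k with
  | zero => simp
  | succ k ih =>
    rw [pow_succ, AlgHom.mul_apply, invol_ι, map_neg, ih, pow_succ]
    simp

theorem superHat_superconnection (deg : κ → ℕ) (H D : Cn N → Matrix κ κ ℂ) (x : Cn N) :
    superHat deg (superconnection H D x) = hatConn deg H D x := by
  ext i j
  rw [hatConn, Matrix.add_apply, signMat_mul_apply, superHat, superconnection, map_add, involPow_ι,
    AlgHom.commutes, Matrix.of_apply, Matrix.smul_apply, scalarMat_apply, Algebra.smul_def _
    (algebraMap ℂ (Ext N) _), ← map_mul]
  rfl

theorem contDiffAt_algebraMap {f : Cn N → ℂ} {x : Cn N} (hf : ContDiffAt ℝ ∞ f x) :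
    ContDiffAt ℝ ∞ (fun y => algebraMap ℂ (Ext N) (f y)) x :=
  ((Algebra.linearMap ℂ (Ext N)).toContinuousLinearMap.restrictScalars ℝ).contDiff.contDiffAt.comp
    x hf

theorem SmoothFun.scalarMat {H : Cn N → Matrix κ κ ℂ} {x : Cn N} (hH : SmoothFun H x) :
    SmoothMat (fun y => scalarMat N (H y)) x := fun i j => contDiffAt_algebraMap (hH i j)

theorem contDiffAt_ι_chernConnection {H : Cn N → Matrix κ κ ℂ} {x : Cn N} (hH : SmoothFun H x)
    (hu : IsUnit (H x)) (i j : κ) :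
    ContDiffAt ℝ ∞ (fun y => ExteriorAlgebra.ι ℂ (chernConnection H y i j)) x := by
  simp only [chernConnection, map_sum, map_smul]
  exact ContDiffAt.sum fun k _ => (hH.inv hu k i).fun_smul (contDiffAt_ι_del (hH j k))

theorem SmoothFun.adjointMatrix {H D : Cn N → Matrix κ κ ℂ} {x : Cn N} (hH : SmoothFun H x)
    (hu : IsUnit (H x)) (hD : SmoothFun D x) :
    SmoothFun (fun y => adjointMatrix (H y) (D y)) x :=
  (((hH.inv hu).mul hD.transpose).mul hH).map_star

theorem smoothMat_hatConn {deg : κ → ℕ} {H D : Cn N → Matrix κ κ ℂ} {x : Cn N}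
    (hH : SmoothFun H x) (hu : IsUnit (H x)) (hD : SmoothFun D x) :
    SmoothMat (hatConn deg H D) x := by
  have h1 : SmoothMat (fun y => scalarMat N (D y + adjointMatrix (H y) (D y))) x :=
    (hD.add (hH.adjointMatrix hu hD)).scalarMat
  refine SmoothMat.add ((smoothMat_const _ x).mul fun i j => ?_) fun i j => ?_
  · exact contDiffAt_ι_chernConnection hH hu i j
  · exact contDiffAt_const.fun_smul (𝕜' := ℂ) (h1 i j)

theorem smoothMat_superconnection {deg : κ → ℕ} {H D : Cn N → Matrix κ κ ℂ} {x : Cn N}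
    (hH : SmoothFun H x) (hu : IsUnit (H x)) (hD : SmoothFun D x) :
    SmoothMat (superconnection H D) x := by
  have h1 := smoothMat_superHat (deg := deg) (smoothMat_hatConn (deg := deg) hH hu hD)
  refine h1.congr (Filter.Eventually.of_forall fun y => ?_)
  simp only [← superHat_superconnection, superHat_superHat]

theorem superHat_superCurvature_superconnection {deg : κ → ℕ} {H D : Cn N → Matrix κ κ ℂ}
    {x : Cn N} (hH : SmoothFun H x) (hu : IsUnit (H x)) (hD : SmoothFun D x) :
    superHat deg (superCurvature deg (superconnection H D) x) =
      hatCurvature deg (hatConn deg H D) x := by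
  rw [superHat_superCurvature (smoothMat_superconnection (deg := deg) hH hu hD)]
  congr 1
  funext y
  exact superHat_superconnection deg H D y

theorem signMat_eq_scalarMat (deg : κ → ℕ) :
    signMat N deg = scalarMat N (Matrix.diagonal fun i => (-1) ^ deg i) := by
  rw [signMat, scalarMat, Matrix.diagonal_map (map_zero _)]

/-- The Chern connection and the adjoint transform naturally, and `∂G = dG` for holomorphic G. The
result has the shape that `hatCurvature_gauge` requires. -/
theorem hatConn_gauge {deg : κ → ℕ} {H H' D D' G K : Cn N → Matrix κ κ ℂ} {x : Cn N}
    (hH : SmoothFun H x) (hu : IsUnit (H x)) (hG : HolFun G x) (hGK : G x * K x = 1)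
    (hH' : ∀ᶠ y in nhds x, H' y = (G y).transpose * H y * (G y).map star)
    (hD' : D' x = K x * D x * G x)
    (hεK : signMat N deg * scalarMat N (K x) = scalarMat N (K x) * signMat N deg) :
    hatConn deg H' D' x = scalarMat N (K x) * hatConn deg H D x * scalarMat N (G x) +
      scalarMat N (K x) * (signMat N deg * matD (fun z => scalarMat N (G z)) x) := by
  set Θ : Matrix κ κ (Ext N) :=
    Matrix.of fun i j => ExteriorAlgebra.ι ℂ (chernConnection H x i j) with hΘ
  have h1 : (Matrix.of fun i j => ExteriorAlgebra.ι ℂ (chernConnection H' x i j)) =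
      scalarMat N (K x) * Θ * scalarMat N (G x) +
        scalarMat N (K x) * matD (fun z => scalarMat N (G z)) x := by
    ext i j
    rw [Matrix.of_apply, chernConnection_gauge hH hu hG hGK hH', map_add, Matrix.add_apply]
    congr 1
    · rw [map_sum, Matrix.mul_apply, Finset.sum_congr rfl fun a _ => map_sum _ _ _,
        Finset.sum_comm]
      refine Finset.sum_congr rfl fun b _ => ?_
      rw [Matrix.mul_apply, Finset.sum_mul]
      refine Finset.sum_congr rfl fun a _ => ?_
      rw [scalarMat_apply, scalarMat_apply, map_smul, ← Algebra.commutes, ← mul_assoc,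
        ← map_mul, ← Algebra.smul_def, hΘ, Matrix.of_apply, mul_comm]
    · rw [map_sum, Matrix.mul_apply]
      refine Finset.sum_congr rfl fun a _ => ?_
      rw [map_smul, scalarMat_apply, ← Algebra.smul_def, matD,
        del_of_holomorphic (hG.differentiableAt a j)]
      congr 1
      exact (extd_algebraMap (hG.smoothFun.differentiableAt a j)).symm
  rw [hatConn, h1, hatConn, ← hΘ, hD', hH'.self_of_nhds, adjointMatrix_gauge hGK, ← add_mul, ← mul_add,
    scalarMat_mul, scalarMat_mul, mul_add, ← mul_assoc (signMat N deg), ← mul_assoc (signMat N deg),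
    ← mul_assoc (signMat N deg), hεK, mul_add, add_mul]
  simp only [mul_assoc, mul_smul_comm, smul_mul_assoc]
  abel

end Chern

/-! ### Tensors of a form and a constant endomorphism -/

section Tens

variable {N : ℕ} {κ : Type*} [Fintype κ] [DecidableEq κ]

/-- The matrix of the endomorphism `α ⊗ C`. -/
def tens (α : Ext N) (C : Matrix κ κ ℂ) : Matrix κ κ (Ext N) := fun i j => C i j • α

theorem tens_apply (α : Ext N) (C : Matrix κ κ ℂ) (i j : κ) : tens α C i j = C i j • α := rfl

theorem tens_mul_tens (α β : Ext N) (C D : Matrix κ κ ℂ) :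
    tens α C * tens β D = tens (α * β) (C * D) := by
  ext i j
  simp only [Matrix.mul_apply, tens_apply, Finset.sum_smul, smul_mul_smul_comm]

theorem tens_add_left (α β : Ext N) (C : Matrix κ κ ℂ) :
    tens (α + β) C = tens α C + tens β C := by
  ext i j
  simp [tens_apply]

theorem tens_neg_left (α : Ext N) (C : Matrix κ κ ℂ) : tens (-α) C = -tens α C := by
  ext i j
  simp [tens_apply]

theorem tens_add_right (α : Ext N) (C D : Matrix κ κ ℂ) :
    tens α (C + D) = tens α C + tens α D := by
  ext i j
  simp [tens_apply, add_smul]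

theorem tens_sub_right (α : Ext N) (C D : Matrix κ κ ℂ) :
    tens α (C - D) = tens α C - tens α D := by
  ext i j
  simp [tens_apply, sub_smul]

theorem tens_zero_right (α : Ext N) : tens α (0 : Matrix κ κ ℂ) = 0 := by
  ext i j
  simp [tens_apply]

theorem tens_zero_left (C : Matrix κ κ ℂ) : tens (0 : Ext N) C = 0 := by
  ext i j
  simp [tens_apply]

theorem tens_smul_left (c : ℂ) (α : Ext N) (C : Matrix κ κ ℂ) :
    tens (c • α) C = c • tens α C := by
  ext i j
  simp only [tens_apply, Matrix.smul_apply]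
  exact smul_comm _ _ _

theorem tens_smul_right (c : ℂ) (α : Ext N) (C : Matrix κ κ ℂ) :
    tens α (c • C) = c • tens α C := by
  ext i j
  simp only [tens_apply, Matrix.smul_apply, smul_assoc]

theorem tens_sum_left {ι : Type*} (s : Finset ι) (α : ι → Ext N) (C : Matrix κ κ ℂ) :
    tens (∑ i ∈ s, α i) C = ∑ i ∈ s, tens (α i) C := by
  ext i j
  simp only [tens_apply, Matrix.sum_apply, Finset.smul_sum]

theorem tens_sum_right {ι : Type*} (s : Finset ι) (α : Ext N) (C : ι → Matrix κ κ ℂ) :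
    tens α (∑ i ∈ s, C i) = ∑ i ∈ s, tens α (C i) := by
  ext i j
  simp only [tens_apply, Matrix.sum_apply, Finset.sum_smul]

theorem scalarMat_eq_tens (C : Matrix κ κ ℂ) : scalarMat N C = tens 1 C := by
  ext i j
  rw [tens_apply, scalarMat_apply, Algebra.algebraMap_eq_smul_one]

theorem matD_tens {α : Cn N → Ext N} {x : Cn N} (hα : DifferentiableAt ℝ α x)
    (C : Matrix κ κ ℂ) : matD (fun y => tens (α y) C) x = tens (extd α x) C := by
  ext i j
  exact extd_const_smul _ hα

theorem matD_sum {ι : Type*} (s : Finset ι) {A : ι → Cn N → Matrix κ κ (Ext N)} {x : Cn N}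
    (hA : ∀ k ∈ s, ∀ i j, DifferentiableAt ℝ (fun y => A k y i j) x) :
    matD (fun y => ∑ k ∈ s, A k y) x = ∑ k ∈ s, matD (A k) x := by
  ext i j
  simp only [matD, Matrix.sum_apply]
  exact extd_sum _ fun k hk => hA k hk i j

theorem superTrace_tens (deg : κ → ℕ) (α : Ext N) (C : Matrix κ κ ℂ) :
    superTrace deg (tens α C) = ((Matrix.diagonal fun i => (-1 : ℂ) ^ deg i) * C).trace • α := by
  simp only [superTrace, tens_apply, Matrix.trace, Matrix.diag, Matrix.diagonal_mul,
    Finset.sum_smul, smul_smul]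

end Tens

/-! ### Metric, connection and Dirac operator of a Koszul complex -/

section Koszul

open scoped ContDiff

variable {N n : ℕ}

theorem koszulMatrix_eq (s : Fin n → ℂ) : koszulMatrix s = ∑ a, s a • annMat ℂ a := by
  ext J I
  rw [koszulMatrix, Matrix.sum_apply, ← Finset.sum_filter_add_sum_filter_not Finset.univ (· ∈ I)]
  rw [Finset.filter_univ_mem, Finset.sum_eq_zero (s := Finset.univ.filter (· ∉ I)), add_zero]
  · refine Finset.sum_congr rfl fun a ha => ?_
    rw [Matrix.smul_apply, annMat]
    simp [ha, mul_comm]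
  · intro a ha
    rw [Matrix.smul_apply, annMat, if_neg, smul_zero]
    exact fun h => (Finset.mem_filter.1 ha).2 h.1

theorem contDiffAt_minorMat {𝕜 : Type*} [NontriviallyNormedField 𝕜] [NormedAlgebra 𝕜 ℂ]
    {E : Type*} [NormedAddCommGroup E] [NormedSpace 𝕜 E] {m : WithTop ℕ∞}
    {H : E → Matrix (Fin n) (Fin n) ℂ} {x : E}
    (hH : ∀ i j, ContDiffAt 𝕜 m (fun y => H y i j) x) (I J : Finset (Fin n)) :
    ContDiffAt 𝕜 m (fun y => minorMat (H y) I J) x := by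
  simp only [minorMat]
  split_ifs
  · exact contDiffAt_det fun i j => hH _ _
  · exact contDiffAt_const

theorem isUnit_minorMat {H : Matrix (Fin n) (Fin n) ℂ} (hu : IsUnit H) : IsUnit (minorMat H) := by
  obtain ⟨u, rfl⟩ := hu
  refine isUnit_iff_exists.2 ⟨minorMat (↑u⁻¹), ?_, ?_⟩
  · rw [← minorMat_mul, Units.mul_inv, minorMat_one]
  · rw [← minorMat_mul, Units.inv_mul, minorMat_one]

theorem minorMat_inv {H : Matrix (Fin n) (Fin n) ℂ} (hu : IsUnit H) :
    (minorMat H)⁻¹ = minorMat H⁻¹ := by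
  apply Matrix.inv_eq_right_inv
  rw [← minorMat_mul, Matrix.mul_nonsing_inv _ ((Matrix.isUnit_iff_isUnit_det _).1 hu),
    minorMat_one]

theorem minorMat_apply_empty (H : Matrix (Fin n) (Fin n) ℂ) (J : Finset (Fin n)) :
    minorMat H J ∅ = if J = ∅ then 1 else 0 := by
  by_cases h : J = ∅
  · subst h
    rw [if_pos rfl, minorMat, dif_pos rfl]
    have : IsEmpty (Fin (∅ : Finset (Fin n)).card) := by
      rw [Finset.card_empty]; infer_instance
    exact Matrix.det_isEmpty
  · rw [if_neg h, minorMat, dif_neg]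
    rw [Finset.card_empty, eq_comm, Finset.card_eq_zero]
    exact h

/-- The logarithmic derivative of `∧H` satisfies the characterisation `eq_sum_numMat`:
differentiating the intertwining relation shows that it commutes with exterior products up to `∂H
H⁻¹`, and its vacuum column is zero because that column of `∧H` is constant. -/
theorem delMat_minorMat {H : Cn N → Matrix (Fin n) (Fin n) ℂ} {x : Cn N} (hH : SmoothFun H x)
    (hu : IsUnit (H x)) (u : Cn N) :
    delMat (fun y => minorMat (H y)) x u * (minorMat (H x))⁻¹ =
      ∑ a, ∑ b, (delMat H x u * (H x)⁻¹) a b • numMat ℂ a b := by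
  have hdet := (Matrix.isUnit_iff_isUnit_det _).1 hu
  have hP : SmoothFun (fun y => minorMat (H y)) x := fun I J => contDiffAt_minorMat hH I J
  have hPP : (minorMat (H x))⁻¹ * minorMat (H x) = 1 :=
    Matrix.nonsing_inv_mul _ ((Matrix.isUnit_iff_isUnit_det _).1 (isUnit_minorMat hu))
  have hPP' : minorMat (H x) * (minorMat (H x))⁻¹ = 1 := mul_eq_one_comm.1 hPP
  set δP := delMat (fun y => minorMat (H y)) x u with hδP
  have key : ∀ t : Fin n → ℂ, δP * ∑ a, t a • creMat ℂ a =
      (∑ a, ((delMat H x u).mulVec t) a • creMat ℂ a) * minorMat (H x) +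
        (∑ a, ((H x).mulVec t) a • creMat ℂ a) * δP := by
    intro t
    have hW : SmoothFun (fun y => ∑ a, ((H y).mulVec t) a • creMat ℂ a) x := by
      intro I J
      simp only [Matrix.sum_apply, Matrix.smul_apply, Matrix.mulVec, dotProduct, smul_eq_mul]
      exact ContDiffAt.sum fun a _ => (ContDiffAt.sum fun b _ =>
        (hH a b).mul contDiffAt_const).mul contDiffAt_const
    have hC : SmoothFun (fun _ : Cn N => ∑ a, t a • creMat ℂ a) x := fun _ _ => contDiffAt_const
    have h1 : delMat (fun y => minorMat (H y) * ∑ a, t a • creMat ℂ a) x u =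
        delMat (fun y => (∑ a, ((H y).mulVec t) a • creMat ℂ a) * minorMat (H y)) x u :=
      delMat_congr (Filter.Eventually.of_forall fun y => minorMat_mul_creMat (H y) t) u
    rw [delMat_mul hP hC, delMat_const, mul_zero, add_zero,
      delMat_mul hW hP] at h1
    rw [h1]
    congr 2
    ext I J
    simp only [delMat, Matrix.sum_apply, Matrix.smul_apply, Matrix.mulVec, dotProduct, smul_eq_mul]
    have hd : ∀ a, DifferentiableAt ℝ (fun y => ∑ b, H y a b * t b) x := fun a =>
      DifferentiableAt.fun_sum fun b _ => (hH.differentiableAt a b).mul_const _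
    rw [del_sum _ fun a _ => (hd a).mul_const _, LinearMap.sum_apply]
    refine Finset.sum_congr rfl fun a _ => ?_
    rw [del_mul (hd a) (differentiableAt_const _), del_const, smul_zero, zero_add,
      del_sum _ fun b _ => (hH.differentiableAt a b).mul_const _]
    simp only [LinearMap.smul_apply, LinearMap.sum_apply, smul_eq_mul]
    rw [mul_comm]
    congr 1
    refine Finset.sum_congr rfl fun b _ => ?_
    rw [del_mul (hH.differentiableAt a b) (differentiableAt_const _), del_const, smul_zero,
      zero_add, LinearMap.smul_apply, smul_eq_mul, mul_comm]
  apply eq_sum_numMat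
  · intro a
    -- With this vector, `∧H` carries the exterior product to multiplication by `e_a`.
    have h1 := key ((H x)⁻¹.mulVec (Pi.single a 1))
    have h2 : minorMat (H x) * ∑ b, ((H x)⁻¹.mulVec (Pi.single a 1)) b • creMat ℂ b =
        creMat ℂ a * minorMat (H x) := by
      rw [minorMat_mul_creMat, Matrix.mulVec_mulVec, Matrix.mul_nonsing_inv _ hdet,
        Matrix.one_mulVec]
      congr 1
      simp [Pi.single_apply]
    have h3 : ∑ b, ((H x).mulVec ((H x)⁻¹.mulVec (Pi.single a 1))) b • creMat ℂ b =
        creMat ℂ a := by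
      rw [Matrix.mulVec_mulVec, Matrix.mul_nonsing_inv _ hdet, Matrix.one_mulVec]
      simp [Pi.single_apply]
    rw [h3, Matrix.mulVec_mulVec] at h1
    have h4 : ∑ b, ((H x)⁻¹.mulVec (Pi.single a 1)) b • creMat ℂ b =
        (minorMat (H x))⁻¹ * creMat ℂ a * minorMat (H x) := by
      rw [mul_assoc, ← h2, ← mul_assoc, hPP, one_mul]
    rw [h4] at h1
    calc δP * (minorMat (H x))⁻¹ * creMat ℂ a
        = δP * ((minorMat (H x))⁻¹ * creMat ℂ a * minorMat (H x)) * (minorMat (H x))⁻¹ := by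
          simp only [mul_assoc, hPP', mul_one]
      _ = _ := by
          rw [h1, add_mul, mul_assoc _ (minorMat (H x)), hPP', mul_one, mul_assoc]
          congr 1
          simp
  · intro J
    rw [minorMat_inv hu, Matrix.mul_apply]
    refine Finset.sum_eq_zero fun K _ => ?_
    rw [minorMat_apply_empty]
    split_ifs with h
    · subst h
      simp only [hδP, delMat, minorMat_apply_empty, del_const]
      simp
    · rw [mul_zero]

/-- The connection matrix is the transpose of the logarithmic derivative; transposing `numMat` swaps
its indices accordingly. -/
theorem chernConnection_minorMat {H : Cn N → Matrix (Fin n) (Fin n) ℂ} {x : Cn N}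
    (hH : SmoothFun H x) (hu : IsUnit (H x)) (I J : Finset (Fin n)) :
    chernConnection (fun y => minorMat (H y)) x I J =
      ∑ a, ∑ b, numMat ℂ a b I J • chernConnection H x a b := by
  refine LinearMap.ext fun u => ?_
  rw [chernConnection_apply, delMat_minorMat hH hu]
  simp only [LinearMap.sum_apply, LinearMap.smul_apply, chernConnection_apply, Matrix.sum_apply,
    Matrix.smul_apply, smul_eq_mul]
  rw [Finset.sum_comm]
  refine Finset.sum_congr rfl fun a _ => Finset.sum_congr rfl fun b _ => ?_
  rw [← numMat_transpose ℂ a b, Matrix.transpose_apply, mul_comm]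

/-- The vector dual to `s` for the metric `H`. -/
def dualVec (H : Matrix (Fin n) (Fin n) ℂ) (s : Fin n → ℂ) (a : Fin n) : ℂ :=
  star ((H⁻¹.mulVec s) a)

theorem creMat_map_star (a : Fin n) : (creMat ℂ a).map star = creMat ℂ a :=
  creMat_map ℂ (starRingEnd ℂ) a

/-- The transpose of contraction with s is exterior multiplication by s, and conjugation by `∧H`
turns s into `H⁻¹ s` by `minorMat_mul_creMat`. -/
theorem adjointMatrix_koszul {H : Matrix (Fin n) (Fin n) ℂ} (hu : IsUnit H) (s : Fin n → ℂ) :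
    adjointMatrix (minorMat H) (koszulMatrix s) = ∑ a, dualVec H s a • creMat ℂ a := by
  have hdet := (Matrix.isUnit_iff_isUnit_det _).1 hu
  have h1 : (koszulMatrix s).transpose = ∑ a, s a • creMat ℂ a := by
    rw [koszulMatrix_eq, Matrix.transpose_sum]
    exact Finset.sum_congr rfl fun a _ => Matrix.transpose_smul _ _
  have h2 := minorMat_mul_creMat H (H⁻¹.mulVec s)
  rw [Matrix.mulVec_mulVec, Matrix.mul_nonsing_inv _ hdet, Matrix.one_mulVec] at h2
  have h3 : (minorMat H)⁻¹ * minorMat H = 1 :=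
    Matrix.nonsing_inv_mul _ ((Matrix.isUnit_iff_isUnit_det _).1 (isUnit_minorMat hu))
  rw [adjointMatrix, h1, mul_assoc, ← h2, ← mul_assoc, h3, one_mul]
  ext I J
  simp only [Matrix.map_apply, Matrix.sum_apply, Matrix.smul_apply, star_sum, smul_eq_mul,
    star_mul']
  refine Finset.sum_congr rfl fun a _ => ?_
  congr 1
  exact congrFun₂ (creMat_map_star a) I J

/-- The sum of the Koszul differential and its adjoint. -/
def diracMat (s t : Fin n → ℂ) : Matrix (Finset (Fin n)) (Finset (Fin n)) ℂ :=
  ∑ a, s a • annMat ℂ a + ∑ a, t a • creMat ℂ a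

/-- The Clifford relation: creations and annihilations each square to zero and only the mixed
anticommutators survive. It makes the degree-zero part of the curvature a scalar. -/
theorem diracMat_mul_self (s t : Fin n → ℂ) :
    diracMat s t * diracMat s t = (∑ a, s a * t a) • 1 := by
  have h1 : (∑ a, s a • annMat ℂ a) * (∑ a, s a • annMat ℂ a) = 0 := by
    apply matrix_eq_zero_of_eq_neg
    conv_rhs => rw [Finset.sum_mul_sum, Finset.sum_comm]
    rw [Finset.sum_mul_sum, ← Finset.sum_neg_distrib]
    refine Finset.sum_congr rfl fun a _ => ?_
    rw [← Finset.sum_neg_distrib]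
    refine Finset.sum_congr rfl fun b _ => ?_
    rw [smul_mul_smul_comm, smul_mul_smul_comm, annMat_anticomm, mul_comm, smul_neg]
  have h2 : (∑ a, t a • creMat ℂ a) * (∑ a, t a • creMat ℂ a) = 0 := by
    apply matrix_eq_zero_of_eq_neg
    conv_rhs => rw [Finset.sum_mul_sum, Finset.sum_comm]
    rw [Finset.sum_mul_sum, ← Finset.sum_neg_distrib]
    refine Finset.sum_congr rfl fun a _ => ?_
    rw [← Finset.sum_neg_distrib]
    refine Finset.sum_congr rfl fun b _ => ?_
    rw [smul_mul_smul_comm, smul_mul_smul_comm, creMat_anticomm, mul_comm, smul_neg]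
  have h3 : (∑ a, s a • annMat ℂ a) * (∑ a, t a • creMat ℂ a) =
      (∑ a, s a * t a) • 1 - (∑ a, t a • creMat ℂ a) * (∑ a, s a • annMat ℂ a) := by
    rw [Finset.sum_mul_sum, Finset.sum_mul_sum, Finset.sum_comm (s := Finset.univ) (t := Finset.univ)
      (f := fun i j => (t i • creMat ℂ i) * (s j • annMat ℂ j)), Finset.sum_smul,
      ← Finset.sum_sub_distrib]
    refine Finset.sum_congr rfl fun a _ => ?_
    have h4 : ∀ b, (s a • annMat ℂ a) * (t b • creMat ℂ b) =
        (if a = b then (s a * t b) • (1 : Matrix (Finset (Fin n)) (Finset (Fin n)) ℂ) else 0) -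
          (t b • creMat ℂ b) * (s a • annMat ℂ a) := by
      intro b
      rw [smul_mul_smul_comm, smul_mul_smul_comm, annMat_mul_creMat, smul_sub, mul_comm (t b)]
      split_ifs <;> simp
    rw [Finset.sum_congr rfl fun b _ => h4 b, Finset.sum_sub_distrib]
    simp
  rw [diracMat, mul_add, add_mul, add_mul, h1, h2, h3]
  abel

theorem numMat_commutator_diracMat (s t : Fin n → ℂ) (a b : Fin n) :
    numMat ℂ a b * diracMat s t - diracMat s t * numMat ℂ a b =
      t b • creMat ℂ a - s a • annMat ℂ b := by
  rw [diracMat, mul_add, add_mul]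
  simp only [Finset.mul_sum, Finset.sum_mul, mul_smul_comm, smul_mul_assoc, numMat_mul_creMat,
    numMat_mul_annMat, smul_sub, smul_add, Finset.sum_add_distrib, Finset.sum_sub_distrib]
  simp
  abel

theorem parityMat_mul_numMat (a b : Fin n) :
    parityMat n * numMat ℂ a b = numMat ℂ a b * parityMat n := by
  rw [numMat, ← mul_assoc, parityMat_mul_creMat, neg_mul, mul_assoc, parityMat_mul_annMat,
    mul_neg, neg_neg, mul_assoc]

theorem parityMat_mul_diracMat (s t : Fin n → ℂ) :
    parityMat n * diracMat s t = -(diracMat s t * parityMat n) := by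
  simp only [diracMat, mul_add, add_mul, Finset.mul_sum, Finset.sum_mul, mul_smul_comm,
    smul_mul_assoc, parityMat_mul_annMat, parityMat_mul_creMat, smul_neg, Finset.sum_neg_distrib,
    neg_add]

end Koszul

/-! ### The curvature of the Koszul superconnection -/

section KoszulCurvature

open scoped ContDiff

variable {N n : ℕ}

/-- The parity of the frame of a Koszul complex. -/
abbrev cardDeg (n : ℕ) : Finset (Fin n) → ℕ := fun I => I.card

/-- The constant `i √(2π)`. -/
def lam : ℂ := Complex.I * (Real.sqrt (2 * Real.pi) : ℂ)

theorem signMat_cardDeg : signMat N (cardDeg n) = tens 1 (parityMat n) := by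
  rw [signMat_eq_scalarMat, scalarMat_eq_tens]
  rfl

/-- The metric and the section are smooth, and the metric is non-degenerate, near `x`. -/
def KoszulAt (H : Cn N → Matrix (Fin n) (Fin n) ℂ) (s : Cn N → Fin n → ℂ) (x : Cn N) : Prop :=
  ∀ᶠ y in nhds x, SmoothFun H y ∧ IsUnit (H y) ∧ ∀ a, ContDiffAt ℝ ∞ (fun z => s z a) y

/-- The connection of the Koszul complex. -/
abbrev koszulHat (H : Cn N → Matrix (Fin n) (Fin n) ℂ) (s : Cn N → Fin n → ℂ) :
    Cn N → Matrix (Finset (Fin n)) (Finset (Fin n)) (Ext N) :=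
  hatConn (cardDeg n) (fun y => minorMat (H y)) (fun y => koszulMatrix (s y))

theorem KoszulAt.eventually {H : Cn N → Matrix (Fin n) (Fin n) ℂ} {s : Cn N → Fin n → ℂ}
    {x : Cn N} (h : KoszulAt H s x) : ∀ᶠ y in nhds x, KoszulAt H s y :=
  eventually_eventually_nhds.2 h

theorem KoszulAt.smooth {H : Cn N → Matrix (Fin n) (Fin n) ℂ} {s : Cn N → Fin n → ℂ}
    {x : Cn N} (h : KoszulAt H s x) : SmoothFun H x := h.self_of_nhds.1

theorem KoszulAt.isUnit {H : Cn N → Matrix (Fin n) (Fin n) ℂ} {s : Cn N → Fin n → ℂ}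
    {x : Cn N} (h : KoszulAt H s x) : IsUnit (H x) := h.self_of_nhds.2.1

theorem KoszulAt.contDiffAt {H : Cn N → Matrix (Fin n) (Fin n) ℂ} {s : Cn N → Fin n → ℂ}
    {x : Cn N} (h : KoszulAt H s x) (a : Fin n) : ContDiffAt ℝ ∞ (fun z => s z a) x :=
  h.self_of_nhds.2.2 a

theorem KoszulAt.contDiffAt_dualVec {H : Cn N → Matrix (Fin n) (Fin n) ℂ} {s : Cn N → Fin n → ℂ}
    {x : Cn N} (h : KoszulAt H s x) (a : Fin n) :
    ContDiffAt ℝ ∞ (fun z => dualVec (H z) (s z) a) x := by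
  refine contDiffAt_star ?_
  simp only [Matrix.mulVec, dotProduct]
  exact ContDiffAt.sum fun b _ => (h.smooth.inv h.isUnit a b).mul (h.contDiffAt b)

theorem KoszulAt.smoothFun_minorMat {H : Cn N → Matrix (Fin n) (Fin n) ℂ} {s : Cn N → Fin n → ℂ}
    {x : Cn N} (h : KoszulAt H s x) : SmoothFun (fun y => minorMat (H y)) x :=
  fun I J => contDiffAt_minorMat h.smooth I J

theorem KoszulAt.smoothFun_koszulMatrix {H : Cn N → Matrix (Fin n) (Fin n) ℂ}
    {s : Cn N → Fin n → ℂ} {x : Cn N} (h : KoszulAt H s x) :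
    SmoothFun (fun y => koszulMatrix (s y)) x := by
  intro I J
  simp only [koszulMatrix_eq, Matrix.sum_apply, Matrix.smul_apply, smul_eq_mul]
  exact ContDiffAt.sum fun a _ => (h.contDiffAt a).mul contDiffAt_const

theorem KoszulAt.smoothMat {H : Cn N → Matrix (Fin n) (Fin n) ℂ} {s : Cn N → Fin n → ℂ}
    {x : Cn N} (h : KoszulAt H s x) : SmoothMat (koszulHat H s) x :=
  smoothMat_hatConn h.smoothFun_minorMat (isUnit_minorMat h.isUnit) h.smoothFun_koszulMatrix

theorem KoszulAt.koszulHat_eq {H : Cn N → Matrix (Fin n) (Fin n) ℂ} {s : Cn N → Fin n → ℂ}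
    {x : Cn N} (h : KoszulAt H s x) :
    koszulHat H s x = (∑ a, ∑ b, tens (ExteriorAlgebra.ι ℂ (chernConnection H x a b))
        (parityMat n * numMat ℂ a b)) +
      lam • scalarMat N (diracMat (s x) (dualVec (H x) (s x))) := by
  have h1 : (Matrix.of fun I J => ExteriorAlgebra.ι ℂ (chernConnection
      (fun y => minorMat (H y)) x I J)) =
      ∑ a, ∑ b, tens (ExteriorAlgebra.ι ℂ (chernConnection H x a b)) (numMat ℂ a b) := by
    ext I J
    rw [Matrix.of_apply, chernConnection_minorMat h.smooth h.isUnit]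
    simp only [map_sum, map_smul, Matrix.sum_apply, tens_apply]
  rw [koszulHat, hatConn, h1, signMat_cardDeg, adjointMatrix_koszul h.isUnit, koszulMatrix_eq,
    Finset.mul_sum]
  simp only [Finset.mul_sum, tens_mul_tens, one_mul]
  rfl

/-- The coefficient of the contractions in the curvature of a Koszul complex. -/
def annForm (H : Cn N → Matrix (Fin n) (Fin n) ℂ) (s : Cn N → Fin n → ℂ) (x : Cn N) (a : Fin n) :
    Cotangent N :=
  (fderiv ℝ (fun z => s z a) x : Cn N →ₗ[ℝ] ℂ) - ∑ b, s x b • chernConnection H x b a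

/-- The coefficient of the exterior products in the curvature of a Koszul complex. -/
def creForm (H : Cn N → Matrix (Fin n) (Fin n) ℂ) (s : Cn N → Fin n → ℂ) (x : Cn N) (a : Fin n) :
    Cotangent N :=
  (fderiv ℝ (fun z => dualVec (H z) (s z) a) x : Cn N →ₗ[ℝ] ℂ) +
    ∑ b, dualVec (H x) (s x) b • chernConnection H x a b

/-- The part of positive degree of the curvature of a Koszul complex. -/
def koszulNil (H : Cn N → Matrix (Fin n) (Fin n) ℂ) (s : Cn N → Fin n → ℂ) (x : Cn N) :
    Matrix (Finset (Fin n)) (Finset (Fin n)) (Ext N) :=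
  (∑ a, ∑ b, tens (bundleCurvature H x a b) (numMat ℂ a b)) +
    lam • ∑ a, (tens (ExteriorAlgebra.ι ℂ (annForm H s x a)) (parityMat n * annMat ℂ a) +
      tens (ExteriorAlgebra.ι ℂ (creForm H s x a)) (parityMat n * creMat ℂ a))

/-- The part of degree zero of the curvature of a Koszul complex. -/
def koszulScalar (H : Cn N → Matrix (Fin n) (Fin n) ℂ) (s : Cn N → Fin n → ℂ) (x : Cn N) : ℂ :=
  lam * lam * ∑ a, s x a * dualVec (H x) (s x) a

theorem bundleCurvature_apply {κ : Type*} [Fintype κ] [DecidableEq κ]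
    (H : Cn N → Matrix κ κ ℂ) (x : Cn N) (a b : κ) :
    bundleCurvature H x a b =
      extd (fun y => ExteriorAlgebra.ι ℂ (chernConnection H y a b)) x +
        ∑ c, ExteriorAlgebra.ι ℂ (chernConnection H x a c) *
          ExteriorAlgebra.ι ℂ (chernConnection H x c b) := by
  simp [bundleCurvature, superCurvature, superMul]

theorem parity_conj (C D : Matrix (Finset (Fin n)) (Finset (Fin n)) ℂ)
    (hC : parityMat n * C = C * parityMat n) :
    parityMat n * C * (parityMat n * D) = C * D := by
  rw [hC, mul_assoc, ← mul_assoc (parityMat n), parityMat_mul_self, one_mul]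

/-- Since one-forms anticommute, symmetrising the double sum leaves only commutators of the
bilinears. The gl_n relations then collapse it to twice the right-hand side. -/
theorem connection_sq (θ : Fin n → Fin n → Cotangent N) :
    (∑ a, ∑ b, tens (ExteriorAlgebra.ι ℂ (θ a b)) (parityMat n * numMat ℂ a b)) *
      (∑ a, ∑ b, tens (ExteriorAlgebra.ι ℂ (θ a b)) (parityMat n * numMat ℂ a b)) =
      ∑ a, ∑ b, tens (∑ c, ExteriorAlgebra.ι ℂ (θ a c) * ExteriorAlgebra.ι ℂ (θ c b))
        (numMat ℂ a b) := by
  set T : Fin n × Fin n → Matrix (Finset (Fin n)) (Finset (Fin n)) (Ext N) := fun p =>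
    tens (ExteriorAlgebra.ι ℂ (θ p.1 p.2)) (parityMat n * numMat ℂ p.1 p.2) with hT
  have hswap : ∀ p q : Fin n × Fin n, ExteriorAlgebra.ι ℂ (θ q.1 q.2) *
      ExteriorAlgebra.ι ℂ (θ p.1 p.2) = -(ExteriorAlgebra.ι ℂ (θ p.1 p.2) *
        ExteriorAlgebra.ι ℂ (θ q.1 q.2)) := by
    intro p q
    rw [ι_mul_eq, invol_ι, neg_mul]
  have hpair : ∀ p q, T p * T q + T q * T p =
      tens (ExteriorAlgebra.ι ℂ (θ p.1 p.2) * ExteriorAlgebra.ι ℂ (θ q.1 q.2))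
        ((if p.2 = q.1 then numMat ℂ p.1 q.2 else 0) -
          (if q.2 = p.1 then numMat ℂ q.1 p.2 else 0)) := by
    intro p q
    simp only [hT, tens_mul_tens, parity_conj _ _ (parityMat_mul_numMat _ _)]
    rw [hswap p q, tens_neg_left, ← sub_eq_add_neg, ← tens_sub_right]
    congr 1
    rw [numMat_mul_numMat]
    abel
  rw [← Fintype.sum_prod_type' (f := fun a b => T (a, b))]
  have hsum : (∑ p, T p) * (∑ p, T p) + (∑ p, T p) * (∑ p, T p) =
      ∑ p, ∑ q, (T p * T q + T q * T p) := by
    simp only [Finset.sum_add_distrib]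
    rw [← Finset.sum_mul_sum]
    congr 1
    rw [Finset.sum_comm, ← Finset.sum_mul_sum]
  set Y := ∑ a, ∑ b, tens (∑ c, ExteriorAlgebra.ι ℂ (θ a c) * ExteriorAlgebra.ι ℂ (θ c b))
        (numMat ℂ a b) with hY
  have h1 : ∑ p : Fin n × Fin n, ∑ q : Fin n × Fin n,
      tens (ExteriorAlgebra.ι ℂ (θ p.1 p.2) * ExteriorAlgebra.ι ℂ (θ q.1 q.2))
        (if p.2 = q.1 then numMat ℂ p.1 q.2 else 0) = Y := by
    simp only [Fintype.sum_prod_type, hY, tens_sum_left]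
    refine Finset.sum_congr rfl fun a _ => ?_
    rw [Finset.sum_comm (s := Finset.univ) (t := Finset.univ) (f := fun b c => tens
      (ExteriorAlgebra.ι ℂ (θ a c) * ExteriorAlgebra.ι ℂ (θ c b)) (numMat ℂ a b))]
    refine Finset.sum_congr rfl fun b _ => ?_
    rw [Finset.sum_eq_single b]
    · simp
    · intro c _ hc
      simp [hc.symm, tens_zero_right]
    · simp
  have h2 : ∑ p : Fin n × Fin n, ∑ q : Fin n × Fin n,
      tens (ExteriorAlgebra.ι ℂ (θ p.1 p.2) * ExteriorAlgebra.ι ℂ (θ q.1 q.2))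
        (if q.2 = p.1 then numMat ℂ q.1 p.2 else 0) = -Y := by
    rw [← h1, Finset.sum_comm, ← Finset.sum_neg_distrib]
    refine Finset.sum_congr rfl fun q _ => ?_
    rw [← Finset.sum_neg_distrib]
    refine Finset.sum_congr rfl fun p _ => ?_
    rw [hswap, tens_neg_left]
  have h3 : (∑ p, T p) * (∑ p, T p) + (∑ p, T p) * (∑ p, T p) = Y + Y := by
    rw [hsum]
    simp only [hpair, tens_sub_right, Finset.sum_sub_distrib]
    rw [h1, h2, sub_neg_eq_add]
  have h4 : (2 : ℂ) • ((∑ p, T p) * (∑ p, T p)) = (2 : ℂ) • Y := by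
    rw [two_smul, two_smul, h3]
  exact smul_right_injective _ (two_ne_zero : (2 : ℂ) ≠ 0) h4

theorem scalarMat_diracMat (s t : Fin n → ℂ) : scalarMat N (diracMat s t) =
    ∑ a, tens (algebraMap ℂ (Ext N) (s a)) (annMat ℂ a) +
      ∑ a, tens (algebraMap ℂ (Ext N) (t a)) (creMat ℂ a) := by
  rw [scalarMat_eq_tens, diracMat, tens_add_right, tens_sum_right, tens_sum_right]
  simp only [tens_smul_right, Algebra.algebraMap_eq_smul_one, tens_smul_left]

/-- The parity factor of the connection anticommutes with the Dirac operator, so the anticommutator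
becomes a commutator with the bilinears, given by `numMat_commutator_diracMat`. -/
theorem anticomm_connection (θ : Fin n → Fin n → Cotangent N) (s t : Fin n → ℂ) :
    (∑ a, ∑ b, tens (ExteriorAlgebra.ι ℂ (θ a b)) (parityMat n * numMat ℂ a b)) *
        scalarMat N (diracMat s t) + scalarMat N (diracMat s t) *
      (∑ a, ∑ b, tens (ExteriorAlgebra.ι ℂ (θ a b)) (parityMat n * numMat ℂ a b)) =
      ∑ a, tens (ExteriorAlgebra.ι ℂ (∑ b, t b • θ a b)) (parityMat n * creMat ℂ a) -
        ∑ a, tens (ExteriorAlgebra.ι ℂ (∑ b, s b • θ b a)) (parityMat n * annMat ℂ a) := by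
  have h1 : ∀ a b, tens (ExteriorAlgebra.ι ℂ (θ a b)) (parityMat n * numMat ℂ a b) *
      scalarMat N (diracMat s t) + scalarMat N (diracMat s t) *
        tens (ExteriorAlgebra.ι ℂ (θ a b)) (parityMat n * numMat ℂ a b) =
      tens (ExteriorAlgebra.ι ℂ (t b • θ a b)) (parityMat n * creMat ℂ a) -
        tens (ExteriorAlgebra.ι ℂ (s a • θ a b)) (parityMat n * annMat ℂ b) := by
    intro a b
    have h2 : parityMat n * numMat ℂ a b * diracMat s t +
        diracMat s t * (parityMat n * numMat ℂ a b) =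
        t b • (parityMat n * creMat ℂ a) - s a • (parityMat n * annMat ℂ b) := by
      have h3 : diracMat s t * parityMat n = -(parityMat n * diracMat s t) := by
        rw [parityMat_mul_diracMat, neg_neg]
      rw [← mul_assoc, h3, neg_mul, mul_assoc, mul_assoc, ← sub_eq_add_neg, ← mul_sub,
        numMat_commutator_diracMat, mul_sub, mul_smul_comm, mul_smul_comm]
    rw [scalarMat_eq_tens, tens_mul_tens, tens_mul_tens, mul_one, one_mul, ← tens_add_right, h2,
      tens_sub_right, tens_smul_right, tens_smul_right, map_smul, map_smul, tens_smul_left,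
      tens_smul_left]
  rw [Finset.sum_mul, Finset.mul_sum, ← Finset.sum_add_distrib]
  simp only [Finset.sum_mul, Finset.mul_sum]
  simp only [← Finset.sum_add_distrib, h1, Finset.sum_sub_distrib, map_sum, tens_sum_left]
  congr 1
  rw [Finset.sum_comm]

theorem smoothMat_tens {α : Cn N → Ext N} {x : Cn N} (hα : ContDiffAt ℝ ∞ α x) {κ : Type*}
    [Fintype κ] [DecidableEq κ] (C : Matrix κ κ ℂ) : SmoothMat (fun y => tens (α y) C) x :=
  fun _ _ => contDiffAt_const.fun_smul (𝕜' := ℂ) hα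

theorem SmoothMat.sum {κ ι : Type*} [Fintype κ] [DecidableEq κ] (S : Finset ι)
    {A : ι → Cn N → Matrix κ κ (Ext N)} {x : Cn N} (hA : ∀ k ∈ S, SmoothMat (A k) x) :
    SmoothMat (fun y => ∑ k ∈ S, A k y) x := by
  intro i j
  simp only [Matrix.sum_apply]
  exact ContDiffAt.sum fun k hk => hA k hk i j

theorem SmoothMat.smul {κ : Type*} [Fintype κ] [DecidableEq κ] {A : Cn N → Matrix κ κ (Ext N)}
    {x : Cn N} (hA : SmoothMat A x) (c : ℂ) : SmoothMat (fun y => c • A y) x :=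
  fun i j => contDiffAt_const.fun_smul (𝕜' := ℂ) (hA i j)

theorem matD_smul {κ : Type*} [Fintype κ] [DecidableEq κ] {A : Cn N → Matrix κ κ (Ext N)}
    {x : Cn N} (hA : SmoothMat A x) (c : ℂ) : matD (fun y => c • A y) x = c • matD A x := by
  ext i j
  exact extd_const_smul c (hA.differentiableAt i j)

/-- Sort by form degree: the Dirac operator squared is the scalar, the connection part gives the
curvature of E acting as a derivation, and the cross terms complete the differentials of s and of
its dual to covariant ones. -/
theorem KoszulAt.hatCurvature_eq {H : Cn N → Matrix (Fin n) (Fin n) ℂ} {s : Cn N → Fin n → ℂ}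
    {x : Cn N} (h : KoszulAt H s x) :
    hatCurvature (cardDeg n) (koszulHat H s) x = koszulScalar H s x • 1 + koszulNil H s x := by
  set t : Cn N → Fin n → ℂ := fun z => dualVec (H z) (s z) with ht
  set X : Cn N → Matrix (Finset (Fin n)) (Finset (Fin n)) (Ext N) := fun y => ∑ a, ∑ b,
    tens (ExteriorAlgebra.ι ℂ (chernConnection H y a b)) (parityMat n * numMat ℂ a b) with hX
  set S : Cn N → Matrix (Finset (Fin n)) (Finset (Fin n)) (Ext N) := fun y =>
    scalarMat N (diracMat (s y) (t y)) with hS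
  have hθ : ∀ a b, ContDiffAt ℝ ∞
      (fun y => ExteriorAlgebra.ι ℂ (chernConnection H y a b)) x := fun a b =>
    contDiffAt_ι_chernConnection h.smooth h.isUnit a b
  have hs : ∀ a, ContDiffAt ℝ ∞ (fun y => s y a) x := h.contDiffAt
  have ht' : ∀ a, ContDiffAt ℝ ∞ (fun y => t y a) x := h.contDiffAt_dualVec
  have hXs : SmoothMat X x := SmoothMat.sum _ fun a _ => SmoothMat.sum _ fun b _ =>
    smoothMat_tens (hθ a b) _
  have hS' : S = fun y => ∑ a, tens (algebraMap ℂ (Ext N) (s y a)) (annMat ℂ a) +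
      ∑ a, tens (algebraMap ℂ (Ext N) (t y a)) (creMat ℂ a) := by
    funext y
    exact scalarMat_diracMat _ _
  have hS1 : ∀ a, SmoothMat (fun y => tens (algebraMap ℂ (Ext N) (s y a)) (annMat ℂ a)) x :=
    fun a => smoothMat_tens (contDiffAt_algebraMap (hs a)) _
  have hS2 : ∀ a, SmoothMat (fun y => tens (algebraMap ℂ (Ext N) (t y a)) (creMat ℂ a)) x :=
    fun a => smoothMat_tens (contDiffAt_algebraMap (ht' a)) _
  have hSs : SmoothMat S x := by
    rw [hS']
    exact (SmoothMat.sum _ fun a _ => hS1 a).add (SmoothMat.sum _ fun a _ => hS2 a)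
  have hDX : signMat N (cardDeg n) * matD X x = ∑ a, ∑ b,
      tens (extd (fun y => ExteriorAlgebra.ι ℂ (chernConnection H y a b)) x) (numMat ℂ a b) := by
    rw [hX, matD_sum _ fun a _ => (SmoothMat.sum _ fun b _ =>
      smoothMat_tens (hθ a b) _).differentiableAt, Finset.mul_sum]
    refine Finset.sum_congr rfl fun a _ => ?_
    rw [matD_sum _ fun b _ => (smoothMat_tens (hθ a b) _).differentiableAt, Finset.mul_sum]
    refine Finset.sum_congr rfl fun b _ => ?_
    rw [matD_tens ((hθ a b).differentiableAt (by simp)), signMat_cardDeg, tens_mul_tens, one_mul,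
      ← mul_assoc, parityMat_mul_self, one_mul]
  have hDS : signMat N (cardDeg n) * matD S x =
      ∑ a, tens (ExteriorAlgebra.ι ℂ (fderiv ℝ (fun z => s z a) x : Cn N →ₗ[ℝ] ℂ))
        (parityMat n * annMat ℂ a) +
      ∑ a, tens (ExteriorAlgebra.ι ℂ (fderiv ℝ (fun z => t z a) x : Cn N →ₗ[ℝ] ℂ))
        (parityMat n * creMat ℂ a) := by
    rw [hS', matD_add (SmoothMat.sum _ fun a _ => hS1 a) (SmoothMat.sum _ fun a _ => hS2 a),
      matD_sum _ fun a _ => (hS1 a).differentiableAt,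
      matD_sum _ fun a _ => (hS2 a).differentiableAt, mul_add, Finset.mul_sum, Finset.mul_sum]
    congr 1
    · refine Finset.sum_congr rfl fun a _ => ?_
      rw [matD_tens ((contDiffAt_algebraMap (hs a)).differentiableAt (by simp)),
        extd_algebraMap ((hs a).differentiableAt (by simp)), signMat_cardDeg, tens_mul_tens,
        one_mul]
    · refine Finset.sum_congr rfl fun a _ => ?_
      rw [matD_tens ((contDiffAt_algebraMap (ht' a)).differentiableAt (by simp)),
        extd_algebraMap ((ht' a).differentiableAt (by simp)), signMat_cardDeg, tens_mul_tens,
        one_mul]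
  have hD : matD (koszulHat H s) x = matD X x + lam • matD S x := by
    rw [← matD_smul hSs, ← matD_add hXs (hSs.smul lam)]
    exact matD_congr (h.eventually.mono fun y hy => hy.koszulHat_eq)
  have hx : koszulHat H s x = X x + lam • S x := h.koszulHat_eq
  have hSS : S x * S x = (∑ a, s x a * t x a) • 1 := by
    simp only [hS]
    rw [← scalarMat_mul, diracMat_mul_self, scalarMat_eq_tens, tens_smul_right,
      ← scalarMat_eq_tens, scalarMat, Matrix.map_one _ (map_zero _) (map_one _)]
  have hanti := anticomm_connection (chernConnection H x) (s x) (t x)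
  have hXX := connection_sq (chernConnection H x)
  change X x * S x + S x * X x = _ at hanti
  change X x * X x = _ at hXX
  rw [hatCurvature, hD, hx]
  have hexp : signMat N (cardDeg n) * (matD X x + lam • matD S x) +
      (X x + lam • S x) * (X x + lam • S x) =
      (lam * lam) • (S x * S x) + ((signMat N (cardDeg n) * matD X x + X x * X x) +
        lam • (signMat N (cardDeg n) * matD S x + (X x * S x + S x * X x))) := by
    simp only [mul_add, add_mul, smul_mul_assoc, mul_smul_comm, smul_add, smul_smul]
    abel
  rw [hexp, hSS, hXX, hanti, hDX, hDS, smul_smul]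
  congr 1
  rw [koszulNil]
  congr 1
  · rw [← Finset.sum_add_distrib]
    refine Finset.sum_congr rfl fun a _ => ?_
    rw [← Finset.sum_add_distrib]
    refine Finset.sum_congr rfl fun b _ => ?_
    rw [bundleCurvature_apply, tens_add_left]
  · congr 1
    simp only [Finset.sum_add_distrib, annForm, creForm, map_add, sub_eq_add_neg,
      tens_add_left, tens_neg_left, map_neg, Finset.sum_neg_distrib]
    abel

/-! ### The Clifford filtration: nilpotency, parity and low degrees -/

section Filtration

theorem superEven_tens {k : ℕ} {α : Ext N} (hα : α ∈ ⋀[ℂ]^k (Cotangent N))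
    {C : Matrix (Finset (Fin n)) (Finset (Fin n)) ℂ}
    (hC : parityMat n * C = (-1 : ℂ) ^ k • (C * parityMat n)) :
    SuperEven (cardDeg n) (tens α C) := by
  intro I J
  have h1 := congrFun₂ hC I J
  simp only [parityMat, Matrix.diagonal_mul, Matrix.smul_apply, Matrix.mul_diagonal,
    smul_eq_mul] at h1
  rw [tens_apply, map_smul, invol_of_mem hα, smul_smul, smul_smul]
  congr 1
  have h2 : ((-1 : ℂ) ^ J.card) * (-1) ^ J.card = 1 := by
    rw [← mul_pow]; simp
  calc C I J * (-1) ^ k = ((-1) ^ k * (C I J * (-1) ^ J.card)) * (-1) ^ J.card := by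
        linear_combination (-(C I J * (-1) ^ k)) * h2
    _ = _ := by rw [← h1, pow_add]; ring

theorem superOdd_tens {k : ℕ} {α : Ext N} (hα : α ∈ ⋀[ℂ]^k (Cotangent N))
    {C : Matrix (Finset (Fin n)) (Finset (Fin n)) ℂ}
    (hC : parityMat n * C = (-1 : ℂ) ^ (k + 1) • (C * parityMat n)) :
    SuperOdd (cardDeg n) (tens α C) := by
  intro I J
  have h1 := congrFun₂ hC I J
  simp only [parityMat, Matrix.diagonal_mul, Matrix.smul_apply, Matrix.mul_diagonal,
    smul_eq_mul] at h1
  rw [tens_apply, map_smul, invol_of_mem hα, smul_smul, smul_smul, ← neg_smul]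
  congr 1
  have h2 : ((-1 : ℂ) ^ J.card) * (-1) ^ J.card = 1 := by
    rw [← mul_pow]; simp
  calc C I J * (-1) ^ k = -((-1) ^ (k + 1) * (C I J * (-1) ^ J.card)) * (-1) ^ J.card := by
        linear_combination (-(C I J * (-1) ^ k)) * h2
    _ = _ := by rw [← h1, pow_add]; ring

/-- Products of Clifford generators. -/
abbrev cliffWord (l : List (Fin n × Bool)) : Matrix (Finset (Fin n)) (Finset (Fin n)) ℂ :=
  (l.map cliffGen).prod

theorem parityMat_mul_cliffWord (l : List (Fin n × Bool)) :
    parityMat n * cliffWord l = (-1 : ℂ) ^ l.length • (cliffWord l * parityMat n) := by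
  have h := mul_prod_of_anticomm (x := parityMat n) (l.map cliffGen) (by
    intro y hy
    obtain ⟨p, -, rfl⟩ := List.mem_map.1 hy
    exact parityMat_mul_cliffGen p)
  rw [cliffWord, h, List.length_map]
  rcases Nat.even_or_odd l.length with hl | hl
  · rw [hl.neg_one_pow, hl.neg_one_pow, one_mul, one_smul]
  · rw [hl.neg_one_pow, hl.neg_one_pow, neg_one_mul, neg_one_smul]

theorem parityMat_pow_mul_cliffWord (k : ℕ) (l : List (Fin n × Bool)) :
    parityMat n ^ k * cliffWord l = (-1 : ℂ) ^ (k * l.length) • (cliffWord l * parityMat n ^ k) := by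
  induction k with
  | zero => simp
  | succ k ih =>
    rw [pow_succ', mul_assoc, ih, mul_smul_comm, ← mul_assoc, parityMat_mul_cliffWord,
      smul_mul_assoc, smul_smul, mul_assoc, ← pow_add]
    congr 2
    ring

/-- The span of the products of a form of degree `k ≥ d` and of at most `k` Clifford generators,
with the parity of `k`. -/
def cliffSpan (N n d : ℕ) : Submodule ℂ (Matrix (Finset (Fin n)) (Finset (Fin n)) (Ext N)) :=
  Submodule.span ℂ {X | ∃ (k : ℕ) (l : List (Fin n × Bool)) (α : Ext N), d ≤ k ∧
    α ∈ ⋀[ℂ]^k (Cotangent N) ∧ l.length ≤ k ∧ Even (k + l.length) ∧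
      X = tens α (parityMat n ^ k * cliffWord l)}

theorem tens_mem_cliffSpan {d k : ℕ} {α : Ext N} (hα : α ∈ ⋀[ℂ]^k (Cotangent N))
    (l : List (Fin n × Bool)) (hd : d ≤ k) (hl : l.length ≤ k) (he : Even (k + l.length)) :
    tens α (parityMat n ^ k * cliffWord l) ∈ cliffSpan N n d :=
  Submodule.subset_span ⟨k, l, α, hd, hα, hl, he, rfl⟩

/-- Moving a power of the parity operator past a word costs only a sign; form degrees and word
lengths both add. -/
theorem mul_mem_cliffSpan {d d' : ℕ} {X Y : Matrix (Finset (Fin n)) (Finset (Fin n)) (Ext N)}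
    (hX : X ∈ cliffSpan N n d) (hY : Y ∈ cliffSpan N n d') : X * Y ∈ cliffSpan N n (d + d') := by
  induction hX using Submodule.span_induction with
  | zero => rw [zero_mul]; exact zero_mem _
  | add X X' _ _ h h' => rw [add_mul]; exact add_mem h h'
  | smul c X _ h => rw [smul_mul_assoc]; exact Submodule.smul_mem _ _ h
  | mem X hX =>
    obtain ⟨k, l, α, hd, hα, hl, he, rfl⟩ := hX
    induction hY using Submodule.span_induction with
    | zero => rw [mul_zero]; exact zero_mem _
    | add Y Y' _ _ h h' => rw [mul_add]; exact add_mem h h'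
    | smul c Y _ h => rw [mul_smul_comm]; exact Submodule.smul_mem _ _ h
    | mem Y hY =>
      obtain ⟨k', l', β, hd', hβ, hl', he', rfl⟩ := hY
      have h1 : cliffWord l * parityMat n ^ k' =
          (-1 : ℂ) ^ (k' * l.length) • (parityMat n ^ k' * cliffWord l) := by
        rw [parityMat_pow_mul_cliffWord, smul_smul, ← mul_pow]
        simp
      have h2 : parityMat n ^ k * cliffWord l * (parityMat n ^ k' * cliffWord l') =
          (-1 : ℂ) ^ (k' * l.length) • (parityMat n ^ (k + k') * cliffWord (l ++ l')) := by
        rw [cliffWord, cliffWord, cliffWord, List.map_append, List.prod_append, mul_assoc,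
          ← mul_assoc _ (parityMat n ^ k')]
        rw [show (l.map cliffGen).prod * parityMat n ^ k' = _ from h1, smul_mul_assoc,
          mul_smul_comm, pow_add]
        simp only [mul_assoc]
      rw [tens_mul_tens, h2, tens_smul_right]
      refine Submodule.smul_mem _ _ (tens_mem_cliffSpan (mul_mem_exteriorPower hα hβ) _ (by omega)
        ?_ ?_)
      · rw [List.length_append]; omega
      · rw [List.length_append]
        have := he.add he'
        rwa [show k + l.length + (k' + l'.length) = k + k' + (l.length + l'.length) by ring] at this

theorem one_mem_cliffSpan : (1 : Matrix (Finset (Fin n)) (Finset (Fin n)) (Ext N)) ∈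
    cliffSpan N n 0 := by
  have h := tens_mem_cliffSpan (d := 0) (one_mem_exteriorPower (N := N)) ([] : List (Fin n × Bool))
    le_rfl le_rfl (by simp)
  have h1 : (1 : Matrix (Finset (Fin n)) (Finset (Fin n)) (Ext N)) = tens 1 1 := by
    rw [← scalarMat_eq_tens, scalarMat, Matrix.map_one _ (map_zero _) (map_one _)]
  rw [h1]
  simpa [cliffWord] using h

theorem cliffSpan_antitone {d d' : ℕ} (h : d ≤ d') : cliffSpan N n d' ≤ cliffSpan N n d :=
  Submodule.span_mono fun _ ⟨k, l, α, hd, hr⟩ => ⟨k, l, α, h.trans hd, hr⟩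

theorem pow_mem_cliffSpan {X : Matrix (Finset (Fin n)) (Finset (Fin n)) (Ext N)}
    (hX : X ∈ cliffSpan N n 1) (k : ℕ) : X ^ k ∈ cliffSpan N n k := by
  induction k with
  | zero => rw [pow_zero]; exact one_mem_cliffSpan
  | succ k ih => rw [pow_succ]; exact mul_mem_cliffSpan ih hX

theorem eq_zero_of_mem_cliffSpan {d : ℕ} (hd : Module.finrank ℂ (Cotangent N) < d)
    {X : Matrix (Finset (Fin n)) (Finset (Fin n)) (Ext N)} (hX : X ∈ cliffSpan N n d) : X = 0 := by
  induction hX using Submodule.span_induction with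
  | zero => rfl
  | add X X' _ _ h h' => rw [h, h', add_zero]
  | smul c X _ h => rw [h, smul_zero]
  | mem X hX =>
    obtain ⟨k, l, α, hdk, hα, -, -, rfl⟩ := hX
    rw [exteriorPower_eq_zero (hd.trans_le hdk) hα, tens_zero_left]

theorem superEven_of_mem_cliffSpan {d : ℕ}
    {X : Matrix (Finset (Fin n)) (Finset (Fin n)) (Ext N)} (hX : X ∈ cliffSpan N n d) :
    SuperEven (cardDeg n) X := by
  induction hX using Submodule.span_induction with
  | zero => intro i j; simp
  | add X X' _ _ h h' => exact h.add h'
  | smul c X _ h =>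
    intro i j
    rw [Matrix.smul_apply, map_smul, h i j, smul_comm]
  | mem X hX =>
    obtain ⟨k, l, α, -, hα, -, he, rfl⟩ := hX
    refine superEven_tens hα ?_
    rw [← mul_assoc, ← pow_succ', pow_succ, mul_assoc, parityMat_mul_cliffWord, mul_smul_comm,
      mul_assoc]
    congr 1
    have h2 : (-1 : ℂ) ^ (k + l.length) = 1 := he.neg_one_pow
    rw [pow_add] at h2
    rcases neg_one_pow_eq_or ℂ k with h3 | h3 <;> rw [h3] at h2 ⊢
    · linear_combination h2
    · linear_combination -h2

/-- Only spanning elements with a form of degree m matter, and these carry a word of at most m < 2n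
generators, too short to have a supertrace. -/
theorem extDegree_superTrace_of_mem_cliffSpan {m : ℕ} (hm : m < 2 * n)
    {X : Matrix (Finset (Fin n)) (Finset (Fin n)) (Ext N)} (hX : X ∈ cliffSpan N n 0) :
    extDegree m (superTrace (cardDeg n) X) = 0 := by
  have hz : extDegree m (0 : Ext N) = 0 := by
    simpa using extDegree_smul (N := N) m 0 0
  induction hX using Submodule.span_induction with
  | zero => simpa [superTrace] using hz
  | add X X' _ _ h h' =>
    have h1 : superTrace (cardDeg n) (X + X') =
        ∑ b : Bool, superTrace (cardDeg n) (if b then X else X') := by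
      simp [superTrace, Finset.sum_add_distrib]
    rw [h1, extDegree_sum]
    simp [h, h']
  | smul c X _ h =>
    have h1 : superTrace (cardDeg n) (c • X) = c • superTrace (cardDeg n) X := by
      simp only [superTrace, Matrix.smul_apply, Finset.smul_sum]
      exact Finset.sum_congr rfl fun i _ => smul_comm _ _ _
    rw [h1, extDegree_smul, h, smul_zero]
  | mem X hX =>
    obtain ⟨k, l, α, -, hα, hl, he, rfl⟩ := hX
    rw [superTrace_tens]
    by_cases hkm : k = m
    · have h0 : ((Matrix.diagonal fun I : Finset (Fin n) => (-1 : ℂ) ^ cardDeg n I) *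
          (parityMat n ^ k * cliffWord l)).trace = 0 := by
        change (parityMat n * (parityMat n ^ k * cliffWord l)).trace = 0
        rcases Nat.even_or_odd' k with ⟨j, rfl | rfl⟩
        · rw [pow_mul, pow_two, parityMat_mul_self, one_pow, one_mul]
          exact trace_parityMat_mul_word l (by omega)
        -- In odd degree the parity operators cancel, leaving the plain trace of an odd word.
        -- Conjugation by parity negates it.
        · rw [← mul_assoc, ← pow_succ', show 2 * j + 1 + 1 = 2 * (j + 1) by ring, pow_mul, pow_two,
            parityMat_mul_self, one_pow, one_mul]
          have hodd : Odd l.length := by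
            rcases Nat.even_or_odd l.length with h | h
            · exfalso
              rw [Nat.even_add] at he
              have := he.2 h
              rw [Nat.even_add_one] at this
              exact this (even_two_mul j)
            · exact h
          have h1 : parityMat n * cliffWord l * parityMat n = -cliffWord l := by
            rw [parityMat_mul_cliffWord, hodd.neg_one_pow, neg_one_smul, neg_mul, mul_assoc,
              parityMat_mul_self, mul_one]
          have h2 : (cliffWord l).trace = -(cliffWord l).trace := by
            rw [← Matrix.trace_neg, ← h1, Matrix.trace_mul_comm, ← mul_assoc, parityMat_mul_self,
              one_mul]
          linear_combination h2 / 2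
      rw [h0, zero_smul, hz]
    · rw [extDegree_smul, extDegree_of_mem hα hkm, smul_zero]

theorem tens_cliffGen_mem {α : Ext N} (hα : α ∈ ⋀[ℂ]^1 (Cotangent N)) (p : Fin n × Bool) :
    tens α (parityMat n * cliffGen p) ∈ cliffSpan N n 1 := by
  have := tens_mem_cliffSpan hα [p] le_rfl le_rfl ⟨1, rfl⟩
  simpa [cliffWord] using this

theorem tens_cliffGen_mul_mem {α : Ext N} (hα : α ∈ ⋀[ℂ]^2 (Cotangent N)) (p q : Fin n × Bool) :
    tens α (cliffGen p * cliffGen q) ∈ cliffSpan N n 1 := by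
  have := tens_mem_cliffSpan (d := 1) hα [p, q] (by norm_num) le_rfl ⟨2, rfl⟩
  simpa [cliffWord, pow_two, parityMat_mul_self] using this

theorem tens_annMat_mem {α : Ext N} (hα : α ∈ ⋀[ℂ]^1 (Cotangent N)) (a : Fin n) :
    tens α (parityMat n * annMat ℂ a) ∈ cliffSpan N n 1 := by
  rw [annMat_eq_cliffGen, mul_add, mul_smul_comm, mul_smul_comm, tens_add_right, tens_smul_right,
    tens_smul_right]
  exact add_mem (Submodule.smul_mem _ _ (tens_cliffGen_mem hα _))
    (Submodule.smul_mem _ _ (tens_cliffGen_mem hα _))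

theorem tens_creMat_mem {α : Ext N} (hα : α ∈ ⋀[ℂ]^1 (Cotangent N)) (a : Fin n) :
    tens α (parityMat n * creMat ℂ a) ∈ cliffSpan N n 1 := by
  rw [creMat_eq_cliffGen, mul_add, mul_smul_comm, mul_smul_comm, tens_add_right, tens_smul_right,
    tens_smul_right]
  exact add_mem (Submodule.smul_mem _ _ (tens_cliffGen_mem hα _))
    (Submodule.smul_mem _ _ (tens_cliffGen_mem hα _))

theorem tens_numMat_mem {α : Ext N} (hα : α ∈ ⋀[ℂ]^2 (Cotangent N)) (a b : Fin n) :
    tens α (numMat ℂ a b) ∈ cliffSpan N n 1 := by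
  rw [numMat, annMat_eq_cliffGen, creMat_eq_cliffGen, add_mul, mul_add, mul_add]
  simp only [smul_mul_smul_comm, tens_add_right, tens_smul_right]
  refine add_mem (add_mem ?_ ?_) (add_mem ?_ ?_) <;>
    exact Submodule.smul_mem _ _ (tens_cliffGen_mul_mem hα _ _)

end Filtration

theorem bundleCurvature_mem {κ : Type*} [Fintype κ] [DecidableEq κ] {H : Cn N → Matrix κ κ ℂ}
    {x : Cn N} (hH : SmoothFun H x) (hu : IsUnit (H x)) (a b : κ) :
    bundleCurvature H x a b ∈ ⋀[ℂ]^2 (Cotangent N) := by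
  rw [bundleCurvature_apply]
  exact add_mem (extd_ι_mem ((contDiffAt_ι_chernConnection hH hu a b).differentiableAt (by simp)))
    (Submodule.sum_mem _ fun c _ => mul_mem_exteriorPower (ι_mem_exteriorPower _)
      (ι_mem_exteriorPower _))

theorem KoszulAt.koszulNil_mem {H : Cn N → Matrix (Fin n) (Fin n) ℂ} {s : Cn N → Fin n → ℂ}
    {x : Cn N} (h : KoszulAt H s x) : koszulNil H s x ∈ cliffSpan N n 1 := by
  refine add_mem (Submodule.sum_mem _ fun a _ => Submodule.sum_mem _ fun b _ =>
    tens_numMat_mem (bundleCurvature_mem h.smooth h.isUnit a b) a b)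
    (Submodule.smul_mem _ _ (Submodule.sum_mem _ fun a _ => add_mem
      (tens_annMat_mem (ι_mem_exteriorPower _) a) (tens_creMat_mem (ι_mem_exteriorPower _) a)))

theorem KoszulAt.koszulNil_pow {H : Cn N → Matrix (Fin n) (Fin n) ℂ} {s : Cn N → Fin n → ℂ}
    {x : Cn N} (h : KoszulAt H s x) {m : ℕ} (hm : Module.finrank ℂ (Cotangent N) < m) :
    koszulNil H s x ^ m = 0 :=
  eq_zero_of_mem_cliffSpan hm (pow_mem_cliffSpan h.koszulNil_mem m)

theorem KoszulAt.superEven {H : Cn N → Matrix (Fin n) (Fin n) ℂ} {s : Cn N → Fin n → ℂ}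
    {x : Cn N} (h : KoszulAt H s x) : SuperEven (cardDeg n) (koszulNil H s x) :=
  superEven_of_mem_cliffSpan h.koszulNil_mem

theorem SuperOdd.add_smul_scalar {X : Matrix (Finset (Fin n)) (Finset (Fin n)) (Ext N)}
    (hX : SuperOdd (cardDeg n) X) (c : ℂ) (s t : Fin n → ℂ) :
    SuperOdd (cardDeg n) (X + c • scalarMat N (diracMat s t)) := by
  refine hX.add (SuperOdd.smul ?_ c)
  rw [scalarMat_eq_tens]
  refine superOdd_tens one_mem_exteriorPower ?_
  rw [parityMat_mul_diracMat]
  simp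

theorem KoszulAt.superOdd {H : Cn N → Matrix (Fin n) (Fin n) ℂ} {s : Cn N → Fin n → ℂ}
    {x : Cn N} (h : KoszulAt H s x) : SuperOdd (cardDeg n) (koszulHat H s x) := by
  rw [h.koszulHat_eq]
  refine SuperOdd.add_smul_scalar (SuperOdd.sum _ fun a _ => SuperOdd.sum _ fun b _ =>
    superOdd_tens (ι_mem_exteriorPower _) ?_) _ _ _
  rw [parityMat_mul_numMat, ← mul_assoc, parityMat_mul_numMat]
  simp

/-- `koszulGram` unfolds to `minorMat`, so the defining superconnection is the one whose twisted
curvature is `koszulScalar + koszulNil`. -/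
theorem KoszulAt.koszulChernForm_eq {H : Cn N → Matrix (Fin n) (Fin n) ℂ} {s : Cn N → Fin n → ℂ}
    {x : Cn N} (h : KoszulAt H s x) {m : ℕ} (hm : koszulNil H s x ^ m = 0) :
    koszulChernForm H s x =
      expTrace (cardDeg n) m (koszulScalar H s x) (koszulNil H s x) := by
  refine superTrace_superExp (cardDeg n) ?_ hm h.superEven
  rw [← h.hatCurvature_eq]
  exact superHat_superCurvature_superconnection h.smoothFun_minorMat (isUnit_minorMat h.isUnit)
    h.smoothFun_koszulMatrix

theorem KoszulAt.contDiffAt_koszulScalar {H : Cn N → Matrix (Fin n) (Fin n) ℂ}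
    {s : Cn N → Fin n → ℂ} {x : Cn N} (h : KoszulAt H s x) :
    ContDiffAt ℝ ∞ (koszulScalar H s) x :=
  contDiffAt_const.mul (ContDiffAt.sum fun a _ => (h.contDiffAt a).mul (h.contDiffAt_dualVec a))

/-- Near the point it is the curvature minus its scalar part, and both of these are visibly smooth.
-/
theorem KoszulAt.smoothMat_koszulNil {H : Cn N → Matrix (Fin n) (Fin n) ℂ}
    {s : Cn N → Fin n → ℂ} {x : Cn N} (h : KoszulAt H s x) : SmoothMat (koszulNil H s) x := by
  have h1 : SmoothMat (fun y => hatCurvature (cardDeg n) (koszulHat H s) y +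
      (-koszulScalar H s y) • (1 : Matrix (Finset (Fin n)) (Finset (Fin n)) (Ext N))) x := by
    refine SmoothMat.add (SmoothMat.add ((smoothMat_const _ x).mul h.smoothMat.matD)
      (h.smoothMat.mul h.smoothMat)) fun i j => ?_
    exact h.contDiffAt_koszulScalar.neg.fun_smul (𝕜' := ℂ) contDiffAt_const
  refine h1.congr (h.eventually.mono fun y hy => ?_)
  change _ = hatCurvature (cardDeg n) (koszulHat H s) y + _
  rw [hy.hatCurvature_eq, neg_smul]
  abel

theorem KoszulAt.eventually_koszulChernForm {H : Cn N → Matrix (Fin n) (Fin n) ℂ}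
    {s : Cn N → Fin n → ℂ} {x : Cn N} (h : KoszulAt H s x) {m : ℕ}
    (hm : Module.finrank ℂ (Cotangent N) < m) : koszulChernForm H s =ᶠ[nhds x] fun y =>
      expTrace (cardDeg n) m (koszulScalar H s y) (koszulNil H s y) :=
  h.eventually.mono fun _ hy => hy.koszulChernForm_eq (hy.koszulNil_pow hm)

theorem KoszulAt.contDiffAt_koszulChernForm {H : Cn N → Matrix (Fin n) (Fin n) ℂ}
    {s : Cn N → Fin n → ℂ} {x : Cn N} (h : KoszulAt H s x) :
    ContDiffAt ℝ ∞ (koszulChernForm H s) x :=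
  (contDiffAt_expTrace h.smoothMat_koszulNil h.contDiffAt_koszulScalar _).congr_of_eventuallyEq
    (h.eventually_koszulChernForm (Nat.lt_succ_self _))

theorem KoszulAt.extd_koszulChernForm {H : Cn N → Matrix (Fin n) (Fin n) ℂ}
    {s : Cn N → Fin n → ℂ} {x : Cn N} (h : KoszulAt H s x) :
    extd (koszulChernForm H s) x = 0 := by
  -- One more term than nilpotency requires: `extd_expTrace` wants the power before the last cutoff
  -- to vanish already.
  rw [extd_congr (h.eventually_koszulChernForm
    (m := Module.finrank ℂ (Cotangent N) + 1 + 1) (by omega))]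
  exact extd_expTrace h.smoothMat h.superOdd h.smoothMat_koszulNil h.superEven
    h.contDiffAt_koszulScalar (h.eventually.mono fun _ hy => hy.hatCurvature_eq)
    (h.koszulNil_pow (Nat.lt_succ_self _))

theorem KoszulAt.extDegree_koszulChernForm {H : Cn N → Matrix (Fin n) (Fin n) ℂ}
    {s : Cn N → Fin n → ℂ} {x : Cn N} (h : KoszulAt H s x) {k : ℕ} (hk : k < 2 * n) :
    extDegree k (koszulChernForm H s x) = 0 := by
  rw [h.koszulChernForm_eq (h.koszulNil_pow (Nat.lt_succ_self _)), expTrace, extDegree_smul,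
    extDegree_sum, Finset.sum_eq_zero, smul_zero]
  intro j _
  rw [extDegree_smul, extDegree_superTrace_of_mem_cliffSpan hk, smul_zero]
  exact cliffSpan_antitone (Nat.zero_le _) (pow_mem_cliffSpan h.koszulNil_mem j)

end KoszulCurvature

/-! ### Independence of the holomorphic frame -/

section Gauge

open scoped ContDiff

variable {N n : ℕ}

theorem minorMat_map_star (g : Matrix (Fin n) (Fin n) ℂ) :
    minorMat (g.map star) = (minorMat g).map star := minorMat_map (starRingEnd ℂ) g

theorem koszulMatrix_mul_minorMat (g : Matrix (Fin n) (Fin n) ℂ) (s : Fin n → ℂ) :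
    koszulMatrix s * minorMat g = minorMat g * koszulMatrix (g.transpose.mulVec s) := by
  have h := congrArg Matrix.transpose (minorMat_mul_creMat g.transpose s)
  rw [Matrix.transpose_mul, Matrix.transpose_mul, minorMat_transpose, Matrix.transpose_transpose,
    Matrix.transpose_sum, Matrix.transpose_sum] at h
  simpa only [koszulMatrix_eq, Matrix.transpose_smul, creMat, Matrix.transpose_transpose] using h

theorem signMat_mul_minorMat (g : Matrix (Fin n) (Fin n) ℂ) :
    signMat N (cardDeg n) * scalarMat N (minorMat g) =
      scalarMat N (minorMat g) * signMat N (cardDeg n) := by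
  ext I J
  rw [signMat_mul_apply, mul_signMat_apply, scalarMat_apply, minorMat]
  split_ifs with h
  · change (-1 : ℂ) ^ I.card • _ = (-1 : ℂ) ^ J.card • _
    congr 1
    rw [h]
  · simp

theorem dualVec_gauge {H g k : Matrix (Fin n) (Fin n) ℂ} (hgk : g * k = 1) (s : Fin n → ℂ) :
    dualVec (g.transpose * H * g.map star) (g.transpose.mulVec s) = k.mulVec (dualVec H s) := by
  have hkg : k * g = 1 := mul_eq_one_comm.1 hgk
  have e1 : g.map star * k.map star = 1 := by rw [← map_star_mul, hgk, map_star_one]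
  have e2 : g.transpose * k.transpose = 1 := by
    rw [← Matrix.transpose_mul, hkg, Matrix.transpose_one]
  have e3 : k.transpose * g.transpose = 1 := mul_eq_one_comm.1 e2
  have h1 : (g.transpose * H * g.map star)⁻¹ = k.map star * H⁻¹ * k.transpose := by
    rw [Matrix.mul_inv_rev, Matrix.mul_inv_rev, Matrix.inv_eq_right_inv e1,
      Matrix.inv_eq_right_inv e2, mul_assoc]
  funext a
  rw [dualVec, h1, Matrix.mulVec_mulVec, mul_assoc, mul_assoc, e3, mul_one,
    ← Matrix.mulVec_mulVec]
  simp [dualVec, Matrix.mulVec, dotProduct, star_sum]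

/-- The curvature is conjugated by `∧g`, which preserves degree and so commutes with parity. The
scalar part, a pairing of s with its dual vector, is unchanged, so the nilpotent parts are conjugate
and have powers of equal supertrace. -/
theorem KoszulAt.koszulChernForm_gauge {H H' g : Cn N → Matrix (Fin n) (Fin n) ℂ}
    {s s' : Cn N → Fin n → ℂ} {x : Cn N} (h : KoszulAt H s x) (h' : KoszulAt H' s' x)
    (hg : ∀ᶠ y in nhds x, HolFun g y ∧ IsUnit (g y))
    (hH : ∀ᶠ y in nhds x, H' y = (g y).transpose * H y * (g y).map star)
    (hs : ∀ᶠ y in nhds x, s' y = (g y).transpose.mulVec (s y)) :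
    koszulChernForm H' s' x = koszulChernForm H s x := by
  have hinv : ∀ᶠ y in nhds x, g y * (g y)⁻¹ = 1 := hg.mono fun y hy =>
    Matrix.mul_nonsing_inv _ ((Matrix.isUnit_iff_isUnit_det _).1 hy.2)
  have hG : ∀ᶠ y in nhds x, HolFun (fun z => minorMat (g z)) y := hg.mono fun y hy I J =>
    contDiffAt_minorMat hy.1 I J
  have hGK : ∀ᶠ y in nhds x, minorMat (g y) * minorMat (g y)⁻¹ = 1 := hinv.mono fun y hy => by
    rw [← minorMat_mul, hy, minorMat_one]
  have hHG : ∀ᶠ y in nhds x, minorMat (H' y) =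
      (minorMat (g y)).transpose * minorMat (H y) * (minorMat (g y)).map star :=
    hH.mono fun y hy => by
      rw [hy, minorMat_mul, minorMat_mul, minorMat_transpose, minorMat_map_star]
  have hD : ∀ᶠ y in nhds x, koszulMatrix (s' y) =
      minorMat (g y)⁻¹ * koszulMatrix (s y) * minorMat (g y) := by
    filter_upwards [hs, hGK] with y hy hy'
    rw [mul_assoc, koszulMatrix_mul_minorMat, ← mul_assoc, mul_eq_one_comm.1 hy', one_mul, hy]
  have hcurv : hatCurvature (cardDeg n) (koszulHat H' s') x =
      scalarMat N (minorMat (g x)⁻¹) * hatCurvature (cardDeg n) (koszulHat H s) x *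
        scalarMat N (minorMat (g x)) := by
    have hgx := hg.self_of_nhds
    refine hatCurvature_gauge (G := fun y => minorMat (g y)) (K := fun y => minorMat (g y)⁻¹)
      h.smoothMat h.superOdd hG.self_of_nhds.smoothFun.scalarMat ?_
      (hGK.mono fun y hy => mul_eq_one_comm.1 hy) hGK.self_of_nhds (signMat_mul_minorMat _) ?_
    · exact SmoothFun.scalarMat fun I J => contDiffAt_minorMat (hgx.1.smoothFun.inv hgx.2) I J
    · filter_upwards [h.eventually, hG, hGK, hHG.eventually_nhds, hD] with y hy hGy hGKy hHy hDy
      exact hatConn_gauge (G := fun y => minorMat (g y)) (K := fun y => minorMat (g y)⁻¹)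
        hy.smoothFun_minorMat (isUnit_minorMat hy.isUnit) hGy hGKy hHy hDy
        (signMat_mul_minorMat _)
  have hc : koszulScalar H' s' x = koszulScalar H s x := by
    rw [koszulScalar, koszulScalar, hH.self_of_nhds, hs.self_of_nhds,
      dualVec_gauge hinv.self_of_nhds]
    congr 1
    change (g x).transpose.mulVec (s x) ⬝ᵥ (g x)⁻¹.mulVec (dualVec (H x) (s x)) =
      s x ⬝ᵥ dualVec (H x) (s x)
    rw [Matrix.mulVec_transpose, ← Matrix.dotProduct_mulVec, Matrix.mulVec_mulVec,
      hinv.self_of_nhds, Matrix.one_mulVec]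
  have hKG : scalarMat N (minorMat (g x)⁻¹) * scalarMat N (minorMat (g x)) = 1 := by
    rw [← scalarMat_mul, mul_eq_one_comm.1 hGK.self_of_nhds, scalarMat,
      Matrix.map_one _ (map_zero _) (map_one _)]
  have hnil : koszulNil H' s' x =
      scalarMat N (minorMat (g x)⁻¹) * koszulNil H s x * scalarMat N (minorMat (g x)) := by
    rw [h'.hatCurvature_eq, h.hatCurvature_eq, hc, mul_add, add_mul, mul_smul_comm, mul_one,
      smul_mul_assoc, hKG] at hcurv
    exact add_left_cancel hcurv
  rw [h'.koszulChernForm_eq (h'.koszulNil_pow (Nat.lt_succ_self _)),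
    h.koszulChernForm_eq (h.koszulNil_pow (Nat.lt_succ_self _)), expTrace, expTrace, hc, hnil]
  congr 1
  refine Finset.sum_congr rfl fun k _ => ?_
  congr 1
  rcases k with _ | k
  · rw [pow_zero, pow_zero]
  · rw [conj_pow hGK.self_of_nhds, superTrace_conj hGK.self_of_nhds (signMat_mul_minorMat _)]

end Gauge

/-! ### Compatibility with holomorphic pullback -/

section KoszulPullback

open scoped ContDiff

variable {N M n : ℕ} {κ : Type*} [Fintype κ] [DecidableEq κ]

theorem chernConnection_comp {H : Cn N → Matrix κ κ ℂ} {t : Cn M → Cn N} {y : Cn M}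
    (hH : SmoothFun H (t y)) (ht : DifferentiableAt ℂ t y) (i j : κ) :
    chernConnection (fun z => H (t z)) y i j =
      chernConnection H (t y) i j ∘ₗ (fderiv ℝ t y : Cn M →ₗ[ℝ] Cn N) := by
  refine LinearMap.ext fun u => ?_
  simp only [chernConnection, LinearMap.sum_apply, LinearMap.smul_apply, LinearMap.comp_apply]
  refine Finset.sum_congr rfl fun k _ => ?_
  rw [del_comp_holomorphic (hH.differentiableAt j k) ht]
  rfl

theorem hatConn_apply (deg : κ → ℕ) (H D : Cn N → Matrix κ κ ℂ) (x : Cn N) (i j : κ) :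
    hatConn deg H D x i j = (-1 : ℂ) ^ deg i • ExteriorAlgebra.ι ℂ (chernConnection H x i j) +
      lam • algebraMap ℂ (Ext N) (D x i j + adjointMatrix (H x) (D x) i j) := by
  rw [hatConn, Matrix.add_apply, signMat_mul_apply, Matrix.smul_apply, scalarMat_apply]
  rfl

theorem hatConn_pullback {deg : κ → ℕ} {H D : Cn N → Matrix κ κ ℂ} {t : Cn M → Cn N} {y : Cn M}
    (hH : SmoothFun H (t y)) (ht : DifferentiableAt ℂ t y) :
    hatConn deg (fun z => H (t z)) (fun z => D (t z)) y =
      (hatConn deg H D (t y)).map (extPullback (fderiv ℝ t y)) := by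
  ext i j
  rw [Matrix.map_apply, hatConn_apply, hatConn_apply, map_add (extPullback _), map_smul, map_smul,
    extPullback_ι, AlgHom.commutes, chernConnection_comp hH ht]

theorem matD_hatConn_apply {deg : κ → ℕ} {H D : Cn N → Matrix κ κ ℂ} {x : Cn N}
    (hH : SmoothFun H x) (hu : IsUnit (H x)) (hD : SmoothFun D x) (i j : κ) :
    matD (hatConn deg H D) x i j =
      (-1 : ℂ) ^ deg i • extd (fun z => ExteriorAlgebra.ι ℂ (chernConnection H z i j)) x +
      lam • extd (fun z => algebraMap ℂ (Ext N) (D z i j + adjointMatrix (H z) (D z) i j)) x := by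
  have h1 : DifferentiableAt ℝ (fun z => ExteriorAlgebra.ι ℂ (chernConnection H z i j)) x :=
    (contDiffAt_ι_chernConnection hH hu i j).differentiableAt (by simp)
  have h2 : DifferentiableAt ℝ
      (fun z => algebraMap ℂ (Ext N) (D z i j + adjointMatrix (H z) (D z) i j)) x :=
    (contDiffAt_algebraMap ((hD i j).add (hH.adjointMatrix hu hD i j))).differentiableAt (by simp)
  rw [← extd_const_smul _ h1, ← extd_const_smul _ h2,
    ← extd_add (h1.fun_const_smul ((-1 : ℂ) ^ deg i)) (h2.fun_const_smul lam), matD]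
  simp only [hatConn_apply]

theorem matD_hatConn_pullback {deg : κ → ℕ} {H D : Cn N → Matrix κ κ ℂ} {t : Cn M → Cn N}
    {y : Cn M} (hH : ∀ᶠ u in nhds (t y), SmoothFun H u) (hu : IsUnit (H (t y)))
    (hD : SmoothFun D (t y)) (ht : ContDiffAt ℝ ∞ t y)
    (htc : ∀ᶠ z in nhds y, DifferentiableAt ℂ t z) :
    matD (hatConn deg (fun z => H (t z)) (fun z => D (t z))) y =
      (matD (hatConn deg H D) (t y)).map (extPullback (fderiv ℝ t y)) := by
  have hHy := hH.self_of_nhds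
  have hHt : SmoothFun (fun z => H (t z)) y := fun i j => (hHy i j).comp y ht
  have hDt : SmoothFun (fun z => D (t z)) y := fun i j => (hD i j).comp y ht
  have hle : (2 : WithTop ℕ∞) ≤ ∞ := (show ((2 : ℕ∞) : WithTop ℕ∞) ≤ _ from mod_cast le_top)
  ext i j
  rw [Matrix.map_apply, matD_hatConn_apply hHy hu hD, matD_hatConn_apply hHt hu hDt, map_add
    (extPullback _), map_smul, map_smul]
  congr 2
  · rw [← extd_pullback_ι ((contDiffAt_ι_chernConnection hHy hu i j).differentiableAt (by simp))
      (ht.of_le hle)]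
    refine extd_congr ?_
    filter_upwards [htc, ht.continuousAt.eventually hH] with z hz hHz
    rw [chernConnection_comp hHz hz]
  · rw [← extd_pullback_algebraMap
      (((hD i j).add (hHy.adjointMatrix hu hD i j)).differentiableAt (by simp))
      (ht.differentiableAt (by simp))]

/-- The map t is holomorphic, so ∂ commutes with pullback and so does the Chern connection. The
curvature follows because d commutes with pullback of functions and one-forms, and pullback is an
algebra map. -/
theorem KoszulAt.koszulChernForm_pullback {H : Cn N → Matrix (Fin n) (Fin n) ℂ}
    {s : Cn N → Fin n → ℂ} {t : Cn M → Cn N} {y : Cn M} (h : KoszulAt H s (t y))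
    (ht : ∀ᶠ z in nhds y, ContDiffAt ℂ ∞ t z) :
    koszulChernForm (fun z => H (t z)) (fun z => s (t z)) y =
      extPullback (fderiv ℝ t y) (koszulChernForm H s (t y)) := by
  have htr : ∀ᶠ z in nhds y, ContDiffAt ℝ ∞ t z := ht.mono fun z hz => hz.restrict_scalars ℝ
  have h' : KoszulAt (fun z => H (t z)) (fun z => s (t z)) y := by
    filter_upwards [htr, htr.self_of_nhds.continuousAt.eventually h] with z hz hHz
    exact ⟨fun i j => (hHz.1 i j).comp z hz, hHz.2.1, fun a => (hHz.2.2 a).comp z hz⟩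
  have htd : ∀ᶠ z in nhds y, DifferentiableAt ℂ t z := ht.mono fun z hz =>
    hz.differentiableAt (by simp)
  have hcurv : hatCurvature (cardDeg n) (koszulHat (fun z => H (t z)) (fun z => s (t z))) y =
      (hatCurvature (cardDeg n) (koszulHat H s) (t y)).map (extPullback (fderiv ℝ t y)) :=
    hatCurvature_pullback
      (hatConn_pullback (deg := cardDeg n) (H := fun y => minorMat (H y))
        (D := fun y => koszulMatrix (s y)) h.smoothFun_minorMat htd.self_of_nhds)
      (matD_hatConn_pullback (deg := cardDeg n) (H := fun y => minorMat (H y))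
        (D := fun y => koszulMatrix (s y)) (h.eventually.mono fun u hu => hu.smoothFun_minorMat)
        (isUnit_minorMat h.isUnit) h.smoothFun_koszulMatrix htr.self_of_nhds htd)
  have hc : koszulScalar (fun z => H (t z)) (fun z => s (t z)) y = koszulScalar H s (t y) := rfl
  have hnil : koszulNil (fun z => H (t z)) (fun z => s (t z)) y =
      (koszulNil H s (t y)).map (extPullback (fderiv ℝ t y)) := by
    rw [h'.hatCurvature_eq, h.hatCurvature_eq, hc] at hcurv
    have h1 : (koszulScalar H s (t y) • (1 : Matrix (Finset (Fin n)) (Finset (Fin n)) (Ext N)) +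
        koszulNil H s (t y)).map (extPullback (fderiv ℝ t y)) =
        koszulScalar H s (t y) • 1 + (koszulNil H s (t y)).map (extPullback (fderiv ℝ t y)) := by
      ext I J
      rw [Matrix.map_apply, Matrix.add_apply, Matrix.add_apply, Matrix.smul_apply,
        Matrix.smul_apply, map_add, map_smul, Matrix.map_apply, Matrix.one_apply, Matrix.one_apply]
      split_ifs
      · rw [map_one]
      · rw [map_zero]
    rw [h1] at hcurv
    exact add_left_cancel hcurv
  -- One cutoff beyond both dimensions, so that the two exponential sums have the same length.
  obtain ⟨m, hm, hm'⟩ : ∃ m, Module.finrank ℂ (Cotangent N) < m ∧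
      Module.finrank ℂ (Cotangent M) < m :=
    ⟨Module.finrank ℂ (Cotangent N) + Module.finrank ℂ (Cotangent M) + 1, by omega, by omega⟩
  rw [h'.koszulChernForm_eq (h'.koszulNil_pow hm'),
    h.koszulChernForm_eq (h.koszulNil_pow hm), hnil, hc, expTrace_map]

end KoszulPullback

/-! ### Power series at nilpotent elements and the Todd identity -/

section NilEval

open PowerSeries

variable {A : Type*} [Ring A] [Algebra ℂ A]

/-- The value of a power series at an element with `P ^ m = 0`. -/
def nilEval (m : ℕ) (f : PowerSeries ℂ) (P : A) : A :=
  ∑ k ∈ Finset.range m, coeff k f • P ^ k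

theorem aeval_eq_sum_of_pow_eq_zero {m : ℕ} {P : A} (hP : P ^ m = 0) (p : Polynomial ℂ) :
    Polynomial.aeval P p = ∑ k ∈ Finset.range m, p.coeff k • P ^ k := by
  rw [Polynomial.aeval_eq_sum_range' (show p.natDegree < p.natDegree + 1 + m by omega)]
  symm
  refine Finset.sum_subset (Finset.range_subset_range.2 (by omega)) fun k _ hk => ?_
  rw [Finset.mem_range, not_lt] at hk
  rw [pow_eq_zero_of_le hk hP, smul_zero]

theorem nilEval_eq_aeval {m : ℕ} {P : A} (hP : P ^ m = 0) (f : PowerSeries ℂ) :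
    nilEval m f P = Polynomial.aeval P (trunc m f) := by
  rw [aeval_eq_sum_of_pow_eq_zero hP, nilEval]
  refine Finset.sum_congr rfl fun k hk => ?_
  rw [coeff_trunc, if_pos (Finset.mem_range.1 hk)]

/-- Coefficients of the product below m depend only on the truncations, and polynomial evaluation is
multiplicative. -/
theorem nilEval_mul {m : ℕ} {P : A} (hP : P ^ m = 0) (f g : PowerSeries ℂ) :
    nilEval m (f * g) P = nilEval m f P * nilEval m g P := by
  rw [nilEval_eq_aeval hP f, nilEval_eq_aeval hP g, ← map_mul, aeval_eq_sum_of_pow_eq_zero hP,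
    nilEval]
  refine Finset.sum_congr rfl fun k hk => ?_
  rw [coeff_mul_eq_coeff_trunc_mul_trunc f g (Finset.mem_range.1 hk), ← Polynomial.coe_mul,
    Polynomial.coeff_coe]

theorem nilEval_one {m : ℕ} (hm : 0 < m) (P : A) : nilEval m 1 P = 1 := by
  rw [nilEval, Finset.sum_eq_single 0]
  · simp
  · intro k _ hk
    rw [coeff_one, if_neg hk, zero_smul]
  · intro h
    exact absurd (Finset.mem_range.2 hm) h

theorem nilEval_X {m : ℕ} (hm : 1 < m) (P : A) : nilEval m X P = P := by
  rw [nilEval, Finset.sum_eq_single 1]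
  · simp
  · intro k _ hk
    rw [coeff_X, if_neg hk, zero_smul]
  · intro h
    exact absurd (Finset.mem_range.2 hm) h

theorem nilEval_sub (m : ℕ) (f g : PowerSeries ℂ) (P : A) :
    nilEval m (f - g) P = nilEval m f P - nilEval m g P := by
  simp only [nilEval, map_sub, sub_smul, Finset.sum_sub_distrib]

/-- The power series `∑ B'_n t^n / n!`. -/
def toddSeries : PowerSeries ℂ := bernoulli'PowerSeries ℂ

/-- The power series `exp t`. -/
def expSeries : PowerSeries ℂ := PowerSeries.exp ℂ

theorem coeff_toddSeries (k : ℕ) :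
    coeff k toddSeries = ((bernoulli' k : ℚ) : ℂ) / (k.factorial : ℂ) := by
  simp [toddSeries, bernoulli'PowerSeries]

theorem coeff_expSeries (k : ℕ) : coeff k expSeries = ((k.factorial : ℂ))⁻¹ := by
  simp [expSeries, PowerSeries.coeff_exp]

/-- Multiply the generating identity `B'(t)(e^t - 1) = t e^t` by `e^{-t}`. -/
theorem toddSeries_mul : toddSeries * (1 - evalNegHom expSeries) = X := by
  have h1 := PowerSeries.exp_mul_exp_neg_eq_one (A := ℂ)
  have h2 := bernoulli'PowerSeries_mul_exp_sub_one ℂ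
  calc toddSeries * (1 - evalNegHom expSeries)
      = (toddSeries * (expSeries - 1)) * evalNegHom expSeries := by
        rw [mul_assoc, sub_mul, one_mul, show expSeries * evalNegHom expSeries = 1 from h1]
    _ = X := by
        rw [show toddSeries * (expSeries - 1) = X * expSeries from h2, mul_assoc,
          show expSeries * evalNegHom expSeries = 1 from h1, mul_one]

theorem nilEval_evalNeg (m : ℕ) (f : PowerSeries ℂ) (P : A) :
    nilEval m (evalNegHom f) P = nilEval m f (-P) := by
  rw [nilEval, nilEval]
  refine Finset.sum_congr rfl fun k _ => ?_
  rw [evalNegHom, coeff_rescale, neg_pow P, mul_comm, ← smul_smul]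
  congr 1
  rcases Nat.even_or_odd k with h | h
  · rw [h.neg_one_pow, h.neg_one_pow, one_smul, one_mul]
  · rw [h.neg_one_pow, h.neg_one_pow, neg_one_smul, neg_one_mul]

theorem nilEval_todd_mul {m : ℕ} (hm : 1 < m) {P : A} (hP : P ^ m = 0) :
    nilEval m toddSeries P * (1 - nilEval m expSeries (-P)) = P := by
  rw [← nilEval_evalNeg, ← nilEval_one (zero_lt_one.trans hm) P, ← nilEval_sub,
    ← nilEval_mul hP, toddSeries_mul, nilEval_X hm]

theorem isUnit_nilEval_todd {m : ℕ} (hm : 0 < m) {P : A} (hP : P ^ m = 0) :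
    IsUnit (nilEval m toddSeries P) := by
  have h0 : constantCoeff toddSeries ≠ 0 := by
    rw [← coeff_zero_eq_constantCoeff_apply, coeff_toddSeries]
    simp
  have h1 := PowerSeries.mul_inv_cancel toddSeries h0
  refine isUnit_iff_exists.2 ⟨nilEval m toddSeries⁻¹ P, ?_, ?_⟩
  · rw [← nilEval_mul hP, h1, nilEval_one hm]
  · rw [← nilEval_mul hP, mul_comm, h1, nilEval_one hm]

theorem nilEval_transpose {R : Type*} [CommRing R] [Algebra ℂ R] {κ : Type*} [Fintype κ]
    [DecidableEq κ] (m : ℕ) (f : PowerSeries ℂ) (P : Matrix κ κ R) :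
    (nilEval m f P).transpose = nilEval m f P.transpose := by
  simp only [nilEval, Matrix.transpose_sum, Matrix.transpose_smul, Matrix.transpose_pow]

/-- The Todd identity over a commutative ring. -/
theorem det_todd_mul {R : Type*} [CommRing R] [Algebra ℂ R] {κ : Type*} [Fintype κ]
    [DecidableEq κ] {m : ℕ} (hm : 1 < m) {Z : Matrix κ κ R} (hZ : Z ^ m = 0) :
    (1 - nilEval m expSeries Z).det * (nilEval m toddSeries (-Z.transpose)).det =
      (-Z.transpose).det := by
  -- The Todd identity is applied to `P = -Zᵀ`, for which `e^{-P}` is the transpose of `e^Z`;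
  -- determinants do not see the transposition.
  have hP : (-Z.transpose) ^ m = 0 := by
    rw [neg_pow, ← Matrix.transpose_pow, hZ, Matrix.transpose_zero, mul_zero]
  have h := nilEval_todd_mul hm hP
  rw [neg_neg, ← nilEval_transpose m expSeries Z, ← Matrix.transpose_one,
    ← Matrix.transpose_sub] at h
  have h2 := congrArg Matrix.det h
  rw [Matrix.det_mul, Matrix.det_transpose] at h2
  rw [mul_comm, h2]

theorem isUnit_det_todd {R : Type*} [CommRing R] [Algebra ℂ R] {κ : Type*} [Fintype κ]
    [DecidableEq κ] {m : ℕ} (hm : 0 < m) {Z : Matrix κ κ R} (hZ : Z ^ m = 0) :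
    IsUnit (nilEval m toddSeries (-Z.transpose)).det := by
  refine (Matrix.isUnit_iff_isUnit_det _).1 (isUnit_nilEval_todd hm ?_)
  rw [neg_pow, ← Matrix.transpose_pow, hZ, Matrix.transpose_zero, mul_zero]

/-- The supertrace of the exponential of the operator on `∧ Rⁿ` induced by a nilpotent matrix. -/
theorem sum_nilEval_exp_numMat {R : Type*} [CommRing R] [Algebra ℂ R] {n m : ℕ}
    {Z : Matrix (Fin n) (Fin n) R} (hZ : Z ^ m = 0)
    (hD : (∑ a, ∑ b, Z a b • numMat R a b) ^ m = 0) :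
    ∑ I, (-1) ^ I.card * nilEval m expSeries (∑ a, ∑ b, Z a b • numMat R a b) I I =
      (1 - nilEval m expSeries Z).det := by
  -- `IsNilpotent.exp` uses rational scalars; this structure is induced from the complex one so that
  -- the factorials agree.
  let _ : Algebra ℚ R := ((algebraMap ℂ R).comp (algebraMap ℚ ℂ)).toAlgebra
  have hq : ∀ (k : ℕ) (r : R), coeff k expSeries • r = ((k.factorial : ℚ))⁻¹ • r := by
    intro k r
    rw [Algebra.smul_def, Algebra.smul_def, coeff_expSeries]
    congr 1
    change _ = algebraMap ℂ R (algebraMap ℚ ℂ _)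
    simp
  have h1 : ∀ {κ : Type} [Fintype κ] [DecidableEq κ] (X : Matrix κ κ R), X ^ m = 0 →
      IsNilpotent.exp X = nilEval m expSeries X := by
    intro κ _ _ X hX
    rw [IsNilpotent.exp_eq_sum hX, nilEval]
    refine Finset.sum_congr rfl fun k _ => ?_
    ext i j
    rw [Matrix.smul_apply, Matrix.smul_apply, hq]
  rw [← h1 _ hD, ← h1 _ hZ, exp_sum_numMat ⟨m, hZ⟩ ⟨m, hD⟩, sum_minorMat_diag]

end NilEval

/-! ### The Koszul form of the zero section -/

section Todd

open scoped ContDiff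

variable {N n : ℕ}

/-- The center of the algebra of forms. -/
abbrev CenterExt (N : ℕ) := Subalgebra.center ℂ (Ext N)

/-- The inclusion of the center of the algebra of forms. -/
abbrev centerVal (N : ℕ) : CenterExt N →ₐ[ℂ] Ext N := (Subalgebra.center ℂ (Ext N)).val

theorem centerVal_injective : Function.Injective (centerVal N) := Subtype.val_injective

theorem formDet_map {R : Type*} [CommRing R] [Algebra ℂ R] (F : R →ₐ[ℂ] Ext N)
    (M : Matrix (Fin n) (Fin n) R) : formDet (M.map F) = F M.det := by
  rw [formDet, Matrix.det_apply, map_sum]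
  refine Finset.sum_congr rfl fun σ _ => ?_
  rw [Units.smul_def, map_zsmul, ← List.prod_ofFn, map_list_prod, List.map_ofFn]
  rfl

theorem superPow_zero_deg {κ : Type*} [Fintype κ] [DecidableEq κ] (T : Matrix κ κ (Ext N)) (k : ℕ) :
    superPow (fun _ => 0) T k = T ^ k := by
  induction k with
  | zero => rw [pow_zero]; rfl
  | succ k ih =>
    rw [superPow, ih, pow_succ']
    ext i j
    simp [superMul, Matrix.mul_apply]

theorem nilEval_map {A B : Type*} [Ring A] [Algebra ℂ A] [Ring B] [Algebra ℂ B] (F : A →ₐ[ℂ] B)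
    (m : ℕ) (f : PowerSeries ℂ) (P : A) : F (nilEval m f P) = nilEval m f (F P) := by
  simp only [nilEval, map_sum, map_smul, map_pow]

theorem superSeries_zero_deg {κ : Type*} [Fintype κ] [DecidableEq κ] {T : Matrix κ κ (Ext N)}
    {m : ℕ} (hT : T ^ m = 0) (f : PowerSeries ℂ) :
    superSeries (fun _ => 0) (fun k => PowerSeries.coeff k f) T = nilEval m f T := by
  ext i j
  rw [superSeries, nilEval, Matrix.sum_apply]
  refine extSum_eq_of_hasSum ?_
  simp only [superPow_zero_deg]
  refine hasSum_sum_of_ne_finset_zero fun k hk => ?_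
  rw [Finset.mem_range, not_lt] at hk
  rw [pow_eq_zero_of_le hk hT, Matrix.zero_apply, smul_zero]

theorem expTrace_zero_eq {κ : Type*} [Fintype κ] [DecidableEq κ] (deg : κ → ℕ) (m : ℕ)
    (X : Matrix κ κ (Ext N)) :
    expTrace deg m 0 X = superTrace deg (nilEval m expSeries X) := by
  simp only [expTrace, Complex.exp_zero, one_smul, superTrace, nilEval, Matrix.sum_apply,
    Finset.smul_sum, Matrix.smul_apply, coeff_expSeries]
  rw [Finset.sum_comm]
  refine Finset.sum_congr rfl fun i _ => Finset.sum_congr rfl fun k _ => smul_comm _ _ _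

theorem koszulNil_zero {H : Cn N → Matrix (Fin n) (Fin n) ℂ} (x : Cn N) :
    koszulNil H (fun _ => 0) x =
      ∑ a, ∑ b, tens (bundleCurvature H x a b) (numMat ℂ a b) := by
  have h0 : ∀ z a, dualVec (H z) 0 a = 0 := by
    intro z a
    simp [dualVec]
  have h1 : ∀ a, annForm H (fun _ => 0) x a = 0 := by
    intro a
    ext u
    simp [annForm]
  have h2 : ∀ a, creForm H (fun _ => 0) x a = 0 := by
    intro a
    ext u
    simp [creForm, h0]
  simp [koszulNil, h1, h2, tens_zero_left]

theorem pow_mem_of_mem {κ : Type*} [Fintype κ] [DecidableEq κ] {T : Matrix κ κ (Ext N)}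
    (hT : ∀ a b, T a b ∈ ⋀[ℂ]^2 (Cotangent N)) (k : ℕ) (a b : κ) :
    (T ^ k) a b ∈ ⋀[ℂ]^(2 * k) (Cotangent N) := by
  induction k generalizing a b with
  | zero =>
    rw [pow_zero, Matrix.one_apply]
    split_ifs
    · exact one_mem_exteriorPower
    · exact zero_mem _
  | succ k ih =>
    rw [pow_succ, Matrix.mul_apply]
    exact Submodule.sum_mem _ fun c _ => mul_mem_exteriorPower (ih a c) (hT c b)

theorem pow_eq_zero_of_mem {κ : Type*} [Fintype κ] [DecidableEq κ] {T : Matrix κ κ (Ext N)}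
    (hT : ∀ a b, T a b ∈ ⋀[ℂ]^2 (Cotangent N)) {m : ℕ}
    (hm : Module.finrank ℂ (Cotangent N) < m) : T ^ m = 0 := by
  ext a b
  exact exteriorPower_eq_zero (by omega) (pow_mem_of_mem hT m a b)

/-- Lets the curvature be viewed as a matrix over the commutative ring `CenterExt`, where
`Matrix.det` is available. -/
theorem mem_center_of_mem {α : Ext N} (hα : α ∈ ⋀[ℂ]^2 (Cotangent N)) :
    α ∈ Subalgebra.center ℂ (Ext N) := by
  rw [Subalgebra.mem_center_iff]
  intro β
  refine (commute_of_even ?_ β).symm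
  rw [invol_of_mem hα]
  simp

/-- The dual connection matrix is `-θᵀ`. In the quadratic term the two signs cancel, and the
transposition reverses the order of anticommuting one-forms, which restores a sign. -/
theorem bundleCurvature_dual {H : Cn N → Matrix (Fin n) (Fin n) ℂ} {x : Cn N}
    (hH : ∀ᶠ y in nhds x, SmoothFun H y ∧ IsUnit (H y))
    (hherm : ∀ᶠ y in nhds x, (H y).transpose = (H y).map star) (a b : Fin n) :
    bundleCurvature (fun y => dualGram (H y)) x a b = -bundleCurvature H x b a := by
  have h1 : ∀ᶠ y in nhds x, ∀ i j, chernConnection (fun y => dualGram (H y)) y i j =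
      -chernConnection H y j i := by
    filter_upwards [hH, hherm.eventually_nhds] with y hy hy'
    exact chernConnection_dual hy.1 hy.2 hy'
  have hx := hH.self_of_nhds
  rw [bundleCurvature_apply, bundleCurvature_apply]
  simp only [h1.self_of_nhds]
  have h2 : extd (fun y => ExteriorAlgebra.ι ℂ
      (chernConnection (fun y => dualGram (H y)) y a b)) x =
      -extd (fun y => ExteriorAlgebra.ι ℂ (chernConnection H y b a)) x := by
    rw [← neg_one_smul ℂ (extd _ x), ← extd_const_smul _
      ((contDiffAt_ι_chernConnection hx.1 hx.2 b a).differentiableAt (by simp))]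
    refine extd_congr (h1.mono fun y hy => ?_)
    simp only [hy, map_neg, neg_one_smul]
  rw [h2, neg_add, ← Finset.sum_neg_distrib]
  congr 1
  refine Finset.sum_congr rfl fun c _ => ?_
  rw [map_neg, map_neg, neg_mul_neg, ι_mul_eq, invol_ι, neg_mul]

/-- All three forms are images of determinants over R: `det(1 - e^Z)`, the Todd determinant and the
determinant of `-Zᵀ`. Injectivity of F transfers nilpotency from forms back to R, where
`det_todd_mul` relates them. -/
theorem koszulChernForm_zero_of_map {R : Type*} [CommRing R] [Algebra ℂ R] (F : R →ₐ[ℂ] Ext N)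
    (hF : Function.Injective F) {H : Cn N → Matrix (Fin n) (Fin n) ℂ} {x : Cn N}
    (hH : ∀ᶠ y in nhds x, SmoothFun H y ∧ IsUnit (H y))
    (hherm : ∀ᶠ y in nhds x, (H y).transpose = (H y).map star)
    (Z : Matrix (Fin n) (Fin n) R) (hZmap : ∀ a b, F (Z a b) = bundleCurvature H x a b) :
    IsUnit (toddForm (fun y => dualGram (H y)) x) ∧
      koszulChernForm H (fun _ => 0) x * toddForm (fun y => dualGram (H y)) x =
        topChernForm (fun y => dualGram (H y)) x := by
  have hK : KoszulAt H (fun _ => 0) x := hH.mono fun y hy =>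
    ⟨hy.1, hy.2, fun _ => contDiffAt_const⟩
  obtain ⟨m, hm, hm1⟩ : ∃ m, Module.finrank ℂ (Cotangent N) < m ∧ 1 < m :=
    ⟨Module.finrank ℂ (Cotangent N) + 2, by omega, by omega⟩
  have hR : ∀ a b, bundleCurvature H x a b ∈ ⋀[ℂ]^2 (Cotangent N) :=
    bundleCurvature_mem hK.smooth hK.isUnit
  have hinj : ∀ {κ : Type} [Fintype κ] [DecidableEq κ],
      Function.Injective (F.mapMatrix (m := κ)) := fun {_} _ _ _ _ h =>
    Matrix.map_injective hF h
  have hZ' : F.mapMatrix Z = bundleCurvature H x := by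
    ext a b
    exact hZmap a b
  have hdual : F.mapMatrix (-Z.transpose) = bundleCurvature (fun y => dualGram (H y)) x := by
    ext a b
    rw [bundleCurvature_dual hH hherm, AlgHom.mapMatrix_apply, Matrix.map_apply, Matrix.neg_apply,
      map_neg, Matrix.transpose_apply, hZmap]
  have hZ : Z ^ m = 0 := by
    apply hinj
    rw [map_pow, map_zero, hZ']
    exact pow_eq_zero_of_mem hR hm
  have hPm : (-Z.transpose) ^ m = 0 := by
    rw [neg_pow, ← Matrix.transpose_pow, hZ, Matrix.transpose_zero, mul_zero]
  have hnil : koszulNil H (fun _ => 0) x = F.mapMatrix (∑ a, ∑ b, Z a b • numMat R a b) := by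
    rw [koszulNil_zero, map_sum]
    refine Finset.sum_congr rfl fun a _ => ?_
    rw [map_sum]
    refine Finset.sum_congr rfl fun b _ => ?_
    ext I J
    rw [tens_apply, AlgHom.mapMatrix_apply, Matrix.map_apply, Matrix.smul_apply, smul_eq_mul,
      map_mul, ← numMat_map ℂ (algebraMap ℂ R) a b, Matrix.map_apply,
      AlgHom.commutes, ← Algebra.commutes, ← Algebra.smul_def, hZmap]
  have hD : (∑ a, ∑ b, Z a b • numMat R a b) ^ m = 0 := by
    apply hinj
    rw [map_pow, map_zero, ← hnil]
    exact hK.koszulNil_pow hm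
  have hphi : koszulChernForm H (fun _ => 0) x = F (1 - nilEval m expSeries Z).det := by
    have hc : koszulScalar H (fun _ => 0) x = 0 := by simp [koszulScalar]
    rw [hK.koszulChernForm_eq (hK.koszulNil_pow hm), hc, expTrace_zero_eq, hnil, ← nilEval_map,
      ← sum_nilEval_exp_numMat hZ hD, superTrace, map_sum]
    refine Finset.sum_congr rfl fun I _ => ?_
    rw [map_mul, map_pow, map_neg, map_one, AlgHom.mapMatrix_apply, Matrix.map_apply,
      Algebra.smul_def, map_pow, map_neg, map_one]
  have htop : topChernForm (fun y => dualGram (H y)) x = F (-Z.transpose).det := by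
    rw [topChernForm, ← hdual, ← formDet_map]
    rfl
  have htodd : toddForm (fun y => dualGram (H y)) x =
      F (nilEval m toddSeries (-Z.transpose)).det := by
    have hPm' : F.mapMatrix (-Z.transpose) ^ m = 0 := by
      rw [← map_pow, hPm, map_zero]
    rw [toddForm, ← hdual]
    simp only [← coeff_toddSeries]
    rw [superSeries_zero_deg hPm', ← formDet_map, ← nilEval_map]
    rfl
  refine ⟨?_, ?_⟩
  · rw [htodd]
    exact (isUnit_det_todd (zero_lt_one.trans hm1) hZ).map F
  · rw [hphi, htodd, htop, ← map_mul, det_todd_mul hm1 hZ]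

theorem koszulChernForm_zero {H : Cn N → Matrix (Fin n) (Fin n) ℂ} {x : Cn N}
    (hH : ∀ᶠ y in nhds x, SmoothFun H y ∧ IsUnit (H y))
    (hherm : ∀ᶠ y in nhds x, (H y).transpose = (H y).map star) :
    IsUnit (toddForm (fun y => dualGram (H y)) x) ∧
      koszulChernForm H (fun _ => 0) x * toddForm (fun y => dualGram (H y)) x =
        topChernForm (fun y => dualGram (H y)) x :=
  koszulChernForm_zero_of_map (centerVal N) centerVal_injective hH hherm
    (fun a b => ⟨bundleCurvature H x a b, mem_center_of_mem
      (bundleCurvature_mem hH.self_of_nhds.1 hH.self_of_nhds.2 a b)⟩) fun _ _ => rfl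

end Todd

/-! ### Linear algebra of Hodge structures -/

section HodgeLinear

variable {W : Type*} [AddCommGroup W] [Module ℝ W]

theorem conjC_smul (c : ℂ) (u : VC W) : conjC (c • u) = star c • conjC u := by
  induction u using TensorProduct.induction_on with
  | zero => simp
  | tmul a x => simp [conjC, TensorProduct.smul_tmul']
  | add x y hx hy => rw [smul_add, map_add, hx, hy, map_add, smul_add]

theorem conjC_conjC (u : VC W) : conjC (conjC u) = u := by
  induction u using TensorProduct.induction_on with
  | zero => simp
  | tmul a x => simp [conjC]
  | add x y hx hy => rw [map_add, map_add, hx, hy]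

/-- The conjugate of a linear functional. -/
def conjDual (l : Module.Dual ℂ (VC W)) : Module.Dual ℂ (VC W) where
  toFun u := star (l (conjC u))
  map_add' u u' := by rw [map_add, map_add, star_add]
  map_smul' c u := by
    rw [conjC_smul, map_smul, smul_eq_mul, star_mul', star_star, RingHom.id_apply, smul_eq_mul]

theorem apply_conjC (l : Module.Dual ℂ (VC W)) (u : VC W) :
    l (conjC u) = star (conjDual l u) := by
  simp [conjDual]

theorem conjC_sum_smul {ι : Type*} (S : Finset ι) (c : ι → ℂ) (u : ι → VC W) :
    conjC (∑ i ∈ S, c i • u i) = ∑ i ∈ S, star (c i) • conjC (u i) := by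
  rw [map_sum]
  exact Finset.sum_congr rfl fun i _ => conjC_smul _ _

theorem linearIndependent_conjC {ι : Type*} [Fintype ι] {e : ι → VC W}
    (he : LinearIndependent ℂ e) : LinearIndependent ℂ fun i => conjC (e i) := by
  rw [Fintype.linearIndependent_iff] at he ⊢
  intro c hc i
  have h1 : ∑ i, star (c i) • e i = 0 := by
    have := congrArg conjC hc
    rw [conjC_sum_smul, map_zero] at this
    simpa only [conjC_conjC] using this
  exact star_eq_zero.1 (he _ h1 i)

theorem conjC_mem_span {ι : Type*} [Fintype ι] {e : ι → VC W} {u : VC W}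
    (hu : u ∈ Submodule.span ℂ (Set.range e)) :
    conjC u ∈ Submodule.span ℂ (Set.range fun i => conjC (e i)) := by
  obtain ⟨c, rfl⟩ := (Submodule.mem_span_range_iff_exists_fun ℂ).1 hu
  rw [conjC_sum_smul]
  exact (Submodule.mem_span_range_iff_exists_fun ℂ).2 ⟨_, rfl⟩

namespace HodgeStructure

variable {w : ℕ} (A : HodgeStructure W w)

theorem mem_iSup_comp (u : VC W) : u ∈ ⨆ p, A.comp p := by
  rw [A.internal.submodule_iSup_eq_top]
  trivial

/-- The projection onto `F^p` along the conjugate of `F^{w+1-p}`. -/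
def proj (p : ℕ) : VC W →ₗ[ℂ] VC W :=
  (DirectSum.toModule ℂ (Fin (w + 1)) (VC W)
      (fun q => if p ≤ (q : ℕ) then (A.comp q).subtype else 0)) ∘ₗ
    A.sumEquiv.symm.toLinearMap

theorem proj_of_mem (p : ℕ) {q : Fin (w + 1)} {u : VC W} (hu : u ∈ A.comp q) :
    A.proj p u = if p ≤ (q : ℕ) then u else 0 := by
  have h : A.sumEquiv.symm u
      = DirectSum.lof ℂ (Fin (w + 1)) (fun p => A.comp p) q ⟨u, hu⟩ := by
    rw [LinearEquiv.symm_apply_eq, sumEquiv, LinearEquiv.ofBijective_apply,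
      DirectSum.coeLinearMap_lof]
  simp only [proj, LinearMap.comp_apply, LinearEquiv.coe_coe, h, DirectSum.toModule_lof]
  split_ifs <;> rfl

theorem mem_F_of_mem {p : ℕ} {q : Fin (w + 1)} (hpq : p ≤ (q : ℕ)) {u : VC W}
    (hu : u ∈ A.comp q) : u ∈ A.F p :=
  Submodule.mem_iSup_of_mem q (Submodule.mem_iSup_of_mem hpq hu)

theorem F_induction {p : ℕ} {P : VC W → Prop} (h0 : P 0) (hadd : ∀ u v, P u → P v → P (u + v))
    (hmem : ∀ q : Fin (w + 1), p ≤ (q : ℕ) → ∀ u ∈ A.comp q, P u) {u : VC W} (hu : u ∈ A.F p) :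
    P u := by
  rw [F] at hu
  induction hu using Submodule.iSup_induction' with
  | mem q x hx =>
    by_cases hpq : p ≤ (q : ℕ)
    · rw [iSup_pos hpq] at hx
      exact hmem q hpq x hx
    · rw [iSup_neg hpq] at hx
      rw [(Submodule.mem_bot ℂ).1 hx]
      exact h0
  | zero => exact h0
  | add x y _ _ hx hy => exact hadd x y hx hy

theorem proj_of_mem_F {p : ℕ} {u : VC W} (hu : u ∈ A.F p) : A.proj p u = u := by
  refine A.F_induction (P := fun u => A.proj p u = u) (map_zero _) ?_ ?_ hu
  · intro u v hu hv
    rw [map_add, hu, hv]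
  · intro q hq u hu
    rw [A.proj_of_mem p hu, if_pos hq]

theorem proj_conjC_of_mem_F {p p' : ℕ} (hpp : w < p + p') {u : VC W} (hu : u ∈ A.F p') :
    A.proj p (conjC u) = 0 := by
  refine A.F_induction (P := fun u => A.proj p (conjC u) = 0) (by simp) ?_ ?_ hu
  · intro u v hu hv
    rw [map_add, map_add, hu, hv, add_zero]
  · intro q hq u hu
    rw [A.proj_of_mem p (A.conj_mem q u hu), if_neg]
    rw [Fin.val_rev]
    omega

/-- The projection onto `V^{q,w-q}` is a difference of two consecutive filtration projections. Those
are determined by the F^p and their conjugates, so they can be controlled by holomorphic frames. -/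
theorem weil_eq_sum_proj (u : VC W) :
    A.weil u = ∑ q : Fin (w + 1), (Complex.I ^ (2 * ((q : ℕ) : ℤ) - (w : ℤ))) •
      (A.proj q u - A.proj (q + 1) u) := by
  have hu := A.mem_iSup_comp u
  induction hu using Submodule.iSup_induction' with
  | mem p x hx =>
    rw [A.weil_of_mem hx, Finset.sum_eq_single p]
    · rw [A.proj_of_mem _ hx, A.proj_of_mem _ hx, if_pos le_rfl, if_neg (by omega), sub_zero]
    · intro q _ hqp
      have hne : (q : ℕ) ≠ p := fun h => hqp (Fin.ext h)
      rw [A.proj_of_mem _ hx, A.proj_of_mem _ hx]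
      by_cases h1 : (q : ℕ) ≤ p
      · rw [if_pos h1, if_pos (by omega), sub_self, smul_zero]
      · rw [if_neg h1, if_neg (by omega), sub_self, smul_zero]
    · simp
  | zero => simp
  | add x y _ _ hx hy =>
    rw [map_add, hx, hy, ← Finset.sum_add_distrib]
    refine Finset.sum_congr rfl fun q _ => ?_
    rw [map_add, map_add, ← smul_add]
    congr 1
    abel

/-- Frames of `F^p` and of `F^{p'}`, `p + p' = w + 1`, give a basis of the whole space. -/
theorem linearIndependent_frame {p p' : ℕ} (hpp : p + p' = w + 1) {ι ι' : Type*} [Fintype ι]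
    [Fintype ι'] {e : ι → VC W} {e' : ι' → VC W} (he : LinearIndependent ℂ e)
    (he' : LinearIndependent ℂ e') (hs : Submodule.span ℂ (Set.range e) = A.F p)
    (hs' : Submodule.span ℂ (Set.range e') = A.F p') :
    LinearIndependent ℂ (Sum.elim e fun i => conjC (e' i)) := by
  refine he.sum_type (linearIndependent_conjC he') (Submodule.disjoint_def.2 fun u hu hu' => ?_)
  rw [hs] at hu
  rw [← A.proj_of_mem_F hu]
  have h1 := conjC_mem_span hu'
  simp only [conjC_conjC] at h1
  rw [hs'] at h1
  rw [← conjC_conjC u]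
  exact A.proj_conjC_of_mem_F (by omega) h1

theorem span_frame {p p' : ℕ} (hpp : p + p' = w + 1) {ι ι' : Type*} [Fintype ι]
    [Fintype ι'] {e : ι → VC W} {e' : ι' → VC W}
    (hs : Submodule.span ℂ (Set.range e) = A.F p)
    (hs' : Submodule.span ℂ (Set.range e') = A.F p') :
    ⊤ ≤ Submodule.span ℂ (Set.range (Sum.elim e fun i => conjC (e' i))) := by
  rw [Set.Sum.elim_range, Submodule.span_union, ← A.internal.submodule_iSup_eq_top]
  refine iSup_le fun q u hu => ?_
  by_cases hpq : p ≤ (q : ℕ)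
  · refine Submodule.mem_sup_left ?_
    rw [hs]
    exact A.mem_F_of_mem hpq hu
  · refine Submodule.mem_sup_right ?_
    have h1 : conjC u ∈ Submodule.span ℂ (Set.range e') := by
      rw [hs']
      refine A.mem_F_of_mem ?_ (A.conj_mem q u hu)
      rw [Fin.val_rev]
      omega
    rw [← conjC_conjC u]
    exact conjC_mem_span h1

end HodgeStructure

variable {B : LinearMap.BilinForm ℝ W} {w : ℕ} {h : ℕ → ℕ}

namespace PeriodDomain

variable (z : PeriodDomain B w h)

/-- The Hodge metric. -/
def metric (u u' : VC W) : ℂ := formC B (z.weil u) (conjC u')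

theorem metric_add_left (u u' v : VC W) : z.metric (u + u') v = z.metric u v + z.metric u' v := by
  simp [metric]

theorem metric_add_right (u v v' : VC W) : z.metric u (v + v') = z.metric u v + z.metric u v' := by
  simp [metric]

theorem metric_smul_left (c : ℂ) (u v : VC W) : z.metric (c • u) v = c * z.metric u v := by
  simp [metric]

theorem metric_smul_right (c : ℂ) (u v : VC W) : z.metric u (c • v) = star c * z.metric u v := by
  simp [metric, conjC_smul]

theorem metric_self_im (u : VC W) : (z.metric u u).im = 0 := by
  by_cases hu : u = 0
  · simp [hu, metric]
  · exact (z.bilinear₂ u hu).2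

theorem metric_symm (u v : VC W) : z.metric v u = star (z.metric u v) := by
  -- Polarisation: reality on `u + v` compares imaginary parts, reality on `u + i v` compares real
  -- parts.
  have h1 := z.metric_self_im (u + v)
  have h2 := z.metric_self_im (u + Complex.I • v)
  have hu := z.metric_self_im u
  have hv := z.metric_self_im v
  simp only [metric_add_left, metric_add_right, metric_smul_left, metric_smul_right] at h1 h2
  simp only [Complex.add_im, Complex.mul_im, Complex.add_re, Complex.mul_re, Complex.I_re,
    Complex.I_im, Complex.star_def, Complex.conj_I, Complex.neg_im, Complex.neg_re, hu, hv] at h1 h2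
  apply Complex.ext
  · rw [Complex.star_def, Complex.conj_re]
    linarith
  · rw [Complex.star_def, Complex.conj_im]
    linarith

/-- Positivity in the second bilinear relation; it is what makes Gram matrices of frames invertible.
-/
theorem metric_self_ne_zero {u : VC W} (hu : u ≠ 0) : z.metric u u ≠ 0 := by
  intro h0
  have h1 := (z.bilinear₂ u hu).1
  rw [show formC B (z.weil u) (conjC u) = z.metric u u from rfl, h0] at h1
  simp at h1

theorem metric_sum_sum {ι ι' : Type*} (S : Finset ι) (S' : Finset ι') (c : ι → ℂ) (c' : ι' → ℂ)
    (u : ι → VC W) (u' : ι' → VC W) :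
    z.metric (∑ i ∈ S, c i • u i) (∑ j ∈ S', c' j • u' j) =
      ∑ i ∈ S, ∑ j ∈ S', c i * z.metric (u i) (u' j) * star (c' j) := by
  simp only [metric, map_sum, map_smul, LinearMap.sum_apply, conjC_smul, LinearMap.smul_apply,
    smul_eq_mul, Finset.mul_sum]
  rw [Finset.sum_comm]
  exact Finset.sum_congr rfl fun i _ => Finset.sum_congr rfl fun j _ => by ring

end PeriodDomain

end HodgeLinear

/-! ### Smooth families of vectors -/

section SmoothVectors

open scoped ContDiff

variable {W : Type*} [AddCommGroup W] [Module ℝ W] [Module.Finite ℝ W] {N : ℕ}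

/-- Smoothness of a family of vectors. -/
def SmoothVec (u : Cn N → VC W) (x : Cn N) : Prop :=
  ∀ l : Module.Dual ℂ (VC W), ContDiffAt ℝ ∞ (fun y => l (u y)) x

theorem SmoothVec.conj {u : Cn N → VC W} {x : Cn N} (hu : SmoothVec u x) :
    SmoothVec (fun y => conjC (u y)) x := by
  intro l
  simp only [apply_conjC]
  exact contDiffAt_star (hu _)

theorem smoothVec_const (u : VC W) (x : Cn N) : SmoothVec (fun _ => u) x :=
  fun _ => contDiffAt_const

theorem SmoothVec.sub {u v : Cn N → VC W} {x : Cn N} (hu : SmoothVec u x) (hv : SmoothVec v x) :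
    SmoothVec (fun y => u y - v y) x := by
  intro l
  simp only [map_sub]
  exact (hu l).sub (hv l)

theorem SmoothVec.smul {c : Cn N → ℂ} {u : Cn N → VC W} {x : Cn N} (hc : ContDiffAt ℝ ∞ c x)
    (hu : SmoothVec u x) : SmoothVec (fun y => c y • u y) x := by
  intro l
  simp only [map_smul, smul_eq_mul]
  exact hc.mul (hu l)

theorem SmoothVec.sum {ι : Type*} {S : Finset ι} {u : ι → Cn N → VC W} {x : Cn N}
    (hu : ∀ i ∈ S, SmoothVec (u i) x) : SmoothVec (fun y => ∑ i ∈ S, u i y) x := by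
  intro l
  simp only [map_sum]
  exact ContDiffAt.sum fun i hi => hu i hi l

theorem SmoothVec.congr {u v : Cn N → VC W} {x : Cn N} (hu : SmoothVec u x)
    (h : v =ᶠ[nhds x] u) : SmoothVec v x := fun l =>
  (hu l).congr_of_eventuallyEq (h.mono fun y hy => by simp only [hy])

theorem sum_finBasis (u : VC W) : ∑ k, (Module.finBasis ℂ (VC W)).coord k u •
    Module.finBasis ℂ (VC W) k = u :=
  (Module.finBasis ℂ (VC W)).sum_repr u

/-- A family of operators that is smooth on constant vectors is smooth on smooth vectors. -/
theorem SmoothVec.apply_linear {T : Cn N → VC W →ₗ[ℂ] VC W} {u : Cn N → VC W} {x : Cn N}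
    (hT : ∀ v, SmoothVec (fun y => T y v) x) (hu : SmoothVec u x) :
    SmoothVec (fun y => T y (u y)) x := by
  have h1 : (fun y => T y (u y)) = fun y => ∑ k, (Module.finBasis ℂ (VC W)).coord k (u y) •
      T y (Module.finBasis ℂ (VC W) k) := by
    funext y
    conv_lhs => rw [← sum_finBasis (u y)]
    rw [map_sum]
    exact Finset.sum_congr rfl fun k _ => map_smul _ _ _
  rw [h1]
  exact SmoothVec.sum fun k _ => SmoothVec.smul (hu _) (hT _)

theorem SmoothVec.formC (B : LinearMap.BilinForm ℝ W) {u v : Cn N → VC W} {x : Cn N}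
    (hu : SmoothVec u x) (hv : SmoothVec v x) :
    ContDiffAt ℝ ∞ (fun y => formC B (u y) (v y)) x := by
  have h1 : (fun y => PeriodForms.formC B (u y) (v y)) = fun y =>
      ∑ k, (Module.finBasis ℂ (VC W)).coord k (u y) *
        PeriodForms.formC B (Module.finBasis ℂ (VC W) k) (v y) := by
    funext y
    conv_lhs => rw [← sum_finBasis (u y)]
    rw [map_sum, LinearMap.sum_apply]
    refine Finset.sum_congr rfl fun k _ => ?_
    rw [map_smul, LinearMap.smul_apply, smul_eq_mul]
  rw [h1]
  exact ContDiffAt.sum fun k _ => (hu _).mul (hv _)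

end SmoothVectors

/-! ### Smoothness and frames of the Hodge bundles -/

section HodgeBundle

open scoped ContDiff

variable {W : Type*} [AddCommGroup W] [Module ℝ W] [Module.Finite ℝ W]
  {B : LinearMap.BilinForm ℝ W} {w : ℕ} {h : ℕ → ℕ} {N : ℕ}
  {f : Cn N → PeriodDomain B w h} {x : Cn N}

theorem IsHolFrameAt.eventually {p : ℕ} {e : Cn N → Fin (hodgeRank w h p) → VC W}
    (he : IsHolFrameAt f p e x) : ∀ᶠ y in nhds x, IsHolFrameAt f p e y :=
  eventually_eventually_nhds.2 he

theorem IsHolFrameAt.smoothVec {p : ℕ} {e : Cn N → Fin (hodgeRank w h p) → VC W}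
    (he : IsHolFrameAt f p e x) (a : Fin (hodgeRank w h p)) : SmoothVec (fun y => e y a) x :=
  fun l => (he.self_of_nhds.1 a l).contDiffAt.restrict_scalars ℝ

theorem isHolFrameAt_of_lt {p : ℕ} (hp : w < p) (e : Cn N → Fin (hodgeRank w h p) → VC W) :
    IsHolFrameAt f p e x := by
  have h0 : hodgeRank w h p = 0 := by
    rw [hodgeRank, Finset.Icc_eq_empty (by omega), Finset.sum_empty]
  have : IsEmpty (Fin (hodgeRank w h p)) := by
    rw [h0]
    infer_instance
  refine Filter.Eventually.of_forall fun y => ⟨fun a => isEmptyElim a,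
    linearIndependent_empty_type, ?_⟩
  rw [Set.range_eq_empty, Submodule.span_empty, HodgeStructure.F, eq_comm, iSup_eq_bot]
  intro q
  rw [iSup_neg]
  omega

/-- Each step of the filtration has its own neighbourhood. Only those with p ≤ w matter, since F^p
is zero beyond w, so a finite intersection suffices. -/
theorem HolAt.eventually (hf : HolAt f x) : ∀ᶠ y in nhds x, HolAt f y := by
  have h1 : ∀ p ∈ Finset.range (w + 1), ∀ᶠ y in nhds x,
      ∃ e : Cn N → Fin (hodgeRank w h p) → VC W, IsHolFrameAt f p e y := fun p _ => by
    obtain ⟨e, he⟩ := hf p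
    exact he.eventually.mono fun y hy => ⟨e, hy⟩
  filter_upwards [(Filter.eventually_all_finset _).2 h1] with y hy p
  by_cases hp : p ≤ w
  · exact hy p (Finset.mem_range.2 (by omega))
  · exact ⟨fun _ _ => 0, isHolFrameAt_of_lt (by omega) _⟩

/-- The projections of the Hodge decomposition depend smoothly on the point. -/
theorem HolAt.smoothVec_proj (hf : HolAt f x) {p : ℕ} (hp : p ≤ w + 1) (v : VC W) :
    SmoothVec (fun y => (f y).proj p v) x := by
  obtain ⟨e, he⟩ := hf p
  obtain ⟨e', he'⟩ := hf (w + 1 - p)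
  set E : Cn N → Fin (hodgeRank w h p) ⊕ Fin (hodgeRank w h (w + 1 - p)) → VC W := fun y =>
    Sum.elim (e y) fun i => conjC (e' y i) with hE
  have hEs : ∀ j, SmoothVec (fun y => E y j) x := by
    rintro (j | j)
    · exact he.smoothVec j
    · exact (he'.smoothVec j).conj
  have hpp : p + (w + 1 - p) = w + 1 := by omega
  have hx := he.self_of_nhds
  have hx' := he'.self_of_nhds
  let β : Module.Basis (Fin (hodgeRank w h p) ⊕ Fin (hodgeRank w h (w + 1 - p))) ℂ (VC W) :=
    Module.Basis.mk ((f x).linearIndependent_frame hpp hx.2.1 hx'.2.1 hx.2.2 hx'.2.2)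
      ((f x).span_frame hpp hx.2.2 hx'.2.2)
  -- The moving frame, formed from a frame of F^p and the conjugate of one of F^{w+1-p}, written in
  -- its own value at x. It is the identity there, hence invertible nearby, and its inverse gives
  -- smooth coordinates of v.
  set T : Cn N → Matrix (Fin (hodgeRank w h p) ⊕ Fin (hodgeRank w h (w + 1 - p)))
    (Fin (hodgeRank w h p) ⊕ Fin (hodgeRank w h (w + 1 - p))) ℂ := fun y i j =>
      β.coord i (E y j) with hT
  have hTs : SmoothFun T x := fun i j => hEs j _
  have hTx : T x = 1 := by
    ext i j
    have h1 : E x j = β j := (Module.Basis.mk_apply _ _ _).symm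
    change β.coord i (E x j) = _
    rw [h1, Module.Basis.coord_apply, Module.Basis.repr_self, Matrix.one_apply,
      Finsupp.single_apply]
    simp only [eq_comm]
  have hTu : IsUnit (T x) := by
    rw [hTx]
    exact isUnit_one
  have hTe := eventually_isUnit (fun i j => (hTs i j).continuousAt) hTu
  have hsm : SmoothVec (fun y => ∑ j : Fin (hodgeRank w h p),
      ((T y)⁻¹.mulVec fun i => β.coord i v) (Sum.inl j) • e y j) x := by
    refine SmoothVec.sum fun j _ => SmoothVec.smul ?_ (he.smoothVec j)
    simp only [Matrix.mulVec, dotProduct]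
    exact ContDiffAt.sum fun i _ => (hTs.inv hTu _ i).mul contDiffAt_const
  refine hsm.congr ?_
  filter_upwards [hTe, he, he'] with y hy hey hey'
  set c := (T y)⁻¹.mulVec fun i => β.coord i v with hc
  have hv : v = ∑ j, c j • E y j := by
    apply β.ext_elem
    intro i
    rw [map_sum, Finsupp.finsetSum_apply]
    have h1 : (T y).mulVec c = fun i => β.coord i v := by
      rw [hc, Matrix.mulVec_mulVec, Matrix.mul_nonsing_inv _
        ((Matrix.isUnit_iff_isUnit_det _).1 hy), Matrix.one_mulVec]
    rw [← Module.Basis.coord_apply, ← congrFun h1 i, Matrix.mulVec, dotProduct]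
    refine Finset.sum_congr rfl fun j _ => ?_
    rw [map_smul, Finsupp.smul_apply, smul_eq_mul, mul_comm]
    rfl
  conv_lhs => rw [hv]
  rw [map_sum, Fintype.sum_sum_type]
  have h2 : ∑ j : Fin (hodgeRank w h (w + 1 - p)),
      (f y).proj p (c (Sum.inr j) • E y (Sum.inr j)) = 0 := by
    refine Finset.sum_eq_zero fun j _ => ?_
    have h3 : e' y j ∈ (f y).F (w + 1 - p) := by
      rw [← hey'.2.2]
      exact Submodule.subset_span ⟨j, rfl⟩
    have h4 : E y (Sum.inr j) = conjC (e' y j) := rfl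
    rw [map_smul, h4, (f y).proj_conjC_of_mem_F (by omega) h3, smul_zero]
  rw [h2, add_zero]
  refine Finset.sum_congr rfl fun j _ => ?_
  have h3 : e y j ∈ (f y).F p := by
    rw [← hey.2.2]
    exact Submodule.subset_span ⟨j, rfl⟩
  have h4 : E y (Sum.inl j) = e y j := rfl
  rw [map_smul, h4, (f y).proj_of_mem_F h3]

theorem HolAt.smoothVec_weil (hf : HolAt f x) {u : Cn N → VC W} (hu : SmoothVec u x) :
    SmoothVec (fun y => (f y).weil (u y)) x := by
  refine SmoothVec.apply_linear (T := fun y => (f y).weil) (fun v => ?_) hu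
  simp only [HodgeStructure.weil_eq_sum_proj]
  refine SmoothVec.sum fun q _ => SmoothVec.smul contDiffAt_const ?_
  exact (hf.smoothVec_proj (by omega) v).sub (hf.smoothVec_proj (by omega) v)

theorem HolAt.smoothFun_hodgeGram (hf : HolAt f x)
    {e : Cn N → Fin (hodgeRank w h (w / 2 + 1)) → VC W} (he : IsHolFrameAt f (w / 2 + 1) e x) :
    SmoothFun (hodgeGram f e) x := fun a b =>
  contDiffAt_const.mul ((hf.smoothVec_weil (he.smoothVec a)).formC B (he.smoothVec b).conj)

theorem hodgeGram_apply (e : Cn N → Fin (hodgeRank w h (w / 2 + 1)) → VC W) (y : Cn N)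
    (a b : Fin (hodgeRank w h (w / 2 + 1))) :
    hodgeGram f e y a b = 2 * (f y).metric (e y a) (e y b) := rfl

theorem hodgeGram_transpose (e : Cn N → Fin (hodgeRank w h (w / 2 + 1)) → VC W) (y : Cn N) :
    (hodgeGram f e y).transpose = (hodgeGram f e y).map star := by
  ext a b
  rw [Matrix.transpose_apply, Matrix.map_apply, hodgeGram_apply, hodgeGram_apply, star_mul',
    (f y).metric_symm (e y a)]
  simp

/-- A kernel vector, conjugated because the metric is antilinear in its second argument, would give
a combination of the frame of norm zero. -/
theorem isUnit_hodgeGram {e : Cn N → Fin (hodgeRank w h (w / 2 + 1)) → VC W} {y : Cn N}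
    (he : LinearIndependent ℂ (e y)) : IsUnit (hodgeGram f e y) := by
  rw [← Matrix.mulVec_injective_iff_isUnit, ← Matrix.coe_mulVecLin, injective_iff_map_eq_zero]
  intro d hd
  by_contra hne
  have h1 : (f y).metric (∑ a, star (d a) • e y a) (∑ a, star (d a) • e y a) = 0 := by
    rw [PeriodDomain.metric_sum_sum]
    refine Finset.sum_eq_zero fun a _ => ?_
    have h2 := congrFun hd a
    rw [Matrix.mulVecLin_apply, Matrix.mulVec, dotProduct] at h2
    simp only [hodgeGram_apply, Pi.zero_apply] at h2
    simp only [star_star, mul_assoc, ← Finset.mul_sum] at h2 ⊢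
    rw [(mul_eq_zero.1 h2).resolve_left two_ne_zero, mul_zero]
  refine (f y).metric_self_ne_zero ?_ h1
  intro h0
  apply hne
  funext a
  exact star_eq_zero.1 (Fintype.linearIndependent_iff.1 he _ h0 a)

theorem hodgeGram_frame_change {e e' : Cn N → Fin (hodgeRank w h (w / 2 + 1)) → VC W} {y : Cn N}
    {g : Matrix (Fin (hodgeRank w h (w / 2 + 1))) (Fin (hodgeRank w h (w / 2 + 1))) ℂ}
    (hg : ∀ b, e' y b = ∑ a, g a b • e y a) :
    hodgeGram f e' y = g.transpose * hodgeGram f e y * g.map star := by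
  ext b b'
  rw [hodgeGram_apply, hg, hg, PeriodDomain.metric_sum_sum, Matrix.mul_apply, Finset.mul_sum]
  simp only [Matrix.mul_apply, Finset.sum_mul, Matrix.transpose_apply, Matrix.map_apply,
    hodgeGram_apply, Finset.mul_sum]
  rw [Finset.sum_comm]
  refine Finset.sum_congr rfl fun a _ => Finset.sum_congr rfl fun a' _ => ?_
  ring

/-- Two holomorphic frames differ by a holomorphic invertible matrix. -/
theorem IsHolFrameAt.exists_change {p : ℕ} {e e' : Cn N → Fin (hodgeRank w h p) → VC W}
    (he : IsHolFrameAt f p e x) (he' : IsHolFrameAt f p e' x) :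
    ∃ g : Cn N → Matrix (Fin (hodgeRank w h p)) (Fin (hodgeRank w h p)) ℂ,
      ∀ᶠ y in nhds x, HolFun g y ∧ IsUnit (g y) ∧ ∀ b, e' y b = ∑ a, g y a b • e y a := by
  -- Fixed functionals dual to the frame at x give holomorphic matrices L and L' for the two frames,
  -- with L invertible near x; the change of frame is then `L⁻¹ L'`.
  obtain ⟨φ, hφ⟩ := LinearMap.exists_leftInverse_of_injective
    (Fintype.linearCombination ℂ (e x)) (LinearMap.ker_eq_bot.2
      (linearIndependent_iff_injective_fintypeLinearCombination.1 he.self_of_nhds.2.1))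
  set l : Fin (hodgeRank w h p) → Module.Dual ℂ (VC W) := fun a => LinearMap.proj a ∘ₗ φ with hl
  set L : Cn N → Matrix (Fin (hodgeRank w h p)) (Fin (hodgeRank w h p)) ℂ := fun y a b =>
    l a (e y b) with hL
  set L' : Cn N → Matrix (Fin (hodgeRank w h p)) (Fin (hodgeRank w h p)) ℂ := fun y a b =>
    l a (e' y b) with hL'
  have hLx : L x = 1 := by
    ext a b
    have h1 : φ (e x b) = Pi.single b 1 := by
      have := LinearMap.congr_fun hφ (Pi.single b 1)
      simpa [Fintype.linearCombination_apply_single] using this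
    simp only [hL, hl, LinearMap.comp_apply, h1, LinearMap.proj_apply, Matrix.one_apply,
      Pi.single_apply]
  have hLs : ∀ᶠ y in nhds x, HolFun L y := he.mono fun y hy a b => (hy.1 b (l a)).contDiffAt
  have hLs' : ∀ᶠ y in nhds x, HolFun L' y := he'.mono fun y hy a b => (hy.1 b (l a)).contDiffAt
  have hLu : ∀ᶠ y in nhds x, IsUnit (L y) :=
    eventually_isUnit (fun a b => (hLs.self_of_nhds a b).continuousAt) (by
      rw [hLx]
      exact isUnit_one)
  refine ⟨fun y => (L y)⁻¹ * L' y, ?_⟩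
  filter_upwards [he, he', hLs, hLs', hLu] with y hy hy' hLy hLy' hLuy
  have hdet := (Matrix.isUnit_iff_isUnit_det _).1 hLuy
  have hmem : ∀ b, ∃ c : Fin (hodgeRank w h p) → ℂ, ∑ a, c a • e y a = e' y b := fun b => by
    rw [← Submodule.mem_span_range_iff_exists_fun, hy.2.2, ← hy'.2.2]
    exact Submodule.subset_span ⟨b, rfl⟩
  choose c hc using hmem
  have hLc : L' y = L y * Matrix.of fun a b => c b a := by
    ext a b
    change l a (e' y b) = _
    rw [← hc, map_sum, Matrix.mul_apply]
    exact Finset.sum_congr rfl fun k _ => by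
      rw [map_smul, smul_eq_mul, mul_comm]
      rfl
  have hg : (L y)⁻¹ * L' y = Matrix.of fun a b => c b a := by
    rw [hLc, ← mul_assoc, Matrix.nonsing_inv_mul _ hdet, one_mul]
  have hchange : ∀ b, e' y b = ∑ a, ((L y)⁻¹ * L' y) a b • e y a := fun b => by
    rw [hg, ← hc b]
    rfl
  refine ⟨fun a b => ?_, ?_, hchange⟩
  · simp only [Matrix.mul_apply]
    exact ContDiffAt.sum fun k _ => (contDiffAt_inv hLy hLuy a k).mul (hLy' k b)
  · rw [← Matrix.mulVec_injective_iff_isUnit, ← Matrix.coe_mulVecLin, injective_iff_map_eq_zero]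
    intro d hd
    have h1 : ∑ b, d b • e' y b = 0 := by
      simp only [hchange, Finset.smul_sum, smul_smul]
      rw [Finset.sum_comm]
      refine Finset.sum_eq_zero fun a _ => ?_
      rw [← Finset.sum_smul]
      have h2 := congrFun hd a
      rw [Matrix.mulVecLin_apply, Matrix.mulVec, dotProduct, Pi.zero_apply] at h2
      simp only [mul_comm (d _), h2, zero_smul]
    funext b
    exact Fintype.linearIndependent_iff.1 hy'.2.1 _ h1 b

end HodgeBundle

/-! ### Direct sums of r copies as Kronecker products -/

section Kronecker

variable {r n : ℕ}

/-- The Kronecker product, with the index set identified with `Fin (r * n)`. -/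
def kron (k : Matrix (Fin r) (Fin r) ℂ) (H : Matrix (Fin n) (Fin n) ℂ) :
    Matrix (Fin (r * n)) (Fin (r * n)) ℂ :=
  (Matrix.kronecker k H).submatrix finProdFinEquiv.symm finProdFinEquiv.symm

theorem kron_apply (k : Matrix (Fin r) (Fin r) ℂ) (H : Matrix (Fin n) (Fin n) ℂ)
    (i j : Fin (r * n)) : kron k H i j =
      k (finProdFinEquiv.symm i).1 (finProdFinEquiv.symm j).1 *
        H (finProdFinEquiv.symm i).2 (finProdFinEquiv.symm j).2 := rfl

theorem kron_mul (k k' : Matrix (Fin r) (Fin r) ℂ) (H H' : Matrix (Fin n) (Fin n) ℂ) :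
    kron (k * k') (H * H') = kron k H * kron k' H' := by
  rw [kron, kron, kron, Matrix.submatrix_mul_equiv,
    show Matrix.kronecker (k * k') (H * H') = Matrix.kronecker k H * Matrix.kronecker k' H' from
      Matrix.mul_kronecker_mul k k' H H']

theorem kron_transpose (k : Matrix (Fin r) (Fin r) ℂ) (H : Matrix (Fin n) (Fin n) ℂ) :
    (kron k H).transpose = kron k.transpose H.transpose := rfl

theorem kron_map_star (k : Matrix (Fin r) (Fin r) ℂ) (H : Matrix (Fin n) (Fin n) ℂ) :
    (kron k H).map star = kron (k.map star) (H.map star) := by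
  ext i j
  simp only [Matrix.map_apply, kron_apply, star_mul']

theorem kron_one_one : kron (1 : Matrix (Fin r) (Fin r) ℂ) (1 : Matrix (Fin n) (Fin n) ℂ) = 1 := by
  rw [kron, Matrix.kronecker, Matrix.kroneckerMap_one_one _ (by simp) (by simp) (by simp),
    Matrix.submatrix_one_equiv]

/-- In this form changes of frame of ℱ act as `1 ⊗ g` and rotations of the vectors as `k ⊗ 1`. -/
theorem sumGram_eq_kron (H : Matrix (Fin n) (Fin n) ℂ) : sumGram r H = kron 1 H := by
  ext i j
  rw [sumGram, kron_apply, Matrix.one_apply]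
  split_ifs <;> simp

theorem isUnit_kron {k : Matrix (Fin r) (Fin r) ℂ} {H : Matrix (Fin n) (Fin n) ℂ}
    (hk : IsUnit k) (hH : IsUnit H) : IsUnit (kron k H) := by
  obtain ⟨k, rfl⟩ := hk
  obtain ⟨H, rfl⟩ := hH
  refine isUnit_iff_exists.2 ⟨kron (↑k⁻¹) (↑H⁻¹), ?_, ?_⟩
  · rw [← kron_mul, Units.mul_inv, Units.mul_inv, kron_one_one]
  · rw [← kron_mul, Units.inv_mul, Units.inv_mul, kron_one_one]

theorem kron_transpose_mulVec_sumSection (k : Matrix (Fin r) (Fin r) ℂ)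
    (g : Matrix (Fin n) (Fin n) ℂ) (s : Fin r → Fin n → ℂ) :
    (kron k g).transpose.mulVec (sumSection s) =
      sumSection fun j b => ∑ i, ∑ a, k i j * g a b * s i a := by
  funext q
  rw [Matrix.mulVec, dotProduct, sumSection, ← finProdFinEquiv.sum_comp, Fintype.sum_prod_type]
  refine Finset.sum_congr rfl fun i _ => Finset.sum_congr rfl fun a _ => ?_
  rw [Matrix.transpose_apply, kron_apply, sumSection, Equiv.symm_apply_apply]

end Kronecker

/-! ### The forms φ on the period domain -/

section Forms

open scoped ContDiff

variable {W : Type*} [AddCommGroup W] [Module ℝ W] [Module.Finite ℝ W]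
  {B : LinearMap.BilinForm ℝ W} {w : ℕ} {h : ℕ → ℕ} {N r : ℕ}
  {f : Cn N → PeriodDomain B w h} {x : Cn N}

/-- The form involves derivatives, so it depends on germs; gauge invariance with the identity matrix
gives the comparison at once. -/
theorem koszulChernForm_congr {n : ℕ} {H H' : Cn N → Matrix (Fin n) (Fin n) ℂ}
    {s s' : Cn N → Fin n → ℂ} (hK : KoszulAt H s x) (hH : H' =ᶠ[nhds x] H)
    (hs : s' =ᶠ[nhds x] s) : koszulChernForm H' s' x = koszulChernForm H s x := by
  have hK' : KoszulAt H' s' x := by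
    filter_upwards [hK, hH.eventuallyEq_nhds, hs.eventuallyEq_nhds] with y hy hHy hsy
    refine ⟨fun i j => (hy.1 i j).congr_of_eventuallyEq (hHy.mono fun z hz => congrFun₂ hz i j),
      ?_, fun a => (hy.2.2 a).congr_of_eventuallyEq (hsy.mono fun z hz => congrFun hz a)⟩
    rw [hHy.self_of_nhds]
    exact hy.2.1
  refine hK.koszulChernForm_gauge hK' (g := fun _ => 1)
    (Filter.Eventually.of_forall fun y => ⟨fun _ _ => contDiffAt_const, isUnit_one⟩) ?_ ?_
  · filter_upwards [hH] with y hy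
    rw [hy, Matrix.transpose_one, map_star_one, one_mul, mul_one]
  · filter_upwards [hs] with y hy
    rw [hy, Matrix.transpose_one, Matrix.one_mulVec]

/-- The section of the dual of `ℱ^{⊕ r}` given by `r` vectors. -/
def hodgeSection (B : LinearMap.BilinForm ℝ W) (v : Fin r → W) {n : ℕ}
    (e : Cn N → Fin n → VC W) (y : Cn N) : Fin (r * n) → ℂ :=
  sumSection fun i a => formC B (e y a) (1 ⊗ₜ[ℝ] v i)

theorem HolAt.hodgeGram_eventually (hf : HolAt f x)
    {e : Cn N → Fin (hodgeRank w h (w / 2 + 1)) → VC W} (he : IsHolFrameAt f (w / 2 + 1) e x) :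
    ∀ᶠ y in nhds x, SmoothFun (hodgeGram f e) y ∧ IsUnit (hodgeGram f e y) := by
  filter_upwards [hf.eventually, he.eventually] with y hy hey
  exact ⟨hy.smoothFun_hodgeGram hey, isUnit_hodgeGram hey.self_of_nhds.2.1⟩

theorem HolAt.koszulAt (hf : HolAt f x) {e : Cn N → Fin (hodgeRank w h (w / 2 + 1)) → VC W}
    (he : IsHolFrameAt f (w / 2 + 1) e x) (v : Fin r → W) :
    KoszulAt (fun y => sumGram r (hodgeGram f e y)) (hodgeSection B v e) x := by
  filter_upwards [hf.hodgeGram_eventually he, he.eventually] with y hy hey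
  refine ⟨fun i j => ?_, ?_, fun a => ?_⟩
  · simp only [sumGram_eq_kron, kron_apply]
    exact contDiffAt_const.mul (hy.1 _ _)
  · rw [sumGram_eq_kron]
    exact isUnit_kron isUnit_one hy.2
  · exact (hey.smoothVec _).formC B (smoothVec_const _ _)

theorem phiInFrame_eq (v : Fin r → W) (e : Cn N → Fin (hodgeRank w h (w / 2 + 1)) → VC W) :
    phiInFrame v f e x = (Real.exp (-Real.pi * ∑ i, B (v i) (v i)) : ℂ) •
      koszulChernForm (fun y => sumGram r (hodgeGram f e y)) (hodgeSection B v e) x := rfl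

/-- The change of frame g of ℱ induces `1 ⊗ g` on the sum of r copies, which transforms both the
metric and the sections as gauge invariance requires. -/
theorem phiInFrame_frame_change (hf : HolAt f x)
    {e e' : Cn N → Fin (hodgeRank w h (w / 2 + 1)) → VC W} (he : IsHolFrameAt f (w / 2 + 1) e x)
    (he' : IsHolFrameAt f (w / 2 + 1) e' x) (v : Fin r → W) :
    phiInFrame v f e' x = phiInFrame v f e x := by
  obtain ⟨g, hg⟩ := he.exists_change he'
  rw [phiInFrame_eq, phiInFrame_eq]
  refine congrArg (fun α : Ext _ => (_ : ℂ) • α) ?_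
  refine (hf.koszulAt he v).koszulChernForm_gauge (hf.koszulAt he' v) (g := fun y => kron 1 (g y))
    ?_ ?_ ?_
  · filter_upwards [hg] with y hy
    refine ⟨fun i j => ?_, isUnit_kron isUnit_one hy.2.1⟩
    simp only [kron_apply]
    exact contDiffAt_const.mul (hy.1 _ _)
  · filter_upwards [hg] with y hy
    rw [sumGram_eq_kron, sumGram_eq_kron, hodgeGram_frame_change hy.2.2, kron_map_star,
      kron_transpose, ← kron_mul, ← kron_mul, Matrix.transpose_one, map_star_one, one_mul, mul_one]
  · filter_upwards [hg] with y hy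
    rw [hodgeSection, hodgeSection, kron_transpose_mulVec_sumSection]
    congr 1
    funext j b
    rw [hy.2.2, map_sum, LinearMap.sum_apply, Finset.sum_eq_single j]
    · refine Finset.sum_congr rfl fun a _ => ?_
      rw [Matrix.one_apply_eq, one_mul, map_smul, LinearMap.smul_apply, smul_eq_mul]
    · intro i _ hij
      simp [Matrix.one_apply_ne hij]
    · simp

/-- Any local holomorphic frame computes `φ`. -/
theorem phi_eq_phiInFrame (hf : HolAt f x)
    {e : Cn N → Fin (hodgeRank w h (w / 2 + 1)) → VC W} (he : IsHolFrameAt f (w / 2 + 1) e x)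
    (v : Fin r → W) : phi w h B v N f x = phiInFrame v f e x := by
  rw [phi, ofFrames, dif_pos hf]
  exact phiInFrame_frame_change hf he (Classical.choose_spec (hf (w / 2 + 1))) v

/-- The frame chosen in the definition may vary from point to point; replacing all these choices by
one frame near x is what makes φ differentiable. -/
theorem phi_eventuallyEq (hf : HolAt f x)
    {e : Cn N → Fin (hodgeRank w h (w / 2 + 1)) → VC W} (he : IsHolFrameAt f (w / 2 + 1) e x)
    (v : Fin r → W) : phi w h B v N f =ᶠ[nhds x] phiInFrame v f e := by
  filter_upwards [hf.eventually, he.eventually] with y hy hey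
  exact phi_eq_phiInFrame hy hey v

theorem contDiffAt_phiInFrame (hf : HolAt f x)
    {e : Cn N → Fin (hodgeRank w h (w / 2 + 1)) → VC W} (he : IsHolFrameAt f (w / 2 + 1) e x)
    (v : Fin r → W) : ContDiffAt ℝ ∞ (phiInFrame v f e) x :=
  contDiffAt_const.fun_smul (𝕜' := ℂ) (hf.koszulAt he v).contDiffAt_koszulChernForm

theorem extd_phi (hf : HolAt f x) (v : Fin r → W) : extd (phi w h B v N f) x = 0 := by
  obtain ⟨e, he⟩ := hf (w / 2 + 1)
  have hK := hf.koszulAt he v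
  have h1 := extd_const_smul (Real.exp (-Real.pi * ∑ i, B (v i) (v i)) : ℂ)
    (hK.contDiffAt_koszulChernForm.differentiableAt (by simp))
  rw [extd_congr (phi_eventuallyEq hf he v)]
  refine h1.trans ?_
  rw [hK.extd_koszulChernForm, smul_zero]

theorem IsHolFrameAt.comp {M : ℕ} {f' : Cn M → PeriodDomain B w h} {t : Cn M → Cn N} {y : Cn M}
    (ht : AnalyticAt ℂ t y) (hf' : f' =ᶠ[nhds y] f ∘ t) {p : ℕ}
    {e : Cn N → Fin (hodgeRank w h p) → VC W} (he : IsHolFrameAt f p e (t y)) :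
    IsHolFrameAt f' p (fun z => e (t z)) y := by
  filter_upwards [ht.eventually_analyticAt, ht.continuousAt.eventually he, hf'] with z htz hez hfz
  refine ⟨fun a l => (hez.1 a l).comp htz, hez.2.1, ?_⟩
  rw [hez.2.2, hfz]
  rfl

theorem phi_pullback {M : ℕ} {f' : Cn M → PeriodDomain B w h} {t : Cn M → Cn N} {y : Cn M}
    (ht : AnalyticAt ℂ t y) (hf : HolAt f (t y)) (hf' : f' =ᶠ[nhds y] f ∘ t) (v : Fin r → W) :
    phi w h B v M f' y = extPullback (fderiv ℝ t y) (phi w h B v N f (t y)) := by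
  obtain ⟨e, he⟩ := hf (w / 2 + 1)
  have hfol : HolAt f' y := fun p => by
    obtain ⟨e, he⟩ := hf p
    exact ⟨_, he.comp ht hf'⟩
  have hK := hf.koszulAt he v
  have hK' := hfol.koszulAt (he.comp ht hf') v
  rw [phi_eq_phiInFrame hfol (he.comp ht hf'), phi_eq_phiInFrame hf he, phiInFrame_eq,
    phiInFrame_eq, map_smul, ← hK.koszulChernForm_pullback
      (ht.eventually_analyticAt.mono fun z hz => hz.contDiffAt)]
  refine congrArg (fun α : Ext _ => (_ : ℂ) • α) ?_
  refine (koszulChernForm_congr hK' ?_ (Filter.EventuallyEq.refl _ _)).symm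
  filter_upwards [hf'] with z hz
  congr 1
  ext a b
  rw [hodgeGram_apply, hodgeGram_apply, hz]
  rfl

theorem isDifferentialForm_phi (v : Fin r → W) : IsDifferentialForm (phi w h B v) := by
  refine ⟨fun N f x hf => ?_, fun N M f f' t y ht hf hf' => phi_pullback ht hf hf' v⟩
  obtain ⟨e, he⟩ := hf (w / 2 + 1)
  exact smoothFormAt_of_contDiffAt
    ((contDiffAt_phiInFrame hf he v).congr_of_eventuallyEq (phi_eventuallyEq hf he v))

theorem IsHolFrameAt.act (g : OrthGroup B) {p : ℕ} {e : Cn N → Fin (hodgeRank w h p) → VC W}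
    (he : IsHolFrameAt f p e x) :
    IsHolFrameAt (act g ∘ f) p (fun y a => autC g.1 (e y a)) x := by
  filter_upwards [he] with y hy
  refine ⟨fun a l => hy.1 a (l ∘ₗ (autC g.1).toLinearMap), ?_, ?_⟩
  · exact hy.2.1.map' (autC g.1).toLinearMap (autC g.1).ker
  · change _ = ((f y).toHodgeStructure.act g.1).F p
    rw [HodgeStructure.act_F, ← hy.2.2, Submodule.map_span, ← Set.range_comp]
    rfl

/-- The automorphism carries a frame to a frame, and commutes with conjugation and the Weil
operators, so the Gram matrix and the section in the new frame are literally the old ones. -/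
theorem phi_act (g : OrthGroup B) (hf : HolAt f x) (v : Fin r → W) :
    phi w h B (fun i => g.1 (v i)) N (act g ∘ f) x = phi w h B v N f x := by
  obtain ⟨e, he⟩ := hf (w / 2 + 1)
  have hfol : HolAt (act g ∘ f) x := fun p => by
    obtain ⟨e, he⟩ := hf p
    exact ⟨_, he.act g⟩
  rw [phi_eq_phiInFrame hfol (he.act g), phi_eq_phiInFrame hf he, phiInFrame_eq, phiInFrame_eq]
  simp only [g.2]
  have h1 : hodgeGram (act g ∘ f) (fun y a => autC g.1 (e y a)) = hodgeGram f e := by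
    funext y
    ext a b
    change 2 * formC B (((f y).toHodgeStructure.act g.1).weil (autC g.1 (e y a)))
      (conjC (autC g.1 (e y b))) = _
    rw [HodgeStructure.act_weil, conjC_autC, formC_autC]
    rfl
  have h2 : hodgeSection B (fun i => g.1 (v i)) (fun y a => autC g.1 (e y a)) =
      hodgeSection B v e := by
    funext y
    rw [hodgeSection, hodgeSection]
    congr 1
    funext i a
    have h3 : (1 : ℂ) ⊗ₜ[ℝ] g.1 (v i) = autC g.1 (1 ⊗ₜ[ℝ] v i) := by simp [autC]
    rw [h3, formC_autC]
  rw [h1, h2]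

theorem extDegree_phi {k : ℕ} (hk : k < 2 * (r * hodgeRank w h (w / 2 + 1))) (hf : HolAt f x)
    (v : Fin r → W) : extDegree k (phi w h B v N f x) = 0 := by
  obtain ⟨e, he⟩ := hf (w / 2 + 1)
  rw [phi_eq_phiInFrame hf he, phiInFrame_eq, extDegree_smul,
    (hf.koszulAt he v).extDegree_koszulChernForm hk, smul_zero]

/-- If `ℱ` is zero then the form is positive definite. -/
theorem pos_of_hodgeRank_eq_zero (hw2 : Even w) (hr : hodgeRank w h (w / 2 + 1) = 0)
    (hf : HolAt f x) {u : W} (hu : u ≠ 0) : 0 < B u u := by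
  obtain ⟨e, he⟩ := hf (w / 2 + 1)
  set z := f x with hz
  have hF : z.F (w / 2 + 1) = ⊥ := by
    have : IsEmpty (Fin (hodgeRank w h (w / 2 + 1))) := by
      rw [hr]
      infer_instance
    rw [← he.self_of_nhds.2.2, Set.range_eq_empty, Submodule.span_empty]
  obtain ⟨m, hm⟩ := hw2
  -- Pieces above the middle lie in the zero space F^{w/2+1}, and pieces below are conjugate to
  -- those above. On the middle piece the Weil operator is the identity.
  have hcomp : ∀ q : Fin (w + 1), (q : ℕ) ≠ w / 2 → ∀ a ∈ z.comp q, a = 0 := by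
    intro q hq a ha
    by_cases hlt : w / 2 + 1 ≤ (q : ℕ)
    · have := z.mem_F_of_mem hlt ha
      rwa [hF, Submodule.mem_bot] at this
    · have := z.mem_F_of_mem (p := w / 2 + 1) (by rw [Fin.val_rev]; omega) (z.conj_mem q a ha)
      rw [hF, Submodule.mem_bot] at this
      rw [← conjC_conjC a, this, map_zero]
  have hweil : ∀ a : VC W, z.weil a = a := by
    intro a
    have ha := z.mem_iSup_comp a
    induction ha using Submodule.iSup_induction' with
    | mem q a ha =>
      by_cases hq : (q : ℕ) = w / 2
      · have h0 : 2 * ((q : ℕ) : ℤ) - (w : ℤ) = 0 := by omega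
        rw [z.weil_of_mem ha, h0, zpow_zero, one_smul]
      · rw [hcomp q hq a ha, map_zero]
    | zero => exact map_zero _
    | add a b _ _ ha hb => rw [map_add, ha, hb]
  -- W embeds in its complexification by flatness over ℝ.
  have hne : (1 : ℂ) ⊗ₜ[ℝ] u ≠ 0 := by
    intro h0
    apply hu
    have := Module.Flat.rTensor_preserves_injective_linearMap (M := W)
      (Algebra.linearMap ℝ ℂ) (algebraMap ℝ ℂ).injective
    have h1 : (Algebra.linearMap ℝ ℂ).rTensor W ((1 : ℝ) ⊗ₜ[ℝ] u) = 0 := by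
      simpa using h0
    have h2 := this (h1.trans (map_zero _).symm)
    simpa using congrArg (TensorProduct.lid ℝ W) h2
  have hpos := (z.bilinear₂ _ hne).1
  rw [hweil] at hpos
  simpa [conjC, formC] using hpos

theorem koszulChernForm_sumGram_one {n : ℕ} (H : Cn N → Matrix (Fin n) (Fin n) ℂ) :
    koszulChernForm (fun y => sumGram 1 (H y)) (fun _ => 0) x =
      koszulChernForm H (fun _ => 0) x := by
  -- `Fin (1 * n)` and `Fin n` are different types; a general size m makes the identification a
  -- substitution.
  have key : ∀ {m : ℕ} (hm : m = n) (H' : Cn N → Matrix (Fin m) (Fin m) ℂ),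
      (∀ y i j, H' y i j = H y (Fin.cast hm i) (Fin.cast hm j)) →
      koszulChernForm H' (fun _ => 0) x = koszulChernForm H (fun _ => 0) x := by
    intro m hm H' hH'
    subst hm
    congr 1
    funext y
    ext i j
    exact hH' y i j
  refine key (one_mul n) _ fun y i j => ?_
  have h1 : ∀ i : Fin (1 * n), (finProdFinEquiv.symm i).2 = Fin.cast (one_mul n) i := by
    intro i
    apply Fin.ext
    change (i : ℕ) % n = i
    exact Nat.mod_eq_of_lt (by have := i.2; omega)
  rw [sumGram, if_pos (Subsingleton.elim _ _), h1, h1]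

theorem phi_zero (hf : HolAt f x) : IsUnit (toddDual B w h N f x) ∧
    phi w h B (fun _ : Fin 1 => (0 : W)) N f x =
      topChernDual B w h N f x * Ring.inverse (toddDual B w h N f x) := by
  set e := Classical.choose (hf (w / 2 + 1)) with he_def
  have he : IsHolFrameAt f (w / 2 + 1) e x := Classical.choose_spec (hf (w / 2 + 1))
  have htodd : toddDual B w h N f x = toddForm (fun y => dualGram (hodgeGram f e y)) x := by
    rw [toddDual, ofFrames, dif_pos hf]
  have htop : topChernDual B w h N f x = topChernForm (fun y => dualGram (hodgeGram f e y)) x := by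
    rw [topChernDual, ofFrames, dif_pos hf]
  have hsec : hodgeSection B (fun _ : Fin 1 => (0 : W)) e = fun _ => 0 := by
    funext y a
    simp [hodgeSection, sumSection]
  have hphi : phi w h B (fun _ : Fin 1 => (0 : W)) N f x =
      koszulChernForm (hodgeGram f e) (fun _ => 0) x := by
    rw [phi_eq_phiInFrame hf he, phiInFrame_eq, hsec, koszulChernForm_sumGram_one]
    simp
  obtain ⟨hu, hmul⟩ := koszulChernForm_zero (hf.hodgeGram_eventually he)
    (Filter.Eventually.of_forall fun y => hodgeGram_transpose e y)
  rw [htodd, htop, hphi]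
  refine ⟨hu, ?_⟩
  rw [← hmul, Ring.mul_inverse_cancel_right _ _ hu]

/-- A real orthogonal k gives the constant unitary change of frame `k ⊗ 1` of the sum of r copies.
It preserves the metric and mixes the sections as k mixes the vectors, and the exponential prefactor
depends only on a sum of squares that k preserves. -/
theorem phi_rotate {k : Matrix (Fin r) (Fin r) ℝ} (hk : k ∈ Matrix.orthogonalGroup (Fin r) ℝ)
    (hf : HolAt f x) (v : Fin r → W) :
    phi w h B (fun j => ∑ i, k i j • v i) N f x = phi w h B v N f x := by
  obtain ⟨e, he⟩ := hf (w / 2 + 1)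
  have hk1 : k * k.transpose = 1 := (Matrix.mem_orthogonalGroup_iff (Fin r) ℝ).1 hk
  have hk2 : k.transpose * k = 1 := mul_eq_one_comm.1 hk1
  have hexp : ∑ j, B (∑ i, k i j • v i) (∑ i, k i j • v i) = ∑ i, B (v i) (v i) := by
    have h0 : ∀ j, B (∑ i, k i j • v i) (∑ i, k i j • v i) =
        ∑ i, ∑ i', k i j * (k i' j * B (v i) (v i')) := by
      intro j
      rw [map_sum B, LinearMap.sum_apply]
      refine Finset.sum_congr rfl fun i _ => ?_
      rw [map_sum]
      refine Finset.sum_congr rfl fun i' _ => ?_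
      simp only [map_smul, LinearMap.smul_apply, smul_eq_mul]
      ring
    have h1 : ∀ i i', ∑ j, k i j * (k i' j * B (v i) (v i')) =
        (1 : Matrix (Fin r) (Fin r) ℝ) i i' * B (v i) (v i') := by
      intro i i'
      rw [← hk1, Matrix.mul_apply, Finset.sum_mul]
      exact Finset.sum_congr rfl fun j _ => by rw [Matrix.transpose_apply, mul_assoc]
    rw [Finset.sum_congr rfl fun j _ => h0 j, Finset.sum_comm]
    refine Finset.sum_congr rfl fun i _ => ?_
    rw [Finset.sum_comm, Finset.sum_congr rfl fun i' _ => h1 i i']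
    simp [Matrix.one_apply]
  rw [phi_eq_phiInFrame hf he, phi_eq_phiInFrame hf he, phiInFrame_eq, phiInFrame_eq, hexp]
  refine congrArg (fun α : Ext _ => (_ : ℂ) • α) ?_
  set kc : Matrix (Fin r) (Fin r) ℂ := k.map Complex.ofReal with hkc
  have hkc2 : kc.transpose * kc.map star = 1 := by
    have h1 : kc.map star = kc := by
      ext i j
      simp [hkc]
    have h2 : kc.transpose * kc = (k.transpose * k).map Complex.ofRealHom := by
      rw [Matrix.map_mul]
      rfl
    rw [h1, h2, hk2, Matrix.map_one _ (map_zero _) (map_one _)]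
  have hkcu : IsUnit kc := by
    have h1 : kc * k.transpose.map Complex.ofReal = 1 := by
      have h2 : kc * k.transpose.map Complex.ofReal = (k * k.transpose).map Complex.ofRealHom := by
        rw [Matrix.map_mul]
        rfl
      rw [h2, hk1, Matrix.map_one _ (map_zero _) (map_one _)]
    exact isUnit_iff_exists.2 ⟨_, h1, mul_eq_one_comm.1 h1⟩
  refine (hf.koszulAt he v).koszulChernForm_gauge (hf.koszulAt he _) (g := fun _ => kron kc 1)
    (Filter.Eventually.of_forall fun y => ⟨fun _ _ => contDiffAt_const,
      isUnit_kron hkcu isUnit_one⟩)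
    (Filter.Eventually.of_forall fun y => ?_) (Filter.Eventually.of_forall fun y => ?_)
  · rw [sumGram_eq_kron, kron_map_star, kron_transpose, ← kron_mul, ← kron_mul,
      Matrix.transpose_one, map_star_one, one_mul, mul_one, mul_one, hkc2]
  · rw [hodgeSection, hodgeSection, kron_transpose_mulVec_sumSection]
    congr 1
    funext j b
    rw [TensorProduct.tmul_sum, map_sum]
    refine Finset.sum_congr rfl fun i _ => ?_
    rw [Finset.sum_eq_single b]
    · rw [Matrix.one_apply_eq, mul_one, TensorProduct.tmul_smul, TensorProduct.smul_tmul']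
      have h1 : ((k i j • (1 : ℂ)) ⊗ₜ[ℝ] v i : VC W) = (kc i j) • ((1 : ℂ) ⊗ₜ[ℝ] v i) := by
        rw [TensorProduct.smul_tmul']
        simp [hkc]
      rw [h1, map_smul, smul_eq_mul]
    · intro a _ hab
      simp [Matrix.one_apply_ne hab]
    · simp

end Forms

end PeriodForms

end
-- The main theorem
theorem mainTheorem8 {V : Type*} [AddCommGroup V] [Module ℚ V] [FiniteDimensional ℚ V]
    (Q : LinearMap.BilinForm ℚ V) (hsymm : Q.IsSymm) (hnondeg : Q.Nondegenerate)
    (hpos : ∃ x, 0 < Q x x) (hneg : ∃ x, Q x x < 0)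
    (w : ℕ) (hw : 0 < w) (hw2 : Even w) (h : ℕ → ℕ) (hmid : h (w / 2) ≠ 0)
    (r : ℕ) (hr : 0 < r) (v : Fin r → ℝ ⊗[ℚ] V) :
    -- the form is well defined: any local holomorphic frame computes it
    (∀ (N : ℕ) (f : PeriodForms.Cn N → PeriodForms.PeriodDomain (Q.baseChange ℝ) w h)
      (e : PeriodForms.Cn N → Fin (PeriodForms.hodgeRank w h (w / 2 + 1)) →
        PeriodForms.VC (ℝ ⊗[ℚ] V)) (x : PeriodForms.Cn N),
      PeriodForms.HolAt f x → PeriodForms.IsHolFrameAt f (w / 2 + 1) e x →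
        PeriodForms.phi w h (Q.baseChange ℝ) v N f x = PeriodForms.phiInFrame v f e x) ∧
    -- it is a smooth differential form
    PeriodForms.IsDifferentialForm (PeriodForms.phi w h (Q.baseChange ℝ) v) ∧
    -- it is closed
    PeriodForms.FormEq (PeriodForms.formD (PeriodForms.phi w h (Q.baseChange ℝ) v))
      (fun _ _ _ => 0) ∧
    -- equivariance
    (∀ g : PeriodForms.OrthGroup (Q.baseChange ℝ),
      PeriodForms.FormEq
        (PeriodForms.formPullback (PeriodForms.act g)
          (PeriodForms.phi w h (Q.baseChange ℝ) (fun i => g.1 (v i))))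
        (PeriodForms.phi w h (Q.baseChange ℝ) v)) ∧
    -- vanishing of the components of degree below `2r`
    (∀ k : ℕ, k < 2 * r →
      PeriodForms.FormEq (PeriodForms.formDegree k (PeriodForms.phi w h (Q.baseChange ℝ) v))
        (fun _ _ _ => 0)) ∧
    -- the value at `v = 0`, `r = 1`; the Todd form is invertible
    (∀ (N : ℕ) (f : PeriodForms.Cn N → PeriodForms.PeriodDomain (Q.baseChange ℝ) w h)
      (x : PeriodForms.Cn N), PeriodForms.HolAt f x →
        IsUnit (PeriodForms.toddDual (Q.baseChange ℝ) w h N f x)) ∧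
    PeriodForms.FormEq
      (PeriodForms.phi w h (Q.baseChange ℝ) (fun _ : Fin 1 => (0 : ℝ ⊗[ℚ] V)))
      (fun N f x => PeriodForms.topChernDual (Q.baseChange ℝ) w h N f x *
        Ring.inverse (PeriodForms.toddDual (Q.baseChange ℝ) w h N f x)) ∧
    -- invariance under right multiplication by `SO(r)`
    (∀ k ∈ Matrix.specialOrthogonalGroup (Fin r) ℝ,
      PeriodForms.FormEq
        (PeriodForms.phi w h (Q.baseChange ℝ) (fun j => ∑ i, k i j • v i))
        (PeriodForms.phi w h (Q.baseChange ℝ) v)) := by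
  refine ⟨fun N f e x hf he => PeriodForms.phi_eq_phiInFrame hf he v,
    PeriodForms.isDifferentialForm_phi v, fun N f x hf => PeriodForms.extd_phi hf v,
    fun g N f x hf => PeriodForms.phi_act g hf v, fun k hk N f x hf => ?_,
    fun N f x hf => (PeriodForms.phi_zero hf).1, fun N f x hf => (PeriodForms.phi_zero hf).2,
    fun k hk N f x hf => PeriodForms.phi_rotate (Matrix.mem_specialOrthogonalGroup_iff.1 hk).1
      hf v⟩
  refine PeriodForms.extDegree_phi (hk.trans_le ?_) hf v
  -- The vanishing holds below `2 r · rank ℱ`, so the bound 2r needs only that ℱ is non-zero: a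
  -- rational vector of negative square excludes the positive definite case.
  have hrank : PeriodForms.hodgeRank w h (w / 2 + 1) ≠ 0 := by
    intro h0
    obtain ⟨u, hu⟩ := hneg
    have hQ : (Q.baseChange ℝ) (1 ⊗ₜ[ℚ] u) (1 ⊗ₜ[ℚ] u) = (Q u u : ℝ) := by
      simp [LinearMap.BilinForm.baseChange_tmul]
    have hne : (1 : ℝ) ⊗ₜ[ℚ] u ≠ 0 := by
      intro hz
      rw [hz, map_zero] at hQ
      exact hu.ne (by exact_mod_cast hQ.symm)
    have hpos := PeriodForms.pos_of_hodgeRank_eq_zero hw2 h0 hf hne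
    rw [hQ] at hpos
    exact hu.not_gt (by exact_mod_cast hpos)
  have h1 : r * 1 ≤ r * PeriodForms.hodgeRank w h (w / 2 + 1) :=
    Nat.mul_le_mul_left r (Nat.one_le_iff_ne_zero.2 hrank)
  omega
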